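/- Let $P=\{p_1,\dots,p_n\}$ be a set of $n\ge 2$ points with a distance function $d:P\times P\to\mathbb{R}_{\ge 0}$, i.e. $d(p_i,p_i)=0$ and $d(p_i,p_j)=d(p_j,p_i)>0$ for $i\ne j$ (no triangle inequality is required). For $\alpha\ge 1$, a directed graph $G=(P,E)$ is $\alpha$-shortcut reachable if for all $p_i\neq p_j$ there is an edge $(p_i,p_k)\in E$ with $d(p_k,p_j)<\frac1\alpha d(p_i,p_j)$. For $\tau\ge 0$, it is $\tau$-monotonic if for all $p_i\ne p_j$ there is an edge $(p_i,p_k)\in E$ with $p_k=p_j$ or $d(p_k,p_j)<d(p_i,p_j)-\tau$. Let $\mathsf{OPT}^{\alpha}$ (resp. $\mathsf{OPT}^{\tau}$) be the minimum number of edges of an $\alpha$-shortcut reachable (resp. $\tau$-monotonic) graph on $P$. Algorithms are randomized RAM programs with words of $O(\log n)$ bits and registers for real numbers, where word operations, arithmetic on and comparisons of reals, evaluations of $d$, and draws of a uniformly random word below a given bound take unit time. There are constants $c$ and $\kappa$ such that the following holds for every constant $C$. (1) There are a randomized algorithm and a constant $K$ such that, for every such $P$ and $d$ and every $\alpha\ge1$,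 given $n$, $\alpha$ and access to $d$, with probability at least $1-1/n^{C}$ the algorithm halts within time $K\,m\,(\log m)^{\kappa}$, where $m=\min(n^{2.5},\,n\cdot\mathsf{OPT}^{\alpha})$, and outputs an $\alpha$-shortcut reachable graph with at most $c\log n\cdot\mathsf{OPT}^{\alpha}$ edges. That is, it runs in time $\tilde O(\min(n^{2.5},n\cdot\mathsf{OPT}^{\alpha}))$. (2) There are a randomized algorithm and a constant $K$ such that, for every such $P$ and $d$ and every $\tau\ge0$, given $n$, $\tau$ and access to $d$, with probability at least $1-1/n^{C}$ the algorithm halts within time $K\,m\,(\log m)^{\kappa}$, where $m=\min(n^{2.5},\,n\cdot\mathsf{OPT}^{\tau})$, and outputs a $\tau$-monotonic graph with at most $c\log n\cdot\mathsf{OPT}^{\tau}$ edges. -/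

import Mathlib

open scoped ENNReal

namespace SearchGraph

/-! ## Point sets, distance functions and graphs

The point set is `P = {p_0, …, p_{n-1}}`; a point is given by its index in `Fin n`.  A directed
graph on `P` is given by its finite set of edges. -/

/-- A distance function: zero on the diagonal, symmetric, positive off the diagonal.
The triangle inequality is not required. -/
structure IsDistance {n : ℕ} (d : Fin n → Fin n → ℝ) : Prop where
  self : ∀ i, d i i = 0
  symm : ∀ i j, d j i = d i j
  pos : ∀ i j, i ≠ j → 0 < d i j

/-- The directed graph with edge set `E` is `α`-shortcut reachable: for all `i ≠ j`, the point `i`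
has an out-neighbor `k` with `d k j < (1 / α) * d i j`. -/
def IsShortcutReachable {n : ℕ} (α : ℝ) (d : Fin n → Fin n → ℝ) (E : Finset (Fin n × Fin n)) :
    Prop :=
  ∀ i j, i ≠ j → ∃ k, (i, k) ∈ E ∧ d k j < (1 / α) * d i j

/-- The directed graph with edge set `E` is `τ`-monotonic: for all `i ≠ j`, the point `i` is
joined to `j` by an edge or has an out-neighbor `k` with `d k j < d i j - τ`. -/
def IsMonotonic {n : ℕ} (τ : ℝ) (d : Fin n → Fin n → ℝ) (E : Finset (Fin n × Fin n)) : Prop :=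
  ∀ i j, i ≠ j → ∃ k, (i, k) ∈ E ∧ (k = j ∨ d k j < d i j - τ)

/-- The minimum number of edges of a graph on `Fin n` with the property `good`. -/
noncomputable def minEdges {n : ℕ} (good : Finset (Fin n × Fin n) → Prop) : ℕ :=
  sInf {m | ∃ E, good E ∧ E.card = m}

/-! ## The machine model

A randomized RAM.  Its memory consists of arrays of machine words (of `O(log n)` bits) and arrays
of real numbers, named by the constants of the program and all initially zero; a scalar variable is
an array of which only one cell is used.  A program is a finite text that does not depend on the
input.  Operations on words, operations on and comparisons of reals, memory accesses, evaluations
of the distance function, draws of a uniformly random word below a given bound, and the output of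
one edge take unit time.  There is no way to read off digits of a real number; reals influence the
words only through comparisons. -/

/-- Word expressions. -/
inductive WExpr : Type
  | lit (c : ℕ)
  | read (a : ℕ) (i : WExpr)
  | add (e f : WExpr)
  | sub (e f : WExpr)
  | mul (e f : WExpr)
  | div (e f : WExpr)
  | mod (e f : WExpr)

/-- Real expressions; `dist i j` is a call of the distance function. -/
inductive RExpr : Type
  | lit (c : ℕ)
  | read (a : ℕ) (i : WExpr)
  | dist (i j : WExpr)
  | add (x y : RExpr)
  | sub (x y : RExpr)
  | mul (x y : RExpr)
  | div (x y : RExpr)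

/-- Boolean expressions: comparisons and their combinations. -/
inductive BExpr : Type
  | wlt (e f : WExpr)
  | weq (e f : WExpr)
  | rlt (x y : RExpr)
  | neg (b : BExpr)
  | conj (b c : BExpr)

/-- Programs. -/
inductive Prog : Type
  | skip
  /-- store a word in cell `i` of word array `a` -/
  | wset (a : ℕ) (i e : WExpr)
  /-- store a real in cell `i` of real array `a` -/
  | rset (a : ℕ) (i : WExpr) (x : RExpr)
  /-- store in cell `i` of word array `a` a fresh uniformly random word below `e` -/
  | rand (a : ℕ) (i e : WExpr)
  /-- output the edge from `i` to `j` -/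
  | emit (i j : WExpr)
  | seq (p q : Prog)
  | ite (b : BExpr) (p q : Prog)
  /-- repeat `p` as long as `b` holds -/
  | loop (b : BExpr) (p : Prog)

/-- Memory contents, together with the set of edges that have been output so far. -/
structure State (n : ℕ) : Type where
  word : ℕ → ℕ → ℕ
  real : ℕ → ℕ → ℝ
  out : Finset (Fin n × Fin n)

/-- Value of a word expression when words hold the numbers below `W`.  Sums and products are
taken modulo `W`; subtraction is truncated at zero. -/
def WExpr.eval {n : ℕ} (W : ℕ) (s : State n) : WExpr → ℕ
  | lit c => c % W
  | read a i => s.word a (i.eval W s)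
  | add e f => (e.eval W s + f.eval W s) % W
  | sub e f => e.eval W s - f.eval W s
  | mul e f => (e.eval W s * f.eval W s) % W
  | div e f => e.eval W s / f.eval W s
  | mod e f => e.eval W s % f.eval W s

/-- Value of a real expression (a call of the distance function on something that is not a pair
of points returns zero). -/
noncomputable def RExpr.eval {n : ℕ} (W : ℕ) (d : Fin n → Fin n → ℝ) (s : State n) : RExpr → ℝ
  | lit c => c
  | read a i => s.real a (i.eval W s)
  | dist i j =>
      if h : i.eval W s < n ∧ j.eval W s < n then d ⟨i.eval W s, h.1⟩ ⟨j.eval W s, h.2⟩ else 0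
  | add x y => x.eval W d s + y.eval W d s
  | sub x y => x.eval W d s - y.eval W d s
  | mul x y => x.eval W d s * y.eval W d s
  | div x y => x.eval W d s / y.eval W d s

/-- Truth of a Boolean expression. -/
def BExpr.Holds {n : ℕ} (W : ℕ) (d : Fin n → Fin n → ℝ) (s : State n) : BExpr → Prop
  | wlt e f => e.eval W s < f.eval W s
  | weq e f => e.eval W s = f.eval W s
  | rlt x y => x.eval W d s < y.eval W d s
  | neg b => ¬ b.Holds W d s
  | conj b c => b.Holds W d s ∧ c.Holds W d s

/-- Time for evaluating a word expression: its number of operations. -/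
def WExpr.cost : WExpr → ℕ
  | lit _ => 1
  | read _ i => 1 + i.cost
  | add e f => 1 + e.cost + f.cost
  | sub e f => 1 + e.cost + f.cost
  | mul e f => 1 + e.cost + f.cost
  | div e f => 1 + e.cost + f.cost
  | mod e f => 1 + e.cost + f.cost

/-- Time for evaluating a real expression. -/
def RExpr.cost : RExpr → ℕ
  | lit _ => 1
  | read _ i => 1 + i.cost
  | dist i j => 1 + i.cost + j.cost
  | add x y => 1 + x.cost + y.cost
  | sub x y => 1 + x.cost + y.cost
  | mul x y => 1 + x.cost + y.cost
  | div x y => 1 + x.cost + y.cost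

/-- Time for evaluating a Boolean expression. -/
def BExpr.cost : BExpr → ℕ
  | wlt e f => 1 + e.cost + f.cost
  | weq e f => 1 + e.cost + f.cost
  | rlt x y => 1 + x.cost + y.cost
  | neg b => 1 + b.cost
  | conj b c => 1 + b.cost + c.cost

/-- The memory after storing the word `v` in cell `i` of word array `a`. -/
def State.setWord {n : ℕ} (s : State n) (a i v : ℕ) : State n :=
  { s with word := Function.update s.word a (Function.update (s.word a) i v) }

/-- The memory after storing the real `x` in cell `i` of real array `a`. -/
noncomputable def State.setReal {n : ℕ} (s : State n) (a i : ℕ) (x : ℝ) : State n :=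
  { s with real := Function.update s.real a (Function.update (s.real a) i x) }

/-- The state after the edge from `i` to `j` has been output (nothing happens if these are not
two points). -/
def State.addEdge {n : ℕ} (s : State n) (i j : ℕ) : State n :=
  if h : i < n ∧ j < n then { s with out := insert (⟨i, h.1⟩, ⟨j, h.2⟩) s.out } else s

/-- The uniform distribution on `{0, …, m - 1}` (the number `0` if `m = 0`). -/
noncomputable def uniformBelow (m : ℕ) : PMF ℕ :=
  PMF.uniformOfFinset (Finset.range (max 1 m)) ⟨0, by simp⟩

/-- Outcome of a (possibly unfinished) execution: `none` if it has not finished, and otherwise the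
elapsed time and the final state. -/
abbrev Outcome (n : ℕ) : Type := Option (ℕ × State n)

/-- Add `t` units of time to an execution. -/
noncomputable def charge {n : ℕ} (t : ℕ) (μ : PMF (Outcome n)) : PMF (Outcome n) :=
  μ.map (Option.map fun r => (t + r.1, r.2))

/-- Sequential composition of executions; times add up. -/
noncomputable def andThen {n : ℕ} (μ : PMF (Outcome n)) (ν : State n → PMF (Outcome n)) :
    PMF (Outcome n) :=
  μ.bind fun
    | none => PMF.pure none
    | some r => charge r.1 (ν r.2)

open Classical in
/-- Distribution of the outcome of executing a program from a state.  The first numerical argument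
after the distance function bounds the depth of the recursion, beyond which the execution counts
as unfinished; it has no other influence on the outcome. -/
noncomputable def exec {n : ℕ} (W : ℕ) (d : Fin n → Fin n → ℝ) :
    ℕ → Prog → State n → PMF (Outcome n)
  | 0, _, _ => PMF.pure none
  | _ + 1, .skip, s => PMF.pure (some (1, s))
  | _ + 1, .wset a i e, s =>
      PMF.pure (some (1 + i.cost + e.cost, s.setWord a (i.eval W s) (e.eval W s)))
  | _ + 1, .rset a i x, s =>
      PMF.pure (some (1 + i.cost + x.cost, s.setReal a (i.eval W s) (x.eval W d s)))
  | _ + 1, .rand a i e, s =>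
      (uniformBelow (e.eval W s)).map fun v =>
        some (1 + i.cost + e.cost, s.setWord a (i.eval W s) v)
  | _ + 1, .emit i j, s =>
      PMF.pure (some (1 + i.cost + j.cost, s.addEdge (i.eval W s) (j.eval W s)))
  | f + 1, .seq p q, s => charge 1 (andThen (exec W d f p s) (exec W d f q))
  | f + 1, .ite b p q, s =>
      charge (1 + b.cost) (if b.Holds W d s then exec W d f p s else exec W d f q s)
  | f + 1, .loop b p, s =>
      charge (1 + b.cost)
        (if b.Holds W d s then andThen (exec W d f p s) (exec W d f (.loop b p))
         else PMF.pure (some (0, s)))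

/-- Initial state: cell `0` of word array `0` holds the number `n` of points, cell `0` of real
array `0` holds the real parameter `a`, everything else is zero, and there is no output yet. -/
noncomputable def State.init (n W : ℕ) (a : ℝ) : State n where
  word := fun x i => if x = 0 ∧ i = 0 then n % W else 0
  real := fun x i => if x = 0 ∧ i = 0 then a else 0
  out := ∅

/-- A randomized algorithm: a program, and the number `k` such that on inputs of `n` points it
works with words of `k * Nat.size n` bits, where `Nat.size n` is the number of bits of `n`. -/
structure Algorithm : Type where
  code : Prog
  wordFactor : ℕ

/-- The probability that the algorithm, on the distance function `d` and the real parameter `a`,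
halts after at most `T` units of time and that the graph it has output has the property `good`. -/
noncomputable def Algorithm.successProb (A : Algorithm) {n : ℕ} (d : Fin n → Fin n → ℝ) (a T : ℝ)
    (good : Finset (Fin n × Fin n) → Prop) : ℝ≥0∞ :=
  let W := 2 ^ (A.wordFactor * Nat.size n)
  ⨆ f : ℕ, (exec W d f A.code (State.init n W a)).toOuterMeasure
    {o | ∃ (t : ℕ) (s : State n), o = some (t, s) ∧ (t : ℝ) ≤ T ∧ good s.out}

/-- The running time `min (n ^ 2.5, n * opt)`, times the `κ`-th power of its logarithm. -/
noncomputable def timeBound (κ n opt : ℕ) : ℝ :=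
  let m := min ((n : ℝ) ^ (5 / 2 : ℝ)) ((n : ℝ) * (opt : ℝ))
  m * Real.log m ^ κ

end SearchGraph

open SearchGraph

/-! For a fixed source `i`, choosing out-neighbors is a set cover problem: `x` takes care of `j`
when `Cv i x j`, and every `j ≠ i` has to be taken care of. Different sources do not interact, so
the optimum is the sum of the optima `k_i` of the sources, and a cover of size `O(k_i log n)` for
each `i` suffices. The difficulty is time: up to logarithms only `n * min(k_i, √n)` may be spent on
one source, while its incidence relation has `n²` entries.

Small `k_i` is treated by sampling, with guesses `g = 1, 2, 4, …` for the optimum. In a pass with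
guess `g`, every candidate `x` is tested on `O(g log n)` random points from the list of the `u`
points uncovered at the start of the pass, and is taken if enough of them are hit. With high
probability every candidate taken gains at least `u / (24 g)` points, so that at most `24 g` are
taken, and every candidate rejected would gain at most `u / g` (`spec_sampleHits`, `spec_onePass`).
If `g ≥ 2 k_i`, summing the gains over an optimal cover shows that at most `u / 2` points are left
(`two_mul_card_uncovered_le`), so logarithmically many passes finish (`spec_passes`). Guesses above
`w = ⌈√n⌉` are not tried; since the guesses grow geometrically, the last one determines time and
output (`spec_guesses`).

If points remain uncovered, then `k_i > w / 4`. For this case the `w` nearest points of every `j`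
are computed once for all sources, in time `O(n²)`, and only the at most `n w` pairs `(x, j)` with
`x` near `j` are used. Both relations are closed towards `j` (`IsClosedTowards`): with `x`, every
point at least as near to `j` takes care of `j`. Hence for each `j`, either a member of an optimal
cover is among its near points, or all `w` near points take care of it. Double counting
(`card_uncovered_mul_le`) shows that if no incidence list has more than `θ` uncovered points, then
at most `θ (k_i + w)` points are uncovered. So each level of a threshold greedy algorithm outputs
`O(k_i + w) = O(k_i)` edges (`spec_greedy`).

Altogether the time is `n ∑ min(k_i, w)` up to logarithms, and this sum is at most the optimum and
at most `n w` (`cost_le_timeBound`).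

The programs are verified in a quantitative Hoare logic. `Run` bounds the expected error of an
execution with a time budget, where exceeding the budget is an error; `Spec` adds a postcondition
and a time bound. Potentials account for amortized time, and exponential potentials give the tail
bounds for the sampling. -/

namespace SearchGraph

/-! ## Expectations over discrete distributions -/

/-- The expectation of `g` under `μ`. -/
noncomputable def expect {α : Type*} (μ : PMF α) (g : α → ℝ≥0∞) : ℝ≥0∞ := ∑' o, μ o * g o

theorem expect_pure {α : Type*} (a : α) (g : α → ℝ≥0∞) : expect (PMF.pure a) g = g a := by
  unfold expect
  rw [tsum_eq_single a]
  · simp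
  · intro b hb; simp [hb]

theorem expect_bind {α β : Type*} (μ : PMF α) (ν : α → PMF β) (g : β → ℝ≥0∞) :
    expect (μ.bind ν) g = expect μ (fun a => expect (ν a) g) := by
  unfold expect
  simp only [PMF.bind_apply, ← ENNReal.tsum_mul_right, ← ENNReal.tsum_mul_left]
  rw [ENNReal.tsum_comm]
  simp only [mul_assoc]

theorem expect_map {α β : Type*} (μ : PMF α) (f : α → β) (g : β → ℝ≥0∞) :
    expect (μ.map f) g = expect μ (fun a => g (f a)) := by
  unfold PMF.map
  rw [expect_bind]
  simp [Function.comp, expect_pure]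

theorem expect_mono {α : Type*} {μ : PMF α} {g h : α → ℝ≥0∞} (H : ∀ a, μ a ≠ 0 → g a ≤ h a) :
    expect μ g ≤ expect μ h := by
  refine ENNReal.tsum_le_tsum fun a => ?_
  by_cases ha : μ a = 0
  · simp [ha]
  · gcongr; exact H a ha

theorem expect_const {α : Type*} (μ : PMF α) (c : ℝ≥0∞) : expect μ (fun _ => c) = c := by
  unfold expect
  rw [ENNReal.tsum_mul_right, μ.tsum_coe, one_mul]

theorem expect_add_const_le {α : Type*} (μ : PMF α) (g : α → ℝ≥0∞) (c : ℝ≥0∞) :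
    expect μ (fun a => g a + c) = expect μ g + c := by
  unfold expect
  simp only [mul_add]
  rw [ENNReal.tsum_add, ENNReal.tsum_mul_right, μ.tsum_coe, one_mul]

theorem uniformBelow_apply_of_lt {m v : ℕ} (h : v ∈ Finset.range (max 1 m)) :
    uniformBelow m v = ((max 1 m : ℕ) : ℝ≥0∞)⁻¹ :=
  (PMF.uniformOfFinset_apply_of_mem _ h).trans (by rw [Finset.card_range])

theorem uniformBelow_apply_of_not_lt {m v : ℕ} (h : v ∉ Finset.range (max 1 m)) :
    uniformBelow m v = 0 :=
  PMF.uniformOfFinset_apply_of_notMem _ h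

theorem expect_uniformBelow (m : ℕ) (g : ℕ → ℝ≥0∞) :
    expect (uniformBelow m) g = (∑ v ∈ Finset.range (max 1 m), g v) / (max 1 m : ℕ) := by
  unfold expect
  rw [tsum_eq_sum (s := Finset.range (max 1 m))]
  · rw [ENNReal.div_eq_inv_mul, Finset.mul_sum]
    exact Finset.sum_congr rfl fun v hv => by rw [uniformBelow_apply_of_lt hv]
  · intro v hv
    rw [uniformBelow_apply_of_not_lt hv, zero_mul]

/-! ## Executions with a time budget

A post-potential `Φ : ℕ → State n → ℝ≥0∞` assigns an error to the remaining time budget and the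
final state; running out of budget counts as error `1`. -/

/-- The error of an outcome when the budget is `B` and the post-potential is `Φ`. -/
noncomputable def outcomeError {n : ℕ} (B : ℕ) (Φ : ℕ → State n → ℝ≥0∞) : Outcome n → ℝ≥0∞
  | none => 1
  -- The cap at `1` allows post-potentials that are arbitrary sums of error terms.
  | some r => if r.1 ≤ B then min 1 (Φ (B - r.1) r.2) else 1

/-- With budget `B`, the program `p` started in `s` has expected error at most `ε`. -/
def Run {n : ℕ} (W : ℕ) (d : Fin n → Fin n → ℝ) (p : Prog) (s : State n) (B : ℕ)
    (Φ : ℕ → State n → ℝ≥0∞) (ε : ℝ≥0∞) : Prop :=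
  -- Every level of the recursion costs at least one unit of time, so an execution within budget `B`
  -- never needs depth greater than `B`.
  ∀ f, B ≤ f → expect (exec W d f p s) (outcomeError B Φ) ≤ ε

open Classical in
/-- The indicator of the failure of a postcondition. -/
noncomputable def failure (P : Prop) : ℝ≥0∞ := if P then 0 else 1

theorem failure_true {P : Prop} (h : P) : failure P = 0 := if_pos h

theorem failure_le_one (P : Prop) : failure P ≤ 1 := by
  unfold failure; split_ifs <;> simp

theorem of_failure_lt_one {P : Prop} (h : failure P < 1) : P := by
  by_contra hP; simp [failure, hP] at h

theorem failure_mono {P Q : Prop} (h : Q → P) : failure P ≤ failure Q := by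
  by_cases hQ : Q
  · simp [failure, hQ, h hQ]
  · rw [failure, failure, if_neg hQ]; split_ifs <;> simp

/-! ### Proof rules for executions with a budget -/

section Rules

variable {n W : ℕ} {d : Fin n → Fin n → ℝ}

theorem outcomeError_le_one (B : ℕ) (Φ : ℕ → State n → ℝ≥0∞) (o : Outcome n) :
    outcomeError B Φ o ≤ 1 := by
  rcases o with _ | r
  · simp [outcomeError]
  · simp only [outcomeError]; split_ifs <;> simp

theorem expect_le_one {α : Type*} (μ : PMF α) {g : α → ℝ≥0∞} (H : ∀ a, g a ≤ 1) :
    expect μ g ≤ 1 := by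
  calc expect μ g ≤ expect μ (fun _ => 1) := expect_mono fun a _ => H a
    _ = 1 := expect_const _ _

theorem Run.of_one_le {p : Prog} {s : State n} {B : ℕ} {Φ : ℕ → State n → ℝ≥0∞} {ε : ℝ≥0∞}
    (h : 1 ≤ ε) : Run W d p s B Φ ε := fun _ _ =>
  (expect_le_one _ fun _ => outcomeError_le_one _ _ _).trans h

theorem expect_charge {t B : ℕ} (h : t ≤ B) (μ : PMF (Outcome n)) (Φ : ℕ → State n → ℝ≥0∞) :
    expect (charge t μ) (outcomeError B Φ) = expect μ (outcomeError (B - t) Φ) := by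
  unfold charge
  rw [expect_map]
  congr 1
  funext o
  rcases o with _ | r
  · rfl
  · simp only [Option.map, outcomeError]
    have h1 : (t + r.1 ≤ B) ↔ (r.1 ≤ B - t) := by omega
    have h2 : B - (t + r.1) = B - t - r.1 := by omega
    simp only [h1, h2]

/-- States with `1 ≤ Ψ b s` need no analysis, because an error never exceeds `1`. This is why the
later rules may assume `Ψ b s < 1`, which through `of_failure_lt_one` yields the intermediate
assertion. -/
theorem expect_andThen_le {B : ℕ} {μ : PMF (Outcome n)} {ν : State n → PMF (Outcome n)}
    {Φ Ψ : ℕ → State n → ℝ≥0∞}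
    (H : ∀ b s, b ≤ B → Ψ b s < 1 → expect (ν s) (outcomeError b Φ) ≤ Ψ b s) :
    expect (andThen μ ν) (outcomeError B Φ) ≤ expect μ (outcomeError B Ψ) := by
  unfold andThen
  rw [expect_bind]
  refine expect_mono fun o _ => ?_
  rcases o with _ | r
  · simp [expect_pure, outcomeError]
  · simp only [outcomeError]
    split_ifs with hr
    · rw [expect_charge hr]
      by_cases h1 : Ψ (B - r.1) r.2 < 1
      · rw [min_eq_right h1.le]
        exact H _ _ (Nat.sub_le _ _) h1
      · rw [min_eq_left (not_lt.mp h1)]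
        exact expect_le_one _ fun _ => outcomeError_le_one _ _ _
    · exact expect_le_one _ fun _ => outcomeError_le_one _ _ _

theorem Run.mono {p : Prog} {s : State n} {B : ℕ} {Φ Ψ : ℕ → State n → ℝ≥0∞} {ε δ : ℝ≥0∞}
    (h : Run W d p s B Φ ε) (h1 : ∀ b s', b ≤ B → min 1 (Ψ b s') ≤ Φ b s') (h2 : ε ≤ δ) :
    Run W d p s B Ψ δ := fun f hf => by
  refine le_trans (expect_mono fun o _ => ?_) ((h f hf).trans h2)
  rcases o with _ | r
  · simp [outcomeError]
  · simp only [outcomeError]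
    split_ifs
    · exact le_min (min_le_left _ _) (h1 _ _ (Nat.sub_le _ _))
    · exact le_rfl

/-- Carries the error allotted to the rest of a program past the execution of `p`. -/
theorem Run.add_const {p : Prog} {s : State n} {B : ℕ} {Φ : ℕ → State n → ℝ≥0∞} {ε : ℝ≥0∞}
    (h : Run W d p s B Φ ε) (c : ℝ≥0∞) : Run W d p s B (fun b s' => Φ b s' + c) (ε + c) :=
  fun f hf => by
  calc _ ≤ expect (exec W d f p s) (fun o => outcomeError B Φ o + c) := by
        refine expect_mono fun o _ => ?_
        rcases o with _ | r
        · simp [outcomeError]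
        · simp only [outcomeError]
          split_ifs
          · rcases le_total 1 (Φ (B - r.1) r.2) with h1 | h1
            · rw [min_eq_left h1]; exact (min_le_left _ _).trans le_self_add
            · rw [min_eq_right h1]; exact min_le_right _ _
          · exact le_self_add
    _ = expect (exec W d f p s) (outcomeError B Φ) + c := expect_add_const_le _ _ _
    _ ≤ _ := by gcongr; exact h f hf

theorem run_skip {s : State n} {B : ℕ} {Φ : ℕ → State n → ℝ≥0∞} (h : 1 ≤ B) :
    Run W d .skip s B Φ (Φ (B - 1) s) := fun f hf => by
  obtain ⟨f, rfl⟩ : ∃ f', f = f' + 1 := ⟨f - 1, by omega⟩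
  rw [exec, expect_pure]
  simp [outcomeError, h]

theorem run_wset {s : State n} {B a : ℕ} {i e : WExpr} {Φ : ℕ → State n → ℝ≥0∞}
    (h : 1 + i.cost + e.cost ≤ B) :
    Run W d (.wset a i e) s B Φ
      (Φ (B - (1 + i.cost + e.cost)) (s.setWord a (i.eval W s) (e.eval W s))) := fun f hf => by
  obtain ⟨f, rfl⟩ : ∃ f', f = f' + 1 := ⟨f - 1, by omega⟩
  rw [exec, expect_pure]
  simp [outcomeError, h]

theorem run_rset {s : State n} {B a : ℕ} {i : WExpr} {x : RExpr} {Φ : ℕ → State n → ℝ≥0∞}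
    (h : 1 + i.cost + x.cost ≤ B) :
    Run W d (.rset a i x) s B Φ
      (Φ (B - (1 + i.cost + x.cost)) (s.setReal a (i.eval W s) (x.eval W d s))) := fun f hf => by
  obtain ⟨f, rfl⟩ : ∃ f', f = f' + 1 := ⟨f - 1, by omega⟩
  rw [exec, expect_pure]
  simp [outcomeError, h]

theorem run_emit {s : State n} {B : ℕ} {i j : WExpr} {Φ : ℕ → State n → ℝ≥0∞}
    (h : 1 + i.cost + j.cost ≤ B) :
    Run W d (.emit i j) s B Φ
      (Φ (B - (1 + i.cost + j.cost)) (s.addEdge (i.eval W s) (j.eval W s))) := fun f hf => by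
  obtain ⟨f, rfl⟩ : ∃ f', f = f' + 1 := ⟨f - 1, by omega⟩
  rw [exec, expect_pure]
  simp [outcomeError, h]

theorem run_rand {s : State n} {B a : ℕ} {i e : WExpr} {Φ : ℕ → State n → ℝ≥0∞}
    (h : 1 + i.cost + e.cost ≤ B) :
    Run W d (.rand a i e) s B Φ
      ((∑ v ∈ Finset.range (max 1 (e.eval W s)),
        Φ (B - (1 + i.cost + e.cost)) (s.setWord a (i.eval W s) v)) / (max 1 (e.eval W s) : ℕ)) :=
  fun f hf => by
  obtain ⟨f, rfl⟩ : ∃ f', f = f' + 1 := ⟨f - 1, by omega⟩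
  rw [exec, expect_map, expect_uniformBelow]
  refine ENNReal.div_le_div_right (Finset.sum_le_sum fun v _ => ?_) _
  simp [outcomeError, h]

theorem run_seq {p q : Prog} {s : State n} {B : ℕ} {Φ Ψ : ℕ → State n → ℝ≥0∞} {ε : ℝ≥0∞}
    (hB : 1 ≤ B) (hp : Run W d p s (B - 1) Ψ ε)
    (hq : ∀ b s', b ≤ B - 1 → Ψ b s' < 1 → Run W d q s' b Φ (Ψ b s')) :
    Run W d (.seq p q) s B Φ ε := fun f hf => by
  obtain ⟨f, rfl⟩ : ∃ f', f = f' + 1 := ⟨f - 1, by omega⟩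
  rw [exec, expect_charge hB]
  exact (expect_andThen_le fun b s' hb h1 => hq b s' hb h1 f (by omega)).trans (hp f (by omega))

theorem run_ite {b : BExpr} {p q : Prog} {s : State n} {B : ℕ} {Φ : ℕ → State n → ℝ≥0∞} {ε : ℝ≥0∞}
    (hB : 1 + b.cost ≤ B) (hp : b.Holds W d s → Run W d p s (B - (1 + b.cost)) Φ ε)
    (hq : ¬ b.Holds W d s → Run W d q s (B - (1 + b.cost)) Φ ε) :
    Run W d (.ite b p q) s B Φ ε := fun f hf => by
  obtain ⟨f, rfl⟩ : ∃ f', f = f' + 1 := ⟨f - 1, by omega⟩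
  rw [exec, expect_charge hB]
  split_ifs with h
  · exact hp h f (by omega)
  · exact hq h f (by omega)

/-- The rule for loops: `J` is the error as a function of the remaining budget and the state
before an evaluation of the guard. -/
theorem run_loop {g : BExpr} {p : Prog} {Φ J : ℕ → State n → ℝ≥0∞}
    (H : ∀ b s, J b s < 1 → 1 + g.cost ≤ b ∧
      (g.Holds W d s → Run W d p s (b - (1 + g.cost)) J (J b s)) ∧
      (¬ g.Holds W d s → Φ (b - (1 + g.cost)) s ≤ J b s)) (B : ℕ) (s : State n) :
    Run W d (.loop g p) s B Φ (J B s) := by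
  -- Each evaluation of the guard consumes budget, so the budget itself serves as termination
  -- measure.
  induction B using Nat.strong_induction_on generalizing s with
  | _ B ih =>
    by_cases hJ : J B s < 1
    · obtain ⟨h1, h2, h3⟩ := H B s hJ
      intro f hf
      obtain ⟨f, rfl⟩ : ∃ f', f = f' + 1 := ⟨f - 1, by omega⟩
      rw [exec, expect_charge h1]
      split_ifs with h
      · refine (expect_andThen_le fun b s' hb _ => ?_).trans (h2 h f (by omega))
        exact ih b (by omega) s' f (by omega)
      · rw [expect_pure]
        simpa [outcomeError] using Or.inr (h3 h)
    · exact Run.of_one_le (not_lt.mp hJ)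

end Rules

/-! ## Frame conditions -/

/-- The word arrays a program may write to. -/
def Prog.mods : Prog → List ℕ
  | .skip => []
  | .wset a _ _ => [a]
  | .rset _ _ _ => []
  | .rand a _ _ => [a]
  | .emit _ _ => []
  | .seq p q => p.mods ++ q.mods
  | .ite _ p q => p.mods ++ q.mods
  | .loop _ p => p.mods

/-- The program does not write to real arrays. -/
def Prog.keepsReals : Prog → Bool
  | .skip => true
  | .wset _ _ _ => true
  | .rset _ _ _ => false
  | .rand _ _ _ => true
  | .emit _ _ => true
  | .seq p q => p.keepsReals && q.keepsReals
  | .ite _ p q => p.keepsReals && q.keepsReals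
  | .loop _ p => p.keepsReals

/-- The program has no output. -/
def Prog.silent : Prog → Bool
  | .skip => true
  | .wset _ _ _ => true
  | .rset _ _ _ => true
  | .rand _ _ _ => true
  | .emit _ _ => false
  | .seq p q => p.silent && q.silent
  | .ite _ p q => p.silent && q.silent
  | .loop _ p => p.silent

/-- What an execution of `p` leading from `s` to `s'` leaves unchanged. -/
structure Frame {n : ℕ} (p : Prog) (s s' : State n) : Prop where
  word : ∀ a, a ∉ p.mods → s'.word a = s.word a
  real : p.keepsReals = true → s'.real = s.real
  out : p.silent = true → s'.out = s.out
  out_subset : s.out ⊆ s'.out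

section FrameRules

variable {n W : ℕ} {d : Fin n → Fin n → ℝ}

theorem Frame.refl (p : Prog) (s : State n) : Frame p s s :=
  ⟨fun _ _ => rfl, fun _ => rfl, fun _ => rfl, subset_rfl⟩

theorem Frame.trans {p : Prog} {s s' s'' : State n} (h : Frame p s s') (h' : Frame p s' s'') :
    Frame p s s'' :=
  ⟨fun a ha => (h'.word a ha).trans (h.word a ha), fun hp => (h'.real hp).trans (h.real hp),
    fun hp => (h'.out hp).trans (h.out hp), h.out_subset.trans h'.out_subset⟩

theorem Frame.weaken {p q : Prog} {s s' : State n} (h : Frame p s s')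
    (h1 : ∀ a, a ∈ p.mods → a ∈ q.mods) (h2 : q.keepsReals = true → p.keepsReals = true)
    (h3 : q.silent = true → p.silent = true) : Frame q s s' :=
  ⟨fun a ha => h.word a fun h' => ha (h1 a h'), fun hq => h.real (h2 hq), fun hq => h.out (h3 hq),
    h.out_subset⟩

theorem Frame.seq_left {p q : Prog} {s s' : State n} (h : Frame p s s') : Frame (.seq p q) s s' :=
  h.weaken (fun a ha => by simp [Prog.mods, ha]) (fun h => by simp_all [Prog.keepsReals])
    (fun h => by simp_all [Prog.silent])

theorem Frame.seq_right {p q : Prog} {s s' : State n} (h : Frame q s s') : Frame (.seq p q) s s' :=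
  h.weaken (fun a ha => by simp [Prog.mods, ha]) (fun h => by simp_all [Prog.keepsReals])
    (fun h => by simp_all [Prog.silent])

theorem Frame.ite_left {b : BExpr} {p q : Prog} {s s' : State n} (h : Frame p s s') :
    Frame (.ite b p q) s s' :=
  h.weaken (fun a ha => by simp [Prog.mods, ha]) (fun h => by simp_all [Prog.keepsReals])
    (fun h => by simp_all [Prog.silent])

theorem Frame.ite_right {b : BExpr} {p q : Prog} {s s' : State n} (h : Frame q s s') :
    Frame (.ite b p q) s s' :=
  h.weaken (fun a ha => by simp [Prog.mods, ha]) (fun h => by simp_all [Prog.keepsReals])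
    (fun h => by simp_all [Prog.silent])

theorem Frame.loop {b : BExpr} {p : Prog} {s s' : State n} (h : Frame p s s') :
    Frame (.loop b p) s s' :=
  h.weaken (fun a ha => by simpa [Prog.mods] using ha) (fun h => by simpa [Prog.keepsReals] using h)
    (fun h => by simpa [Prog.silent] using h)

theorem frame_setWord {p : Prog} {s : State n} {a : ℕ} (ha : a ∈ p.mods) (i v : ℕ) :
    Frame p s (s.setWord a i v) :=
  ⟨fun b hb => by
    have : b ≠ a := fun h => hb (h ▸ ha)
    simp [State.setWord, this], fun _ => rfl, fun _ => rfl, subset_rfl⟩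

theorem out_subset_addEdge (s : State n) (i j : ℕ) : s.out ⊆ (s.addEdge i j).out := by
  unfold State.addEdge
  split_ifs
  · exact Finset.subset_insert _ _
  · exact subset_rfl

theorem word_addEdge (s : State n) (i j : ℕ) : (s.addEdge i j).word = s.word := by
  unfold State.addEdge; split_ifs <;> rfl

theorem real_addEdge (s : State n) (i j : ℕ) : (s.addEdge i j).real = s.real := by
  unfold State.addEdge; split_ifs <;> rfl

theorem charge_ne_zero {t t' : ℕ} {μ : PMF (Outcome n)} {s' : State n}
    (h : charge t μ (some (t', s')) ≠ 0) : ∃ t'', μ (some (t'', s')) ≠ 0 := by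
  rw [charge, ← PMF.mem_support_iff, PMF.mem_support_map_iff] at h
  obtain ⟨o, ho, h⟩ := h
  rcases o with _ | r
  · simp at h
  · simp only [Option.map, Option.some.injEq, Prod.mk.injEq] at h
    exact ⟨r.1, by rw [← h.2]; exact ho⟩

theorem andThen_ne_zero {t : ℕ} {μ : PMF (Outcome n)} {ν : State n → PMF (Outcome n)}
    {s' : State n} (h : andThen μ ν (some (t, s')) ≠ 0) :
    ∃ t1 s1 t2, μ (some (t1, s1)) ≠ 0 ∧ ν s1 (some (t2, s')) ≠ 0 := by
  rw [andThen, ← PMF.mem_support_iff, PMF.mem_support_bind_iff] at h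
  obtain ⟨o, ho, h⟩ := h
  rcases o with _ | r
  · simp at h
  · obtain ⟨t2, h2⟩ := charge_ne_zero h
    exact ⟨r.1, r.2, t2, ho, h2⟩

theorem pure_some_ne_zero {t t' : ℕ} {s s' : State n}
    (h : (PMF.pure (some (t, s)) : PMF (Outcome n)) (some (t', s')) ≠ 0) : s' = s := by
  by_contra hs
  simp [hs] at h

/-- Holds for every state reached with positive probability. Specifications therefore only mention
what a program changes; the rest follows from the syntactic list `Prog.mods`. -/
theorem exec_frame {f : ℕ} {p : Prog} {s s' : State n} {t : ℕ}
    (h : exec W d f p s (some (t, s')) ≠ 0) : Frame p s s' := by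
  induction f generalizing p s s' t with
  | zero => simp [exec] at h
  | succ f ih =>
    cases p with
    | skip => rw [exec] at h; rw [pure_some_ne_zero h]; exact Frame.refl _ _
    | wset a i e =>
      rw [exec] at h; rw [pure_some_ne_zero h]
      exact frame_setWord (by simp [Prog.mods]) _ _
    | rset a i x =>
      rw [exec] at h; rw [pure_some_ne_zero h]
      exact ⟨fun _ _ => rfl, fun h => by simp [Prog.keepsReals] at h, fun _ => rfl, subset_rfl⟩
    | rand a i e =>
      rw [exec, ← PMF.mem_support_iff, PMF.mem_support_map_iff] at h
      obtain ⟨v, -, h⟩ := h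
      simp only [Option.some.injEq, Prod.mk.injEq] at h
      rw [← h.2]
      exact frame_setWord (by simp [Prog.mods]) _ _
    | emit i j =>
      rw [exec] at h; rw [pure_some_ne_zero h]
      exact ⟨fun _ _ => by rw [word_addEdge], fun _ => by rw [real_addEdge],
        fun h => by simp [Prog.silent] at h, out_subset_addEdge _ _ _⟩
    | seq p q =>
      rw [exec] at h
      obtain ⟨t1, h⟩ := charge_ne_zero h
      obtain ⟨t1, s1, t2, h1, h2⟩ := andThen_ne_zero h
      exact (ih h1).seq_left.trans (ih h2).seq_right
    | ite b p q =>
      rw [exec] at h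
      obtain ⟨t1, h⟩ := charge_ne_zero h
      split_ifs at h
      · exact (ih h).ite_left
      · exact (ih h).ite_right
    | loop b p =>
      rw [exec] at h
      obtain ⟨t1, h⟩ := charge_ne_zero h
      split_ifs at h
      · obtain ⟨t1, s1, t2, h1, h2⟩ := andThen_ne_zero h
        exact (ih h1).loop.trans (ih h2)
      · rw [pure_some_ne_zero h]; exact Frame.refl _ _

theorem Run.frame {p : Prog} {s : State n} {B : ℕ} {Φ Ψ : ℕ → State n → ℝ≥0∞} {ε : ℝ≥0∞}
    (h : Run W d p s B Φ ε) (h1 : ∀ b s', b ≤ B → Frame p s s' → min 1 (Ψ b s') ≤ Φ b s') :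
    Run W d p s B Ψ ε := fun f hf => by
  refine le_trans (expect_mono fun o ho => ?_) (h f hf)
  rcases o with _ | r
  · simp [outcomeError]
  · simp only [outcomeError]
    split_ifs
    · exact le_min (min_le_left _ _) (h1 _ _ (Nat.sub_le _ _) (exec_frame ho))
    · exact le_rfl

end FrameRules

/-! ## Straight-line programs -/

/-- Programs without loops and random draws. -/
def Prog.straight : Prog → Bool
  | .skip => true
  | .wset _ _ _ => true
  | .rset _ _ _ => true
  | .rand _ _ _ => false
  | .emit _ _ => true
  | .seq p q => p.straight && q.straight
  | .ite _ p q => p.straight && q.straight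
  | .loop _ _ => false

/-- An upper bound for the running time of a straight-line program. -/
def Prog.steps : Prog → ℕ
  | .skip => 1
  | .wset _ i e => 1 + i.cost + e.cost
  | .rset _ i x => 1 + i.cost + x.cost
  | .rand _ _ _ => 0
  | .emit i j => 1 + i.cost + j.cost
  | .seq p q => 1 + p.steps + q.steps
  -- The sum of the branches instead of their maximum: a cruder bound that stays linear.
  | .ite b p q => 1 + b.cost + (p.steps + q.steps)
  | .loop _ _ => 0

open Classical in
/-- The effect of a straight-line program. -/
noncomputable def Prog.eff {n : ℕ} (W : ℕ) (d : Fin n → Fin n → ℝ) : Prog → State n → State n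
  | .skip, s => s
  | .wset a i e, s => s.setWord a (i.eval W s) (e.eval W s)
  | .rset a i x, s => s.setReal a (i.eval W s) (x.eval W d s)
  | .rand _ _ _, s => s
  | .emit i j, s => s.addEdge (i.eval W s) (j.eval W s)
  | .seq p q, s => q.eff W d (p.eff W d s)
  | .ite b p q, s => if b.Holds W d s then p.eff W d s else q.eff W d s
  | .loop _ _, s => s

/-- With probability at least `1 - ε`, the program `p` started in `s` halts within `c` units of
time in a state satisfying `Q`. -/
def Spec {n : ℕ} (W : ℕ) (d : Fin n → Fin n → ℝ) (p : Prog) (s : State n) (c : ℕ)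
    (Q : State n → Prop) (ε : ℝ≥0∞) : Prop :=
  -- Here `b'` is the budget left at the end, so `b ≤ b' + c` says that at most `c` units have been
  -- spent.
  ∀ b, c ≤ b → Run W d p s b (fun b' s' => failure (b ≤ b' + c ∧ Q s')) ε

/-! ### Rules for specifications with time and error bounds -/

section SpecRules

variable {n W : ℕ} {d : Fin n → Fin n → ℝ}

theorem Run.of_failure {p : Prog} {s : State n} {b : ℕ} {P : ℕ → State n → Prop}
    {Φ : ℕ → State n → ℝ≥0∞} {δ ε : ℝ≥0∞} (h : Run W d p s b (fun b' s' => failure (P b' s')) δ)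
    (H : ∀ b' s', P b' s' → Φ b' s' ≤ ε) : Run W d p s b Φ (δ + ε) := by
  refine (h.add_const ε).mono (fun b' s' _ => ?_) le_rfl
  by_cases hP : P b' s'
  · exact (min_le_right _ _).trans ((H b' s' hP).trans le_add_self)
  · exact (min_le_left _ _).trans (by simp [failure, hP])

theorem Run.of_failure_frame {p : Prog} {s : State n} {b : ℕ} {P : ℕ → State n → Prop}
    {Φ : ℕ → State n → ℝ≥0∞} {δ ε : ℝ≥0∞} (h : Run W d p s b (fun b' s' => failure (P b' s')) δ)
    (H : ∀ b' s', P b' s' → Frame p s s' → Φ b' s' ≤ ε) : Run W d p s b Φ (δ + ε) := by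
  refine (h.add_const ε).frame (fun b' s' _ hF => ?_)
  by_cases hP : P b' s'
  · exact (min_le_right _ _).trans ((H b' s' hP hF).trans le_add_self)
  · exact (min_le_left _ _).trans (by simp [failure, hP])

theorem Spec.run {p : Prog} {s : State n} {c b : ℕ} {Q : State n → Prop}
    {Φ : ℕ → State n → ℝ≥0∞} {δ ε : ℝ≥0∞} (h : Spec W d p s c Q δ) (hb : c ≤ b)
    (H : ∀ b' s', b ≤ b' + c → Q s' → Frame p s s' → Φ b' s' ≤ ε) :
    Run W d p s b Φ (δ + ε) :=
  (h b hb).of_failure_frame fun b' s' h' hF => H b' s' h'.1 h'.2 hF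

theorem Spec.weaken {p : Prog} {s : State n} {c c' : ℕ} {Q Q' : State n → Prop} {ε ε' : ℝ≥0∞}
    (h : Spec W d p s c Q ε) (hc : c ≤ c') (hQ : ∀ s', Frame p s s' → Q s' → Q' s') (hε : ε ≤ ε') :
    Spec W d p s c' Q' ε' := fun b hb => by
  have := h.run (b := b) (ε := 0) (Φ := fun b' s' => failure (b ≤ b' + c' ∧ Q' s'))
    (hc.trans hb) fun b' s' h1 h2 h3 => by
      rw [failure_true]; exact ⟨by omega, hQ _ h3 h2⟩
  rw [add_zero] at this
  exact this.mono (fun _ _ _ => min_le_right _ _) hε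

theorem Spec.seq {p q : Prog} {s : State n} {c c1 c2 : ℕ} {P Q : State n → Prop} {ε ε1 ε2 : ℝ≥0∞}
    (hp : Spec W d p s c1 P ε1)
    (hq : ∀ s', P s' → Frame p s s' → Spec W d q s' c2 Q ε2) (hc : 1 + c1 + c2 ≤ c := by omega)
    (hε : ε1 + ε2 ≤ ε := by simp) :
    Spec W d (.seq p q) s c Q ε := fun b hb => by
  refine (run_seq (Ψ := fun b' s' => failure (b - 1 ≤ b' + c1 ∧ P s' ∧ Frame p s s') + ε2)
    (ε := ε1 + ε2) (by omega) ?_ ?_).mono (fun _ _ _ => min_le_right _ _) hε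
  · refine Run.add_const ?_ _
    have := hp.run (b := b - 1) (ε := 0)
      (Φ := fun b' s' => failure (b - 1 ≤ b' + c1 ∧ P s' ∧ Frame p s s')) (by omega)
      fun b' s' h1 h2 h3 => by rw [failure_true ⟨h1, h2, h3⟩]
    rwa [add_zero] at this
  · intro b' s' _ h1
    obtain ⟨h2, h3, h4⟩ := of_failure_lt_one (lt_of_le_of_lt le_self_add h1)
    rw [failure_true ⟨h2, h3, h4⟩, zero_add]
    refine (hq s' h3 h4 b' (by omega)).mono (fun b'' s'' _ => ?_) le_rfl
    exact (min_le_right _ _).trans (failure_mono fun h => ⟨by omega, h.2⟩)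

theorem Spec.ite {b : BExpr} {p q : Prog} {s : State n} {c c1 : ℕ} {Q : State n → Prop} {ε : ℝ≥0∞}
    (hp : b.Holds W d s → Spec W d p s c1 Q ε) (hq : ¬ b.Holds W d s → Spec W d q s c1 Q ε)
    (hc : 1 + b.cost + c1 ≤ c := by omega) : Spec W d (.ite b p q) s c Q ε := fun B hB => by
  refine run_ite (by omega) (fun h => ?_) (fun h => ?_)
  · refine (hp h (B - (1 + b.cost)) (by omega)).mono (fun b'' s'' _ => ?_) le_rfl
    exact (min_le_right _ _).trans (failure_mono fun h => ⟨by omega, h.2⟩)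
  · refine (hq h (B - (1 + b.cost)) (by omega)).mono (fun b'' s'' _ => ?_) le_rfl
    exact (min_le_right _ _).trans (failure_mono fun h => ⟨by omega, h.2⟩)

theorem spec_straight {p : Prog} (hp : p.straight = true) (s : State n) :
    Spec W d p s p.steps (fun s' => s' = p.eff W d s) 0 := by
  induction p generalizing s with
  | skip =>
    intro b hb
    refine (run_skip (by simpa [Prog.steps] using hb)).mono (fun _ _ _ => min_le_right _ _) ?_
    rw [failure_true]; simp only [Prog.steps, Prog.eff, and_true] at *; omega
  | wset a i e =>
    intro b hb
    refine (run_wset (by simpa [Prog.steps] using hb)).mono (fun _ _ _ => min_le_right _ _) ?_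
    rw [failure_true]; simp only [Prog.steps, Prog.eff, and_true] at *; omega
  | rset a i e =>
    intro b hb
    refine (run_rset (by simpa [Prog.steps] using hb)).mono (fun _ _ _ => min_le_right _ _) ?_
    rw [failure_true]; simp only [Prog.steps, Prog.eff, and_true] at *; omega
  | rand a i e => simp [Prog.straight] at hp
  | emit i j =>
    intro b hb
    refine (run_emit (by simpa [Prog.steps] using hb)).mono (fun _ _ _ => min_le_right _ _) ?_
    rw [failure_true]; simp only [Prog.steps, Prog.eff, and_true] at *; omega
  | seq p q ihp ihq =>
    simp only [Prog.straight, Bool.and_eq_true] at hp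
    refine Spec.seq (ε2 := 0) (ihp hp.1 s) (fun s' h _ => ?_) le_rfl
    subst h
    exact ihq hp.2 _
  | ite b p q ihp ihq =>
    simp only [Prog.straight, Bool.and_eq_true] at hp
    refine Spec.ite (c1 := p.steps + q.steps) (fun h => ?_) (fun h => ?_) le_rfl
    · exact (ihp hp.1 s).weaken (by omega) (fun s' _ h' => by simp [Prog.eff, h, h']) le_rfl
    · exact (ihq hp.2 s).weaken (by omega) (fun s' _ h' => by simp [Prog.eff, h, h']) le_rfl
  | loop b p => simp [Prog.straight] at hp

theorem Spec.of_eff {p : Prog} {s : State n} {c : ℕ} {Q : State n → Prop} {ε : ℝ≥0∞}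
    (hp : p.straight = true) (hc : p.steps ≤ c) (hQ : Q (p.eff W d s)) : Spec W d p s c Q ε :=
  (spec_straight hp s).weaken hc (fun _ _ h => h ▸ hQ) (zero_le)

/-- Sets aside `c` units during `p`; the loop rule uses them for incrementing the counter. -/
theorem Run.add_budget {p : Prog} {s : State n} {B : ℕ} {Φ : ℕ → State n → ℝ≥0∞} {ε : ℝ≥0∞}
    (h : Run W d p s B Φ ε) (c : ℕ) :
    Run W d p s (B + c) (fun b' s' => if c ≤ b' then Φ (b' - c) s' else 1) ε := fun f hf => by
  refine le_trans (expect_mono fun o _ => ?_) (h f (by omega))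
  rcases o with _ | r
  · simp [outcomeError]
  · simp only [outcomeError]
    by_cases h1 : r.1 ≤ B
    · rw [if_pos (by omega), if_pos (by omega), if_pos h1]
      rw [show B + c - r.1 - c = B - r.1 by omega]
    · rw [if_neg h1]; split_ifs <;> simp

/-! ## Counting loops -/

/-- Repeat `body` with the variable `x` running through the numbers below `e`. -/
def forLoop (x : ℕ) (e : WExpr) (body : Prog) : Prog :=
  .seq (.wset x (.lit 0) (.lit 0))
    (.loop (.wlt (.read x (.lit 0)) e)
      (.seq body (.wset x (.lit 0) (.add (.read x (.lit 0)) (.lit 1)))))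

theorem mods_forLoop (x : ℕ) (e : WExpr) (body : Prog) :
    (forLoop x e body).mods = x :: (body.mods ++ [x]) := rfl

theorem keepsReals_forLoop (x : ℕ) (e : WExpr) (body : Prog) :
    (forLoop x e body).keepsReals = body.keepsReals := by
  simp [forLoop, Prog.keepsReals]

theorem silent_forLoop (x : ℕ) (e : WExpr) (body : Prog) :
    (forLoop x e body).silent = body.silent := by
  simp [forLoop, Prog.silent]

theorem frame_body_forLoop {x : ℕ} {e : WExpr} {body : Prog} {s s' : State n}
    (h : Frame body s s') : Frame (forLoop x e body) s s' :=
  h.weaken (fun a ha => by simp [mods_forLoop, ha])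
    (fun h => by rwa [keepsReals_forLoop] at h) (fun h => by rwa [silent_forLoop] at h)

/-- `J k` is the error just before the guard of round `k`. Setting the counter to zero costs `4`
(with the sequencing), a guard costs `e.cost + 4`, sequencing and increment cost `1 + 6`; this gives
`e.cost + 11` per round and `e.cost + 4` for the final guard. -/
theorem run_forLoop {x : ℕ} {e : WExpr} {body : Prog} {s : State n} {B N : ℕ}
    {Φ : ℕ → State n → ℝ≥0∞} (J : ℕ → ℕ → State n → ℝ≥0∞)
    (hN : ∀ s', Frame (forLoop x e body) s s' → e.eval W s' = N) (hNW : N < W)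
    (hx : x ∉ body.mods)
    (step : ∀ k b s', k < N → Frame (forLoop x e body) s s' → s'.word x 0 = k → J k b s' < 1 →
      e.cost + 11 ≤ b ∧ Run W d body s' (b - (e.cost + 11))
        (fun b' s'' => J (k + 1) b' (s''.setWord x 0 (k + 1))) (J k b s'))
    (final : ∀ b s', Frame (forLoop x e body) s s' → s'.word x 0 = N → J N b s' < 1 →
      e.cost + 4 ≤ b ∧ Φ (b - (e.cost + 4)) s' ≤ J N b s')
    (hB : 4 ≤ B) :
    Run W d (forLoop x e body) s B Φ (J 0 (B - 4) (s.setWord x 0 0)) := by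
  classical
  have hxm : x ∈ (forLoop x e body).mods := by simp [mods_forLoop]
  -- The general loop rule does not know the number of the round, so it is read off the counter.
  -- States that violate the frame or the range of the counter get error `1` and drop out.
  set J' : ℕ → State n → ℝ≥0∞ := fun b s' =>
    if Frame (forLoop x e body) s s' ∧ s'.word x 0 ≤ N then J (s'.word x 0) b s' else 1 with hJ'
  have hval : ∀ b (s' : State n) k, Frame (forLoop x e body) s s' → k ≤ N → s'.word x 0 = k →
      J' b s' = J k b s' := by
    intro b s' k h1 h2 h3
    simp only [hJ', h3, h1, h2, and_self, if_true]
  have h0 : Run W d (.wset x (.lit 0) (.lit 0)) s (B - 1) J' (J 0 (B - 4) (s.setWord x 0 0)) := by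
    refine (run_wset (by simp only [WExpr.cost]; omega)).mono (fun _ _ _ => min_le_right _ _) ?_
    simp only [WExpr.cost, WExpr.eval, Nat.zero_mod]
    rw [hval _ _ 0 (frame_setWord hxm _ _) (Nat.zero_le _) (by simp [State.setWord])]
    rw [show B - 1 - (1 + 1 + 1) = B - 4 by omega]
  refine run_seq (Ψ := J') (by omega) h0 fun b s' _ _ => run_loop (fun b s' hlt => ?_) b s'
  have hF : Frame (forLoop x e body) s s' ∧ s'.word x 0 ≤ N := by
    by_contra h
    simp only [hJ'] at hlt
    rw [if_neg h] at hlt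
    exact lt_irrefl _ hlt
  obtain ⟨hF, hle⟩ := hF
  have hJk := hval b s' _ hF hle rfl
  have hcost : (BExpr.wlt (.read x (.lit 0)) e).cost = e.cost + 3 := by
    simp only [BExpr.cost, WExpr.cost]; omega
  have hguard : (BExpr.wlt (.read x (.lit 0)) e).Holds W d s' ↔ s'.word x 0 < N := by
    simp only [BExpr.Holds, WExpr.eval, Nat.zero_mod, hN s' hF]
  rw [hguard, hcost, hJk]
  rw [hJk] at hlt
  rcases hle.lt_or_eq with hk | hk
  · obtain ⟨hb, hrun⟩ := step _ b s' hk hF rfl hlt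
    refine ⟨by omega, fun _ => ?_, fun h => absurd hk h⟩
    have hrun' := hrun.add_budget 6
    rw [show b - (e.cost + 11) + 6 = b - (1 + (e.cost + 3)) - 1 by omega] at hrun'
    refine run_seq (by omega)
      (Run.frame (Ψ := fun b' s'' => if 6 ≤ b' ∧ Frame body s' s'' then
        J (s'.word x 0 + 1) (b' - 6) (s''.setWord x 0 (s'.word x 0 + 1)) else 1) hrun' ?_) ?_
    · intro b' s'' _ hF'
      simp only [hF', and_true]
      exact min_le_right _ _
    · intro b' s'' _ h1
      split_ifs at h1 with h6
      · rw [if_pos h6]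
        obtain ⟨h6, hF'⟩ := h6
        have hxk : s''.word x 0 = s'.word x 0 := by rw [hF'.word x hx]
        have hF'' : Frame (forLoop x e body) s s'' := hF.trans (frame_body_forLoop hF')
        refine (run_wset (by simp only [WExpr.cost]; omega)).mono
          (fun _ _ _ => min_le_right _ _) ?_
        simp only [WExpr.cost, WExpr.eval, Nat.zero_mod, hxk]
        rw [Nat.mod_eq_of_lt (show 1 < W by omega),
          Nat.mod_eq_of_lt (show s'.word x 0 + 1 < W by omega)]
        rw [hval _ _ (s'.word x 0 + 1) (hF''.trans (frame_setWord hxm _ _)) hk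
          (by simp [State.setWord])]
      · exact absurd h1 (lt_irrefl _)
  · rw [hk] at hlt ⊢
    obtain ⟨hb, hΦ⟩ := final b s' hF hk hlt
    refine ⟨by omega, fun h => absurd h (lt_irrefl _), fun _ => ?_⟩
    rw [show 1 + (e.cost + 3) = e.cost + 4 by omega]
    exact hΦ

/-- The rule for counting loops with amortized costs: `c k` is the amortized cost of round `k` with
respect to the potential `pot`. -/
theorem spec_forLoop_amortized {x : ℕ} {e : WExpr} {body : Prog} {s : State n} {N : ℕ}
    (Inv : ℕ → State n → Prop) (c : ℕ → ℕ) (pot : State n → ℕ) (ε : ℝ≥0∞)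
    (hN : ∀ s', Frame (forLoop x e body) s s' → e.eval W s' = N) (hNW : N < W)
    (hx : x ∉ body.mods) (h0 : Inv 0 (s.setWord x 0 0))
    (step : ∀ k s' b, k < N → Frame (forLoop x e body) s s' → s'.word x 0 = k → Inv k s' →
      c k + pot s' ≤ b → Run W d body s' b (fun b' s'' => failure
        (b + pot (s''.setWord x 0 (k + 1)) ≤ b' + c k + pot s' ∧
          Inv (k + 1) (s''.setWord x 0 (k + 1)))) ε) :
    Spec W d (forLoop x e body) s
      (pot (s.setWord x 0 0) + ∑ k ∈ Finset.range N, (c k + e.cost + 11) + e.cost + 8)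
      (fun s' => Inv N s' ∧ s'.word x 0 = N) (N * ε) := fun b hb => by
  set tot := ∑ k ∈ Finset.range N, (c k + e.cost + 11) with htot
  set C := pot (s.setWord x 0 0) + tot + e.cost + 8 with hC
  set part : ℕ → ℕ := fun k => ∑ k ∈ Finset.range k, (c k + e.cost + 11) with hpart
  -- Before round `k` the budget must still cover the slack `b - C`, the current potential, and the
  -- rounds not accounted for in `part k`; `(N - k) * ε` is the error of the remaining rounds.
  have := run_forLoop (W := W) (d := d) (x := x) (e := e) (body := body) (s := s) (B := b) (N := N)
    (Φ := fun b' s' => failure (b ≤ b' + C ∧ Inv N s' ∧ s'.word x 0 = N))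
    (fun k b' s' => failure ((b - C) + pot s' + tot + e.cost + 4 ≤ b' + part k ∧ Inv k s') +
      ((N - k : ℕ) : ℝ≥0∞) * ε) hN hNW hx ?_ ?_ (by omega)
  · refine this.mono (fun _ _ _ => min_le_right _ _) ?_
    rw [failure_true, zero_add, Nat.sub_zero]
    refine ⟨?_, h0⟩
    simp only [hpart, Finset.range_zero, Finset.sum_empty]
    omega
  · intro k b' s' hk hF hxk hlt
    obtain ⟨h1, h2⟩ := of_failure_lt_one (lt_of_le_of_lt le_self_add hlt)
    have hps : part (k + 1) = part k + (c k + e.cost + 11) := Finset.sum_range_succ _ _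
    have hle : part (k + 1) ≤ tot :=
      Finset.sum_le_sum_of_subset (Finset.range_mono (by omega))
    refine ⟨by omega, ?_⟩
    rw [failure_true ⟨h1, h2⟩, zero_add]
    have hNk : N - k = (N - (k + 1)) + 1 := by omega
    rw [hNk, Nat.cast_succ, add_mul, one_mul,
      add_comm (((N - (k + 1) : ℕ) : ℝ≥0∞) * ε) ε]
    refine Run.of_failure (step k s' (b' - (e.cost + 11)) hk hF hxk h2 (by omega)) ?_
    intro b'' s'' h3
    rw [failure_true, zero_add]
    exact ⟨by omega, h3.2⟩
  · intro b' s' hF hxk hlt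
    obtain ⟨h1, h2⟩ := of_failure_lt_one (lt_of_le_of_lt le_self_add hlt)
    have : part N = tot := rfl
    refine ⟨by omega, ?_⟩
    rw [failure_true]
    · exact zero_le
    · exact ⟨by omega, h2, hxk⟩

/-- The rule for counting loops. -/
theorem spec_forLoop_sum {x : ℕ} {e : WExpr} {body : Prog} {s : State n} {N C : ℕ} {δ : ℝ≥0∞}
    (Inv : ℕ → State n → Prop) (c : ℕ → ℕ) (ε : ℝ≥0∞)
    (hN : ∀ s', Frame (forLoop x e body) s s' → e.eval W s' = N) (hNW : N < W)
    (hx : x ∉ body.mods) (h0 : Inv 0 (s.setWord x 0 0))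
    (step : ∀ k s', k < N → Frame (forLoop x e body) s s' → s'.word x 0 = k → Inv k s' →
      Spec W d body s' (c k) (fun s'' => Inv (k + 1) (s''.setWord x 0 (k + 1))) ε)
    (hC : ∑ k ∈ Finset.range N, (c k + e.cost + 11) + e.cost + 8 ≤ C) (hδ : N * ε ≤ δ) :
    Spec W d (forLoop x e body) s C (fun s' => Inv N s' ∧ s'.word x 0 = N) δ := by
  refine (spec_forLoop_amortized Inv c (fun _ => 0) ε hN hNW hx h0 ?_).weaken (by simpa using hC)
    (fun _ _ h => h) hδ
  intro k s' b hk hF hxk hI hb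
  exact (step k s' hk hF hxk hI) b (by omega)

/-- The rule for counting loops all of whose rounds have the same cost. -/
theorem spec_forLoop {x : ℕ} {e : WExpr} {body : Prog} {s : State n} {N C : ℕ} {δ : ℝ≥0∞}
    (Inv : ℕ → State n → Prop) (c : ℕ) (ε : ℝ≥0∞)
    (hN : ∀ s', Frame (forLoop x e body) s s' → e.eval W s' = N) (hNW : N < W)
    (hx : x ∉ body.mods) (h0 : Inv 0 (s.setWord x 0 0))
    (step : ∀ k s', k < N → Frame (forLoop x e body) s s' → s'.word x 0 = k → Inv k s' →
      Spec W d body s' c (fun s'' => Inv (k + 1) (s''.setWord x 0 (k + 1))) ε)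
    (hC : N * (c + e.cost + 11) + e.cost + 8 ≤ C) (hδ : N * ε ≤ δ) :
    Spec W d (forLoop x e body) s C (fun s' => Inv N s' ∧ s'.word x 0 = N) δ := by
  refine spec_forLoop_sum Inv (fun _ => c) ε hN hNW hx h0 step ?_ hδ
  simpa using hC

end SpecRules

/-! ## Variables and simplification rules -/

-- Names for the numbers of the word arrays; `vN` must be `0`, where the initial state holds `n`.
-- The triple `vI`, `vX`, `vJ` holds source, candidate and target. `vCV` marks covered points, `vUL`
-- and `vU` hold a list and its length, `vG` is the guess, `vH` counts hits and `vM` is the number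
-- of hits required. `vNB` stores the lists of nearest points, `vRM` and `vBM` the removed points
-- and the block minima, `vINV` and `vDEG` the incidence lists and their lengths, `vTH` the
-- threshold.
notation "vN" => 0
notation "vL" => 1
notation "vP" => 2
notation "vW" => 3
notation "vI" => 4
notation "vX" => 5
notation "vJ" => 6
notation "vNB" => 7
notation "vCV" => 8
notation "vUL" => 9
notation "vU" => 10
notation "vG" => 11
notation "vA" => 12
notation "vR" => 13
notation "vT" => 14
notation "vV" => 15
notation "vH" => 16
notation "vM" => 17
notation "vINV" => 18
notation "vDEG" => 19
notation "vTH" => 20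
notation "vC" => 21
notation "vRM" => 22
notation "vBM" => 23
notation "vB" => 24
notation "vO" => 25
notation "vBest" => 26
notation "vY" => 27
notation "vBB" => 28

/-- The value of a scalar variable. -/
def rd (a : ℕ) : WExpr := .read a (.lit 0)

/-- Assignment to a scalar variable. -/
def asg (a : ℕ) (e : WExpr) : Prog := .wset a (.lit 0) e

section Simp

variable {n : ℕ} (W : ℕ) (d : Fin n → Fin n → ℝ) (s : State n)

@[simp] theorem eval_rd (a : ℕ) : (rd a).eval W s = s.word a 0 := by simp [rd, WExpr.eval]

@[simp] theorem cost_rd (a : ℕ) : (rd a).cost = 2 := rfl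

@[simp] theorem word_setWord (a i v b k : ℕ) :
    (s.setWord a i v).word b k = if b = a ∧ k = i then v else s.word b k := by
  by_cases hb : b = a
  · subst hb
    by_cases hk : k = i
    · subst hk; simp [State.setWord]
    · simp [State.setWord, hk]
  · simp [State.setWord, hb]

@[simp] theorem real_setWord (a i v : ℕ) : (s.setWord a i v).real = s.real := rfl

@[simp] theorem out_setWord (a i v : ℕ) : (s.setWord a i v).out = s.out := rfl

attribute [simp] word_addEdge real_addEdge mods_forLoop keepsReals_forLoop silent_forLoop

attribute [simp] WExpr.eval WExpr.cost RExpr.cost BExpr.cost BExpr.Holds Prog.mods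
  Prog.keepsReals Prog.silent Prog.straight Prog.steps Prog.eff

@[simp] theorem mods_asg (a : ℕ) (e : WExpr) : (asg a e).mods = [a] := rfl
@[simp] theorem keepsReals_asg (a : ℕ) (e : WExpr) : (asg a e).keepsReals = true := rfl
@[simp] theorem straight_asg (a : ℕ) (e : WExpr) : (asg a e).straight = true := rfl
@[simp] theorem steps_asg (a : ℕ) (e : WExpr) : (asg a e).steps = 2 + e.cost := rfl
@[simp] theorem eff_asg (a : ℕ) (e : WExpr) :
    (asg a e).eff W d s = s.setWord a 0 (e.eval W s) := by simp [asg]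

/-- The distance of two points given by numbers, with value zero on other numbers. -/
noncomputable def natDist (d : Fin n → Fin n → ℝ) (x y : ℕ) : ℝ :=
  if h : x < n ∧ y < n then d ⟨x, h.1⟩ ⟨y, h.2⟩ else 0

@[simp] theorem eval_dist (e f : WExpr) :
    (RExpr.dist e f).eval W d s = natDist d (e.eval W s) (f.eval W s) := rfl

end Simp

/-! ## The logarithm and the square root of the number of points -/

/-- The least number whose square is at least `n`. -/
noncomputable def sqrtCeil (n : ℕ) : ℕ := sInf {w | n ≤ w * w}

theorem le_sqrtCeil_mul (n : ℕ) : n ≤ sqrtCeil n * sqrtCeil n :=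
  Nat.sInf_mem (s := {w | n ≤ w * w}) ⟨n, Nat.le_mul_self n⟩

theorem sqrtCeil_le_of_le {n w : ℕ} (h : n ≤ w * w) : sqrtCeil n ≤ w := Nat.sInf_le h

theorem sqrtCeil_le (n : ℕ) : sqrtCeil n ≤ n := sqrtCeil_le_of_le (Nat.le_mul_self n)

theorem sqrtCeil_pos {n : ℕ} (h : 0 < n) : 0 < sqrtCeil n := by
  by_contra h0
  have := le_sqrtCeil_mul n
  simp only [Nat.eq_zero_of_not_pos h0] at this
  omega

theorem size_le_self (n : ℕ) : Nat.size n ≤ n := Nat.size_le.mpr Nat.lt_two_pow_self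

/-- Compute `Nat.size n`, the corresponding power of two, `sqrtCeil n` and `D * Nat.size n`. -/
def parameters (D : ℕ) : Prog :=
  .seq (asg vL (.lit 0)) <| .seq (asg vP (.lit 1)) <|
  .seq (forLoop vT (rd vN) (.ite (.neg (.wlt (rd vN) (rd vP)))
    (.seq (asg vP (.mul (rd vP) (.lit 2))) (asg vL (.add (rd vL) (.lit 1)))) .skip)) <|
  .seq (asg vW (.lit 0)) <|
  .seq (forLoop vT (rd vN) (.ite (.wlt (.mul (rd vW) (rd vW)) (rd vN))
    (asg vW (.add (rd vW) (.lit 1))) .skip)) <|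
  asg vM (.mul (.lit D) (rd vL))

section Parameters

variable {n W : ℕ} {d : Fin n → Fin n → ℝ}

theorem spec_parameters {D : ℕ} {s : State n} (hn : 2 ≤ n) (hs : s.word vN 0 = n)
    (hW : (n + 1) * (n + 1) ≤ W) (hD : D * n < W) (hD1 : D < W) :
    Spec W d (parameters D) s (100 * n + 100) (fun s' => s'.word vL 0 = Nat.size n ∧
      s'.word vP 0 = 2 ^ Nat.size n ∧ s'.word vW 0 = sqrtCeil n ∧
      s'.word vM 0 = D * Nat.size n) 0 := by
  have hnn : 2 * n ≤ n * n := Nat.mul_le_mul_right n hn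
  have hnW : n * n + 2 * n + 1 ≤ W := by
    have : (n + 1) * (n + 1) = n * n + 2 * n + 1 := by ring
    omega
  have h1 : 1 % W = 1 := Nat.mod_eq_of_lt (by omega)
  have h2 : 2 % W = 2 := Nat.mod_eq_of_lt (by omega)
  unfold parameters
  refine Spec.seq (ε1 := 0) (ε2 := 0) (c1 := 10) (c2 := 100 * n + 80)
    (P := fun s' => s'.word vL 0 = 0) (Spec.of_eff (by simp) (by simp) (by simp)) ?_
  intro s1 hs1 hF1
  have hn1 : s1.word vN 0 = n := by rw [hF1.word _ (by simp)]; exact hs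
  refine Spec.seq (ε1 := 0) (ε2 := 0) (c1 := 10) (c2 := 100 * n + 60)
    (P := fun s' => s'.word vL 0 = 0 ∧ s'.word vP 0 = 1 ∧ s'.word vN 0 = n)
    (Spec.of_eff (by simp) (by simp) (by simp [hs1, h1, hn1])) ?_
  rintro s2 ⟨hL2, hP2, hn2⟩ hF2
  refine Spec.seq (ε1 := 0) (ε2 := 0) (c1 := n * 45 + 10) (c2 := 55 * n + 45)
    (P := fun s' => s'.word vL 0 = Nat.size n ∧ s'.word vP 0 = 2 ^ Nat.size n) ?_ ?_
  -- The loop makes `n` rounds, but doubling stops once the power exceeds `n`. The last clause of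
  -- the invariant says that it has stopped or is still in step with the counter; the loop for
  -- `sqrtCeil` works alike.
  · refine (spec_forLoop (N := n) (C := n * 45 + 10) (δ := 0)
      (fun k s' => s'.word vP 0 = 2 ^ s'.word vL 0 ∧ s'.word vP 0 ≤ 2 * n ∧
        s'.word vL 0 ≤ Nat.size n ∧ s'.word vL 0 ≤ n ∧
        (n < s'.word vP 0 ∨ s'.word vL 0 = k)) 32 0 ?_ ?_ ?_ ?_ ?_ ?_ ?_).weaken le_rfl ?_ le_rfl
    · intro s' hF
      simp [hF.word _ (show vN ∉ _ by simp), hn2]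
    · omega
    · simp
    · simp [hL2, hP2]; omega
    · rintro k s' hk hF hT ⟨h3, h4, h5, h5', h6⟩
      have hn' : s'.word vN 0 = n := by rw [hF.word _ (by simp), hn2]
      refine Spec.of_eff (by simp) (by simp) ?_
      by_cases hlt : n < s'.word vP 0
      · simp [hn', hlt]
        exact ⟨h3, h4, h5, h5'⟩
      · have hLk : s'.word vL 0 = k := by omega
        have hsz : k < Nat.size n := by
          rw [Nat.lt_size, ← hLk, ← h3]; omega
        have e1 : s'.word vP 0 * 2 % W = 2 * s'.word vP 0 := by
          rw [mul_comm]; exact Nat.mod_eq_of_lt (by omega)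
        have e2 : (s'.word vL 0 + 1) % W = k + 1 := by
          rw [hLk]; exact Nat.mod_eq_of_lt (by omega)
        simp [hn', hlt, h1, h2, e1, e2]
        rw [h3, hLk]
        refine ⟨by ring, ?_, hsz, hk⟩
        rw [← hLk, ← h3]; omega
    · simp only [cost_rd]; omega
    · simp
    · rintro s' - ⟨⟨h3, h4, h5, h5', h6⟩, -⟩
      have : Nat.size n ≤ s'.word vL 0 := by
        rw [Nat.size_le]
        rcases h6 with h6 | h6
        · rwa [← h3]
        · rw [h6]; exact Nat.lt_two_pow_self
      have h7 : s'.word vL 0 = Nat.size n := le_antisymm h5 this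
      exact ⟨h7, by rw [h3, h7]⟩
  rintro s3 ⟨hL3, hP3⟩ hF3
  have hn3 : s3.word vN 0 = n := by rw [hF3.word _ (by simp), hn2]
  refine Spec.seq (ε1 := 0) (ε2 := 0) (c1 := 10) (c2 := 55 * n + 30)
    (P := fun s' => s'.word vL 0 = Nat.size n ∧ s'.word vP 0 = 2 ^ Nat.size n ∧
      s'.word vN 0 = n ∧ s'.word vW 0 = 0)
    (Spec.of_eff (by simp) (by simp) (by simp [hL3, hP3, hn3])) ?_
  rintro s4 ⟨hL4, hP4, hn4, hW4⟩ hF4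
  refine Spec.seq (ε1 := 0) (ε2 := 0) (c1 := n * 45 + 10) (c2 := 15)
    (P := fun s' => s'.word vW 0 = sqrtCeil n) ?_ ?_
  · refine (spec_forLoop (N := n) (C := n * 45 + 10) (δ := 0)
      (fun k s' => s'.word vW 0 ≤ sqrtCeil n ∧
        (n ≤ s'.word vW 0 * s'.word vW 0 ∨ s'.word vW 0 = k)) 32 0 ?_ ?_ ?_ ?_ ?_ ?_ ?_).weaken
        le_rfl ?_ le_rfl
    · intro s' hF
      simp [hF.word _ (show vN ∉ _ by simp), hn4]
    · omega
    · simp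
    · simp [hW4]
    · rintro k s' hk hF hT ⟨h3, h6⟩
      have hn' : s'.word vN 0 = n := by rw [hF.word _ (by simp), hn4]
      refine Spec.of_eff (by simp) (by simp) ?_
      have hle : s'.word vW 0 ≤ n := h3.trans (sqrtCeil_le n)
      have e1 : s'.word vW 0 * s'.word vW 0 % W = s'.word vW 0 * s'.word vW 0 :=
        Nat.mod_eq_of_lt (lt_of_le_of_lt (Nat.mul_le_mul hle hle) (by omega))
      by_cases hlt : s'.word vW 0 * s'.word vW 0 < n
      · have e2 : (s'.word vW 0 + 1) % W = s'.word vW 0 + 1 := Nat.mod_eq_of_lt (by omega)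
        simp [hn', hlt, h1, e1, e2]
        refine ⟨?_, by omega⟩
        by_contra h
        have h' : sqrtCeil n ≤ s'.word vW 0 := by omega
        have := le_sqrtCeil_mul n
        have := Nat.mul_le_mul h' h'
        omega
      · simp [hn', hlt, e1]
        exact ⟨h3, by omega⟩
    · simp only [cost_rd]; omega
    · simp
    · rintro s' - ⟨⟨h3, h6⟩, -⟩
      refine le_antisymm h3 ?_
      rcases h6 with h6 | h6
      · exact sqrtCeil_le_of_le h6
      · rw [h6]; exact sqrtCeil_le n
  rintro s5 hW5 hF5
  have hL5 : s5.word vL 0 = Nat.size n := by rw [hF5.word _ (by simp), hL4]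
  have hP5 : s5.word vP 0 = 2 ^ Nat.size n := by rw [hF5.word _ (by simp), hP4]
  refine Spec.of_eff (by simp) (by simp) ?_
  have : D * Nat.size n < W := lt_of_le_of_lt (Nat.mul_le_mul_left _ (size_le_self n)) hD
  simp [hL5, hP5, hW5, Nat.mod_eq_of_lt hD1, Nat.mod_eq_of_lt this]

end Parameters

/-! ## Lists of nearest points

For every point `j` we extract the `sqrtCeil n` points nearest to `j`, by repeatedly removing the
minimum.  The points are divided into `sqrtCeil n` blocks whose minima are kept up to date, so that
one extraction takes time `O(sqrtCeil n)`. -/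

/-- `z` is a minimizer of `key` among the numbers satisfying `C`, or the number `top` if there is
no such number. -/
def IsArgmin (C : ℕ → Prop) (key : ℕ → ℝ) (top z : ℕ) : Prop :=
  (z = top ∧ ∀ y, ¬ C y) ∨ (z < top ∧ C z ∧ ∀ y, C y → key z ≤ key y)

theorem IsArgmin.congr {C C' : ℕ → Prop} {key : ℕ → ℝ} {top z : ℕ} (h : IsArgmin C key top z)
    (hC : ∀ y, C' y ↔ C y) : IsArgmin C' key top z := by
  unfold IsArgmin at *
  simpa only [hC] using h

open Classical in
-- The conditional mirrors the guards of the scanning programs; `top` plays the role of an infinite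
-- minimum for an empty range.
theorem IsArgmin.insert {C C' : ℕ → Prop} {key : ℕ → ℝ} {top z y : ℕ} (h : IsArgmin C key top z)
    (hy : y < top) (hC : ∀ x, C' x ↔ C x ∨ x = y) :
    IsArgmin C' key top (if z < top ∧ ¬ key y < key z then z else y) := by
  unfold IsArgmin at *
  simp only [hC]
  rcases h with ⟨h1, h2⟩ | ⟨h1, h2, h3⟩
  · rw [if_neg (by omega)]
    right
    refine ⟨hy, Or.inr rfl, ?_⟩
    rintro x (hx | rfl)
    · exact absurd hx (h2 x)
    · exact le_rfl
  · right
    split_ifs with hlt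
    · refine ⟨h1, Or.inl h2, ?_⟩
      rintro x (hx | rfl)
      · exact h3 x hx
      · exact not_lt.mp hlt.2
    · have hlt' : key y < key z := by
        by_contra h; exact hlt ⟨h1, h⟩
      refine ⟨hy, Or.inr rfl, ?_⟩
      rintro x (hx | rfl)
      · exact hlt'.le.trans (h3 x hx)
      · exact le_rfl

/-- The values of the parameters computed by `parameters`. -/
structure Params {n : ℕ} (D : ℕ) (s : State n) : Prop where
  n_eq : s.word vN 0 = n
  L_eq : s.word vL 0 = Nat.size n
  P_eq : s.word vP 0 = 2 ^ Nat.size n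
  W_eq : s.word vW 0 = sqrtCeil n
  M_eq : s.word vM 0 = D * Nat.size n

theorem Params.frame {n D : ℕ} {p : Prog} {s s' : State n} (h : Params D s) (hF : Frame p s s')
    (hm : ∀ a ∈ [vN, vL, vP, vW, vM], a ∉ p.mods) : Params D s' := by
  simp only [List.mem_cons, List.not_mem_nil, or_false, forall_eq_or_imp, forall_eq] at hm
  obtain ⟨h1, h2, h3, h4, h5⟩ := hm
  constructor
  · rw [hF.word _ h1, h.n_eq]
  · rw [hF.word _ h2, h.L_eq]
  · rw [hF.word _ h3, h.P_eq]
  · rw [hF.word _ h4, h.W_eq]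
  · rw [hF.word _ h5, h.M_eq]

/-- By minimality the predecessor of `sqrtCeil n` has a square below `n`. The bound makes `sqrtCeil
n` scans of cost `O(sqrtCeil n)` linear in `n`. -/
theorem sqrtCeil_mul_le {n : ℕ} (hn : 2 ≤ n) : sqrtCeil n * sqrtCeil n ≤ 4 * n := by
  obtain ⟨v, hv⟩ : ∃ v, sqrtCeil n = v + 1 :=
    ⟨sqrtCeil n - 1, by have := sqrtCeil_pos (n := n) (by omega); omega⟩
  have h : v * v < n := by
    by_contra h
    have := sqrtCeil_le_of_le (not_lt.mp h)
    omega
  rw [hv]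
  rcases Nat.eq_zero_or_pos v with rfl | h0
  · omega
  · have : v ≤ v * v := Nat.le_mul_self v
    calc (v + 1) * (v + 1) = v * v + 2 * v + 1 := by ring
      _ ≤ 4 * n := by omega

/-- With `mul_add_inj`: tables stored row by row stay within bounds, and distinct entries have
distinct addresses. -/
theorem mul_add_lt {a b i j : ℕ} (hi : i < a) (hj : j < b) : i * b + j < a * b :=
  calc i * b + j < i * b + b := by omega
    _ = (i + 1) * b := by ring
    _ ≤ a * b := Nat.mul_le_mul_right _ hi

theorem mul_add_inj {b i j i' j' : ℕ} (hj : j < b) (hj' : j' < b) (h : i * b + j = i' * b + j') :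
    i = i' ∧ j = j' := by
  have hb : 0 < b := by omega
  have h1 : (i * b + j) / b = i := by
    rw [add_comm, Nat.add_mul_div_right _ _ hb, Nat.div_eq_of_lt hj, zero_add]
  have h2 : (i' * b + j') / b = i' := by
    rw [add_comm, Nat.add_mul_div_right _ _ hb, Nat.div_eq_of_lt hj', zero_add]
  have h3 : i = i' := by rw [← h1, h, h2]
  subst h3
  exact ⟨rfl, by omega⟩

/-- Find the remaining point of block `vB` that is nearest to the point `vJ`. -/
def scanBlock : Prog :=
  .seq (asg vBest (rd vN)) <|
  .seq (forLoop vO (rd vW)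
    (.seq (asg vY (.add (.mul (rd vB) (rd vW)) (rd vO)))
      (.ite (.conj (.conj (.wlt (rd vY) (rd vN)) (.weq (.read vRM (rd vY)) (.lit 0)))
          (.neg (.conj (.wlt (rd vBest) (rd vN))
            (.neg (.rlt (.dist (rd vY) (rd vJ)) (.dist (rd vBest) (rd vJ)))))))
        (asg vBest (rd vY)) .skip))) <|
  .wset vBM (rd vB) (rd vBest)

/-- Find the block with the minimum that is nearest to the point `vJ`. -/
def findBlock : Prog :=
  .seq (asg vBB (rd vW)) <|
  forLoop vB (rd vW)
    (.ite (.conj (.wlt (.read vBM (rd vB)) (rd vN))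
        (.neg (.conj (.wlt (rd vBB) (rd vW))
          (.neg (.rlt (.dist (.read vBM (rd vB)) (rd vJ))
            (.dist (.read vBM (rd vBB)) (rd vJ)))))))
      (asg vBB (rd vB)) .skip)

/-- Remove the minimum and append it to the list of the point `vJ`. -/
def extract : Prog :=
  .seq findBlock <|
  .seq (.seq (asg vX (.read vBM (rd vBB))) <|
    .seq (.wset vNB (.add (.mul (rd vJ) (rd vW)) (rd vR)) (rd vX)) <|
    .seq (.wset vRM (rd vX) (.lit 1)) <| asg vB (rd vBB))
  scanBlock

/-- Compute the list of the point `vJ`. -/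
def nearestList : Prog :=
  .seq (forLoop vX (rd vN) (.wset vRM (rd vX) (.lit 0))) <|
  .seq (forLoop vB (rd vW) scanBlock) <|
  forLoop vR (rd vW) extract

/-- Compute the lists of all points. -/
def nearestLists : Prog := forLoop vJ (rd vN) nearestList

@[simp] theorem mods_scanBlock : scanBlock.mods = [vBest, vO, vY, vBest, vO, vBM] := rfl
@[simp] theorem mods_findBlock : findBlock.mods = [vBB, vB, vBB, vB] := rfl

section Nearest

variable {n W D : ℕ} {d : Fin n → Fin n → ℝ}

/-- The remaining points of block `b`. -/
def Remaining (s : State n) (b y : ℕ) : Prop :=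
  y < n ∧ s.word vRM y = 0 ∧ y / sqrtCeil n = b

theorem spec_scanBlock {s : State n} {b j : ℕ} (hn : 2 ≤ n) (hs : Params D s)
    (hW : (n + 1) * (n + 1) ≤ W) (hb : s.word vB 0 = b) (hbw : b < sqrtCeil n)
    (hj : s.word vJ 0 = j) :
    Spec W d scanBlock s (100 * sqrtCeil n + 50) (fun s' =>
      (∀ b', b' ≠ b → s'.word vBM b' = s.word vBM b') ∧
      IsArgmin (Remaining s b) (fun y => natDist d y j) n (s'.word vBM b)) 0 := by
  have hwpos := sqrtCeil_pos (n := n) (by omega)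
  have hwn := sqrtCeil_le n
  have hww : sqrtCeil n * sqrtCeil n ≤ n * n := Nat.mul_le_mul hwn hwn
  have hnW : n * n + 2 * n + 1 ≤ W := by
    have : (n + 1) * (n + 1) = n * n + 2 * n + 1 := by ring
    omega
  unfold scanBlock
  refine Spec.seq (ε1 := 0) (ε2 := 0) (c1 := 10) (c2 := 100 * sqrtCeil n + 35)
    (P := fun s' => s'.word vBest 0 = n) (Spec.of_eff (by simp) (by simp) (by simp [hs.n_eq])) ?_
  intro s1 hs1 hF1
  refine Spec.seq (ε1 := 0) (ε2 := 0) (c1 := 100 * sqrtCeil n + 20) (c2 := 10)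
    (P := fun s' => IsArgmin (Remaining s b) (fun y => natDist d y j) n (s'.word vBest 0)) ?_ ?_
  · refine (spec_forLoop (N := sqrtCeil n) (C := 100 * sqrtCeil n + 20) (δ := 0)
      (fun k s' => IsArgmin (fun y => y < n ∧ s.word vRM y = 0 ∧ ∃ o < k, y = b * sqrtCeil n + o)
        (fun y => natDist d y j) n (s'.word vBest 0)) 80 0 ?_ ?_ ?_ ?_ ?_ ?_ ?_).weaken le_rfl ?_
        le_rfl
    · intro s' hF
      simp [hF.word _ (show vW ∉ _ by simp), hF1.word _ (show vW ∉ _ by simp), hs.W_eq]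
    · omega
    · simp
    · left; simp [hs1]
    · intro k s' hk hF hx hI
      refine Spec.of_eff (by simp) (by simp) ?_
      have e1 : b * sqrtCeil n % W = b * sqrtCeil n := by
        refine Nat.mod_eq_of_lt ?_
        have := mul_add_lt hbw hwpos
        omega
      have e2 : (b * sqrtCeil n + k) % W = b * sqrtCeil n + k := by
        refine Nat.mod_eq_of_lt ?_
        have := mul_add_lt hbw hk
        omega
      have f0 : s'.word vN 0 = n := by
        rw [hF.word _ (by simp), hF1.word _ (by simp), hs.n_eq]
      have f1 : s'.word vW 0 = sqrtCeil n := by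
        rw [hF.word _ (by simp), hF1.word _ (by simp), hs.W_eq]
      have f2 : s'.word vB 0 = b := by rw [hF.word _ (by simp), hF1.word _ (by simp), hb]
      have f3 : s'.word vJ 0 = j := by rw [hF.word _ (by simp), hF1.word _ (by simp), hj]
      have f4 : s'.word vRM = s.word vRM := by rw [hF.word _ (by simp), hF1.word _ (by simp)]
      simp only [Prog.eff, eff_asg, WExpr.eval, BExpr.Holds, eval_rd, word_setWord, f0, f1, f2, f3,
        f4, hx, e1, e2, eval_dist, Nat.zero_mod]
      simp only [Nat.reduceEqDiff, false_and, if_false, and_self, if_true]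
      set y := b * sqrtCeil n + k with hy
      by_cases hC : y < n ∧ s.word vRM y = 0
      · have := hI.insert (y := y) hC.1 (C' := fun y' => y' < n ∧ s.word vRM y' = 0 ∧
            ∃ o < k + 1, y' = b * sqrtCeil n + o) ?_
        · convert this using 1
          by_cases h : s'.word vBest 0 < n ∧ ¬ natDist d y j < natDist d (s'.word vBest 0) j
          · rw [if_neg (by tauto), if_pos h]
            simp
          · rw [if_pos (by tauto), if_neg h]
            simp
        · intro x
          constructor
          · rintro ⟨h1, h2, o, ho, h3⟩
            rcases (show o < k ∨ o = k by omega) with ho | rfl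
            · exact Or.inl ⟨h1, h2, o, ho, h3⟩
            · exact Or.inr h3
          · rintro (⟨h1, h2, o, ho, h3⟩ | rfl)
            · exact ⟨h1, h2, o, by omega, h3⟩
            · exact ⟨hC.1, hC.2, k, by omega, rfl⟩
      · rw [if_neg (by tauto)]
        simp only [word_setWord]
        simp
        refine hI.congr fun x => ⟨?_, ?_⟩
        · rintro ⟨h1, h2, o, ho, h3⟩
          rcases (show o < k ∨ o = k by omega) with ho | rfl
          · exact ⟨h1, h2, o, ho, h3⟩
          · subst h3; exact absurd ⟨h1, h2⟩ hC
        · rintro ⟨h1, h2, o, ho, h3⟩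
          exact ⟨h1, h2, o, by omega, h3⟩
    · simp only [cost_rd]; omega
    · simp
    · rintro s' - ⟨h, -⟩
      refine h.congr fun y => ?_
      unfold Remaining
      refine and_congr_right fun _ => and_congr_right fun _ => ?_
      constructor
      · intro h
        refine ⟨y % sqrtCeil n, Nat.mod_lt _ hwpos, ?_⟩
        rw [← h, mul_comm]
        exact (Nat.div_add_mod y _).symm
      · rintro ⟨o, ho, rfl⟩
        rw [add_comm, Nat.add_mul_div_right _ _ hwpos, Nat.div_eq_of_lt ho, zero_add]
  · intro s2 hs2 hF2
    refine Spec.of_eff (by simp) (by simp) ?_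
    have f2 : s2.word vB 0 = b := by rw [hF2.word _ (by simp), hF1.word _ (by simp), hb]
    have f3 : s2.word vBM = s.word vBM := by rw [hF2.word _ (by simp), hF1.word _ (by simp)]
    simp [f2, f3, hs2]
    exact fun b' hb' h => absurd h hb'

theorem spec_findBlock {s : State n} {j : ℕ} (hs : Params D s)
    (hW : (n + 1) * (n + 1) ≤ W) (hj : s.word vJ 0 = j) :
    Spec W d findBlock s (100 * sqrtCeil n + 50) (fun s' =>
      IsArgmin (fun b => b < sqrtCeil n ∧ s.word vBM b < n) (fun b => natDist d (s.word vBM b) j)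
        (sqrtCeil n) (s'.word vBB 0)) 0 := by
  have hwn := sqrtCeil_le n
  have hnW : n * n + 2 * n + 1 ≤ W := by
    have : (n + 1) * (n + 1) = n * n + 2 * n + 1 := by ring
    omega
  unfold findBlock
  refine Spec.seq (ε1 := 0) (ε2 := 0) (c1 := 10) (c2 := 100 * sqrtCeil n + 30)
    (P := fun s' => s'.word vBB 0 = sqrtCeil n)
    (Spec.of_eff (by simp) (by simp) (by simp [hs.W_eq])) ?_
  intro s1 hs1 hF1
  refine (spec_forLoop (N := sqrtCeil n) (C := 100 * sqrtCeil n + 30) (δ := 0)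
    (fun k s' => IsArgmin (fun b => b < k ∧ s.word vBM b < n)
      (fun b => natDist d (s.word vBM b) j) (sqrtCeil n) (s'.word vBB 0)) 80 0
      ?_ ?_ ?_ ?_ ?_ ?_ ?_).weaken le_rfl (fun s' _ h => h.1) le_rfl
  · intro s' hF
    simp [hF.word _ (show vW ∉ _ by simp), hF1.word _ (show vW ∉ _ by simp), hs.W_eq]
  · omega
  · simp
  · left; simp [hs1]
  · intro k s' hk hF hx hI
    refine Spec.of_eff (by simp) (by simp) ?_
    have f0 : s'.word vN 0 = n := by
      rw [hF.word _ (by simp), hF1.word _ (by simp), hs.n_eq]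
    have f1 : s'.word vW 0 = sqrtCeil n := by
      rw [hF.word _ (by simp), hF1.word _ (by simp), hs.W_eq]
    have f3 : s'.word vJ 0 = j := by rw [hF.word _ (by simp), hF1.word _ (by simp), hj]
    have f4 : s'.word vBM = s.word vBM := by rw [hF.word _ (by simp), hF1.word _ (by simp)]
    simp only [Prog.eff, eff_asg, WExpr.eval, BExpr.Holds, eval_rd, f0, f1, f3, f4, hx, eval_dist]
    by_cases hC : s.word vBM k < n
    · have := hI.insert (y := k) hk (C' := fun b => b < k + 1 ∧ s.word vBM b < n) ?_
      · convert this using 1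
        by_cases h : s'.word vBB 0 < sqrtCeil n ∧ ¬ natDist d (s.word vBM k) j <
            natDist d (s.word vBM (s'.word vBB 0)) j
        · rw [if_neg (by tauto), if_pos h]
          simp
        · rw [if_pos (by tauto), if_neg h]
          simp
      · intro x
        constructor
        · rintro ⟨h1, h2⟩
          rcases (show x < k ∨ x = k by omega) with ho | rfl
          · exact Or.inl ⟨ho, h2⟩
          · exact Or.inr rfl
        · rintro (⟨h1, h2⟩ | rfl)
          · exact ⟨by omega, h2⟩
          · exact ⟨by omega, hC⟩
    · rw [if_neg (by tauto)]
      simp only [word_setWord]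
      simp
      refine hI.congr fun x => ⟨?_, ?_⟩
      · rintro ⟨h1, h2⟩
        rcases (show x < k ∨ x = k by omega) with ho | rfl
        · exact ⟨ho, h2⟩
        · exact absurd h2 hC
      · rintro ⟨h1, h2⟩
        exact ⟨by omega, h2⟩
  · simp only [cost_rd]; omega
  · simp

end Nearest

/-! ### Extraction of the nearest points -/

section Nearest

variable {n W D : ℕ} {d : Fin n → Fin n → ℝ}

theorem remaining_setWord (s : State n) (v : ℕ) :
    Remaining (s.setWord vR 0 v) = Remaining s := by
  funext b y; simp [Remaining]

/-- Entry `r` of the list of `j`. -/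
noncomputable def nb (s : State n) (j r : ℕ) : ℕ := s.word vNB (j * sqrtCeil n + r)

/-- The first `r` entries of the list of `j` have been extracted. -/
structure Extracted (d : Fin n → Fin n → ℝ) (s : State n) (j r : ℕ) : Prop where
  lt : ∀ r' < r, nb s j r' < n
  removed : ∀ x < n, s.word vRM x ≠ 0 ↔ ∃ r' < r, nb s j r' = x
  inj : ∀ r₁ < r, ∀ r₂ < r, nb s j r₁ = nb s j r₂ → r₁ = r₂
  le : ∀ r' < r, ∀ x < n, s.word vRM x = 0 → natDist d (nb s j r') j ≤ natDist d x j
  blocks : ∀ b < sqrtCeil n, IsArgmin (Remaining s b) (fun y => natDist d y j) n (s.word vBM b)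

/-- The list of `j` consists of `sqrtCeil n` distinct points nearest to `j`. -/
structure IsNearestList (d : Fin n → Fin n → ℝ) (s : State n) (j : ℕ) : Prop where
  lt : ∀ r < sqrtCeil n, nb s j r < n
  inj : ∀ r₁ < sqrtCeil n, ∀ r₂ < sqrtCeil n, nb s j r₁ = nb s j r₂ → r₁ = r₂
  le : ∀ r < sqrtCeil n, ∀ x < n, (∀ r' < sqrtCeil n, nb s j r' ≠ x) →
    natDist d (nb s j r) j ≤ natDist d x j

theorem Extracted.isNearestList {s : State n} {j : ℕ} (h : Extracted d s j (sqrtCeil n)) :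
    IsNearestList d s j := by
  refine ⟨h.lt, h.inj, fun r hr x hx hne => h.le r hr x hx ?_⟩
  by_contra h0
  obtain ⟨r', hr', h'⟩ := (h.removed x hx).mp h0
  exact hne r' hr' h'

theorem IsNearestList.congr {s s' : State n} {j : ℕ} (h : IsNearestList d s j)
    (hs : ∀ r < sqrtCeil n, nb s' j r = nb s j r) : IsNearestList d s' j := by
  constructor
  · intro r hr; rw [hs r hr]; exact h.lt r hr
  · intro r₁ h₁ r₂ h₂; rw [hs _ h₁, hs _ h₂]; exact h.inj _ h₁ _ h₂
  · intro r hr x hx hne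
    rw [hs r hr]
    exact h.le r hr x hx fun r' hr' => by rw [← hs r' hr']; exact hne r' hr'

/-- If not all entries have been extracted, the overall minimum is the minimum of some block. -/
theorem Extracted.exists_min {s : State n} {j r bb : ℕ} (hr : r < sqrtCeil n)
    (h : Extracted d s j r)
    (hbb : IsArgmin (fun b => b < sqrtCeil n ∧ s.word vBM b < n)
      (fun b => natDist d (s.word vBM b) j) (sqrtCeil n) bb) :
    bb < sqrtCeil n ∧ Remaining s bb (s.word vBM bb) ∧
      ∀ x < n, s.word vRM x = 0 → natDist d (s.word vBM bb) j ≤ natDist d x j := by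
  have hblock : ∀ x < n, s.word vRM x = 0 → x / sqrtCeil n < sqrtCeil n ∧
      s.word vBM (x / sqrtCeil n) < n ∧
      natDist d (s.word vBM (x / sqrtCeil n)) j ≤ natDist d x j := by
    intro x hx h0
    have hlt : x / sqrtCeil n < sqrtCeil n :=
      Nat.div_lt_of_lt_mul (lt_of_lt_of_le hx (le_sqrtCeil_mul n))
    rcases h.blocks _ hlt with ⟨-, h2⟩ | ⟨h1, h2, h3⟩
    · exact absurd ⟨hx, h0, rfl⟩ (h2 x)
    · exact ⟨hlt, h1, h3 x ⟨hx, h0, rfl⟩⟩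
  -- Only `r < sqrtCeil n ≤ n` points have been removed, so one remains.
  have hex : ∃ x < n, s.word vRM x = 0 := by
    by_contra hno
    push Not at hno
    have hsub : Finset.range n ⊆ (Finset.range r).image (nb s j) := by
      intro x hx
      rw [Finset.mem_range] at hx
      obtain ⟨r', hr', h'⟩ := (h.removed x hx).mp (hno x hx)
      exact Finset.mem_image.mpr ⟨r', Finset.mem_range.mpr hr', h'⟩
    have := (Finset.card_le_card hsub).trans Finset.card_image_le
    have := sqrtCeil_le n
    simp only [Finset.card_range] at *
    omega
  rcases hbb with ⟨-, h2⟩ | ⟨h1, h2, h3⟩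
  · obtain ⟨x, hx, h0⟩ := hex
    obtain ⟨h4, h5, -⟩ := hblock x hx h0
    exact absurd ⟨h4, h5⟩ (h2 _)
  · refine ⟨h1, ?_, ?_⟩
    · rcases h.blocks bb h1 with ⟨h4, -⟩ | ⟨-, h5, -⟩
      · omega
      · exact h5
    · intro x hx h0
      obtain ⟨h4, h5, h6⟩ := hblock x hx h0
      exact (h3 _ ⟨h4, h5⟩).trans h6

/-- Removing a point affects the minimum of its own block only, so a single rescan restores all
block minima. -/
theorem spec_extract {s : State n} {j r : ℕ} (hn : 2 ≤ n) (hs : Params D s)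
    (hW : (n + 1) * (n + 1) ≤ W) (hj : s.word vJ 0 = j) (hjn : j < n) (hr : s.word vR 0 = r)
    (hrw : r < sqrtCeil n) (hI : Extracted d s j r) :
    Spec W d extract s (200 * sqrtCeil n + 200) (fun s' => Extracted d s' j (r + 1) ∧
      ∀ a < j * sqrtCeil n, s'.word vNB a = s.word vNB a) 0 := by
  have hwpos := sqrtCeil_pos (n := n) (by omega)
  have hwn := sqrtCeil_le n
  have hjr := mul_add_lt hjn hrw
  have hnw : n * sqrtCeil n ≤ n * n := Nat.mul_le_mul_left n hwn
  have hnW : n * n + 2 * n + 1 ≤ W := by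
    have : (n + 1) * (n + 1) = n * n + 2 * n + 1 := by ring
    omega
  unfold extract
  refine Spec.seq (ε1 := 0) (ε2 := 0) (spec_findBlock hs hW hj)
    (c2 := 100 * sqrtCeil n + 140) ?_
  intro s1 hs1 hF1
  obtain ⟨hbb, hz, hmin⟩ := hI.exists_min hrw hs1
  set bb := s1.word vBB 0 with hbbdef
  set z := s.word vBM bb with hzdef
  have hs1P : Params D s1 := hs.frame hF1 (by simp)
  have e1 : j * sqrtCeil n % W = j * sqrtCeil n := Nat.mod_eq_of_lt (by omega)
  have e2 : (j * sqrtCeil n + r) % W = j * sqrtCeil n + r := Nat.mod_eq_of_lt (by omega)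
  have e3 : 1 % W = 1 := Nat.mod_eq_of_lt (by omega)
  have f1 : s1.word vJ 0 = j := by rw [hF1.word _ (by simp), hj]
  have f2 : s1.word vR 0 = r := by rw [hF1.word _ (by simp), hr]
  have f3 : s1.word vBM = s.word vBM := by rw [hF1.word _ (by simp)]
  have f4 : s1.word vNB = s.word vNB := by rw [hF1.word _ (by simp)]
  have f5 : s1.word vRM = s.word vRM := by rw [hF1.word _ (by simp)]
  refine Spec.seq (ε1 := 0) (ε2 := 0) (c1 := 60) (c2 := 100 * sqrtCeil n + 50)
    (P := fun s' => s'.word vB 0 = bb ∧ s'.word vJ 0 = j ∧ s'.word vBM = s.word vBM ∧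
      (∀ a, s'.word vNB a = if a = j * sqrtCeil n + r then z else s.word vNB a) ∧
      (∀ a, s'.word vRM a = if a = z then 1 else s.word vRM a))
    (Spec.of_eff (by simp) (by simp) ?_) ?_
  · simp only [Prog.eff, eff_asg, WExpr.eval, eval_rd, word_setWord]
    simp only [Nat.reduceEqDiff, false_and, if_false, and_self, if_true, hs1P.W_eq, f1, f2, f3, f4,
      f5, e1, e2, e3, ← hbbdef, ← hzdef, true_and, implies_true, and_true]
    funext a
    simp [f3]
  rintro s2 ⟨hB2, hJ2, hBM2, hNB2, hRM2⟩ hF2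
  have hs2P : Params D s2 := hs1P.frame hF2 (by simp)
  refine (spec_scanBlock hn hs2P hW hB2 hbb hJ2).weaken le_rfl ?_ le_rfl
  rintro s3 hF3 ⟨hother, hnew⟩
  have hNB3 : ∀ a, s3.word vNB a = if a = j * sqrtCeil n + r then z else s.word vNB a := by
    intro a; rw [hF3.word _ (by simp), hNB2]
  have hRM3 : ∀ a, s3.word vRM a = if a = z then 1 else s.word vRM a := by
    intro a; rw [hF3.word _ (by simp), hRM2]
  have hnbr : nb s3 j r = z := by unfold nb; rw [hNB3, if_pos rfl]
  have hnb : ∀ r' < r, nb s3 j r' = nb s j r' := by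
    intro r' hr'
    unfold nb
    rw [hNB3, if_neg (by omega)]
  have hrem : ∀ b y, Remaining s3 b y ↔ Remaining s b y ∧ y ≠ z := by
    intro b y
    unfold Remaining
    rw [hRM3]
    by_cases hy : y = z <;> simp [hy]
  have hrem2 : ∀ b y, Remaining s2 b y ↔ Remaining s3 b y := by
    intro b y
    unfold Remaining
    rw [hRM3, hRM2]
  refine ⟨⟨?_, ?_, ?_, ?_, ?_⟩, ?_⟩
  · intro r' hr'
    rcases (show r' < r ∨ r' = r by omega) with h | rfl
    · rw [hnb r' h]; exact hI.lt r' h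
    · rw [hnbr]; exact hz.1
  · intro x hx
    rw [hRM3]
    by_cases hxz : x = z
    · simp only [hxz, if_true]
      exact ⟨fun _ => ⟨r, by omega, hnbr⟩, fun _ => by omega⟩
    · rw [if_neg hxz, hI.removed x hx]
      constructor
      · rintro ⟨r', hr', h⟩
        exact ⟨r', by omega, by rw [hnb r' hr', h]⟩
      · rintro ⟨r', hr', h⟩
        rcases (show r' < r ∨ r' = r by omega) with h' | rfl
        · exact ⟨r', h', by rw [← hnb r' h', h]⟩
        · exact absurd (h.symm.trans hnbr) hxz
  · have hne : ∀ r' < r, nb s j r' ≠ z := fun r' hr' h =>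
      (hI.removed z hz.1).mpr ⟨r', hr', h⟩ hz.2.1
    intro r₁ h₁ r₂ h₂ h
    rcases (show r₁ < r ∨ r₁ = r by omega) with h₁' | h₁' <;>
    rcases (show r₂ < r ∨ r₂ = r by omega) with h₂' | h₂'
    · rw [hnb _ h₁', hnb _ h₂'] at h; exact hI.inj _ h₁' _ h₂' h
    · rw [hnb _ h₁', h₂', hnbr] at h; exact absurd h (hne _ h₁')
    · rw [hnb _ h₂', h₁', hnbr] at h; exact absurd h.symm (hne _ h₂')
    · omega
  · intro r' hr' x hx h0
    rw [hRM3] at h0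
    have hxz : x ≠ z := fun h => by simp [h] at h0
    rw [if_neg hxz] at h0
    rcases (show r' < r ∨ r' = r by omega) with h | rfl
    · rw [hnb r' h]; exact hI.le r' h x hx h0
    · rw [hnbr]; exact hmin x hx h0
  · intro b hb
    by_cases hbe : b = bb
    · subst hbe
      exact hnew.congr fun y => (hrem2 _ y).symm
    · rw [hother b hbe, hBM2]
      refine (hI.blocks b hb).congr fun y => ?_
      rw [hrem]
      refine ⟨fun h => h.1, fun h => ⟨h, ?_⟩⟩
      rintro rfl
      exact hbe (h.2.2.symm.trans hz.2.2)
  · intro a ha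
    rw [hNB3, if_neg (by omega)]

/-- Linear time: `sqrtCeil n` block scans and as many extractions, each of cost `O(sqrtCeil n)`.
Preserving the cells below `j * sqrtCeil n` keeps the lists of earlier points. -/
theorem spec_nearestList {s : State n} {j : ℕ} (hn : 2 ≤ n) (hs : Params D s)
    (hW : (n + 1) * (n + 1) ≤ W) (hj : s.word vJ 0 = j) (hjn : j < n) :
    Spec W d nearestList s (3000 * n) (fun s' => IsNearestList d s' j ∧
      ∀ a < j * sqrtCeil n, s'.word vNB a = s.word vNB a) 0 := by
  have hwpos := sqrtCeil_pos (n := n) (by omega)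
  have hwn := sqrtCeil_le n
  have hww := sqrtCeil_mul_le hn
  have hnW : n * n + 2 * n + 1 ≤ W := by
    have : (n + 1) * (n + 1) = n * n + 2 * n + 1 := by ring
    omega
  unfold nearestList
  refine Spec.seq (ε1 := 0) (ε2 := 0) (c1 := 20 * n + 10)
    (c2 := 300 * (sqrtCeil n * sqrtCeil n) + 600 * sqrtCeil n + 60)
    (P := fun s' => ∀ x < n, s'.word vRM x = 0) ?_ ?_
  · refine (spec_forLoop (N := n) (C := 20 * n + 10) (δ := 0)
      (fun k s' => ∀ x < k, s'.word vRM x = 0) 4 0 ?_ (by omega) (by simp) (by simp) ?_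
      ?_ (by simp)).weaken le_rfl (fun s' _ h => h.1) le_rfl
    · intro s' hF
      simp [hF.word _ (show vN ∉ _ by simp), hs.n_eq]
    · intro k s' hk hF hx hI
      refine Spec.of_eff (by simp) (by simp) ?_
      simp [hx]
      intro x hxk
      exact fun h => hI x (by omega)
    · simp only [cost_rd]; omega
  intro s1 hRM1 hF1
  have hs1 : Params D s1 := hs.frame hF1 (by simp)
  have hj1 : s1.word vJ 0 = j := by rw [hF1.word _ (by simp), hj]
  refine Spec.seq (ε1 := 0) (ε2 := 0)
    (c1 := 100 * (sqrtCeil n * sqrtCeil n) + 100 * sqrtCeil n + 10)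
    (c2 := 200 * (sqrtCeil n * sqrtCeil n) + 300 * sqrtCeil n + 20)
    (P := fun s' => Extracted d s' j 0 ∧ s'.word vNB = s.word vNB) ?_ ?_
  · refine (spec_forLoop (N := sqrtCeil n)
      (C := 100 * (sqrtCeil n * sqrtCeil n) + 100 * sqrtCeil n + 10) (δ := 0)
      (fun k s' => ∀ b < k, IsArgmin (Remaining s1 b) (fun y => natDist d y j) n (s'.word vBM b))
      (100 * sqrtCeil n + 50) 0 ?_ (by omega) (by simp) (by simp) ?_
      ?_ (by simp)).weaken le_rfl ?_ le_rfl
    · intro s' hF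
      simp [hF.word _ (show vW ∉ _ by simp), hs1.W_eq]
    · intro k s' hk hF hx hI
      refine (spec_scanBlock hn (hs1.frame hF (by simp)) hW hx hk
        (by rw [hF.word _ (by simp), hj1])).weaken le_rfl ?_ le_rfl
      rintro s'' hF' ⟨h1, h2⟩ b hb
      simp only [word_setWord, Nat.reduceEqDiff, false_and, if_false]
      have hRM : s'.word vRM = s1.word vRM := hF.word _ (by simp)
      rcases (show b < k ∨ b = k by omega) with h | rfl
      · rw [h1 b (by omega)]; exact hI b h
      · refine h2.congr fun y => ?_
        unfold Remaining; rw [hRM]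
    · simp only [cost_rd]
      have : sqrtCeil n * (100 * sqrtCeil n + 50 + 2 + 11) =
        100 * (sqrtCeil n * sqrtCeil n) + 63 * sqrtCeil n := by ring
      omega
    · rintro s' hF ⟨h, -⟩
      have hRM : s'.word vRM = s1.word vRM := hF.word _ (by simp)
      refine ⟨⟨by simp, ?_, by simp, by simp, ?_⟩, ?_⟩
      · intro x hx
        rw [hRM]
        simp [hRM1 x hx]
      · intro b hb
        refine (h b hb).congr fun y => ?_
        unfold Remaining; rw [hRM]
      · rw [hF.word _ (by simp), hF1.word _ (by simp)]
  rintro s2 ⟨hE2, hNB2⟩ hF2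
  have hs2 : Params D s2 := hs1.frame hF2 (by simp)
  have hj2 : s2.word vJ 0 = j := by rw [hF2.word _ (by simp), hj1]
  refine (spec_forLoop (N := sqrtCeil n)
      (C := 200 * (sqrtCeil n * sqrtCeil n) + 300 * sqrtCeil n + 20) (δ := 0)
      (fun k s' => Extracted d s' j k ∧ ∀ a < j * sqrtCeil n, s'.word vNB a = s.word vNB a)
      (200 * sqrtCeil n + 200) 0 ?_ (by omega) (by simp [extract]) ?_ ?_
      ?_ (by simp)).weaken le_rfl ?_ le_rfl
  · intro s' hF
    simp [hF.word _ (show vW ∉ _ by simp [extract]), hs2.W_eq]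
  · refine ⟨⟨by simp, ?_, by simp, by simp, ?_⟩, by simp [hNB2]⟩
    · simpa using hE2.removed
    · simpa [remaining_setWord] using hE2.blocks
  · rintro k s' hk hF hx ⟨hI, hI'⟩
    refine (spec_extract hn (hs2.frame hF (by simp [extract])) hW
      (by rw [hF.word _ (by simp [extract]), hj2]) hjn hx hk hI).weaken le_rfl ?_ le_rfl
    rintro s'' hF' ⟨h1, h2⟩
    refine ⟨⟨?_, ?_, ?_, ?_, ?_⟩, ?_⟩
    · simpa [nb] using h1.lt
    · simpa [nb] using h1.removed
    · simpa [nb] using h1.inj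
    · simpa [nb] using h1.le
    · simpa [remaining_setWord] using h1.blocks
    · intro a ha
      simp only [word_setWord, Nat.reduceEqDiff, false_and, if_false]
      rw [h2 a ha, hI' a ha]
  · simp only [cost_rd]
    have : sqrtCeil n * (200 * sqrtCeil n + 200 + 2 + 11) =
      200 * (sqrtCeil n * sqrtCeil n) + 213 * sqrtCeil n := by ring
    omega
  · rintro s' - ⟨⟨h1, h2⟩, -⟩
    exact ⟨h1.isNearestList, h2⟩

theorem spec_nearestLists {s : State n} (hn : 2 ≤ n) (hs : Params D s)
    (hW : (n + 1) * (n + 1) ≤ W) :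
    Spec W d nearestLists s (4000 * (n * n)) (fun s' => ∀ j < n, IsNearestList d s' j) 0 := by
  have hwpos := sqrtCeil_pos (n := n) (by omega)
  have hnn : 2 * n ≤ n * n := Nat.mul_le_mul_right n hn
  have hnW : n * n + 2 * n + 1 ≤ W := by
    have : (n + 1) * (n + 1) = n * n + 2 * n + 1 := by ring
    omega
  refine (spec_forLoop (N := n) (C := 4000 * (n * n)) (δ := 0)
      (fun k s' => ∀ j < k, IsNearestList d s' j) (3000 * n) 0 ?_ (by omega)
      (by simp [nearestList, extract]) (by simp) ?_ ?_ (by simp)).weaken le_rfl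
      (fun _ _ h => h.1) le_rfl
  · intro s' hF
    simp [hF.word _ (show vN ∉ _ by simp [nearestList, extract]), hs.n_eq]
  · intro k s' hk hF hx hI
    refine (spec_nearestList hn (hs.frame hF (by simp [nearestList, extract])) hW hx hk).weaken
      le_rfl ?_ le_rfl
    rintro s'' hF' ⟨h1, h2⟩ j hj
    have hset : ∀ r, nb (s''.setWord vJ 0 (k + 1)) j r = nb s'' j r := fun r => by simp [nb]
    rcases (show j < k ∨ j = k by omega) with h | rfl
    · refine (hI j h).congr fun r hr => ?_
      rw [hset]
      exact h2 _ (mul_add_lt h hr)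
    · exact h1.congr fun r _ => hset r
  · simp only [cost_rd]
    have : n * (3000 * n + 2 + 11) = 3000 * (n * n) + 13 * n := by ring
    omega

end Nearest

/-! ## Estimating the number of uncovered elements of a set by sampling -/

/-- The Boolean expression `cov` tests the relation `Cv` for the points `vI`, `vX` and `vJ`;
`Cv i x j` says that an edge from `i` to `x` takes care of the point `j`. -/
structure CoverTest {n : ℕ} (W : ℕ) (d : Fin n → Fin n → ℝ) (a : ℝ) (cov : BExpr)
    (Cv : ℕ → ℕ → ℕ → Prop) : Prop where
  cost : cov.cost ≤ 30
  holds : ∀ s : State n, s.real 0 0 = a →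
    (cov.Holds W d s ↔ Cv (s.word vI 0) (s.word vX 0) (s.word vJ 0))

/-- Collect the uncovered points in the list `vUL` of length `vU`. -/
def buildList : Prog :=
  .seq (asg vU (.lit 0)) <|
  forLoop vJ (rd vN) (.ite (.weq (.read vCV (rd vJ)) (.lit 0))
    (.seq (.wset vUL (rd vU) (rd vJ)) (asg vU (.add (rd vU) (.lit 1)))) .skip)

/-- Mark the points covered by the edge from `vI` to `vX`. -/
def mark (cov : BExpr) : Prog :=
  forLoop vJ (rd vN) (.ite (.conj (.weq (.read vCV (rd vJ)) (.lit 0)) cov)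
    (.wset vCV (rd vJ) (.lit 1)) .skip)

/-- The number of samples used by `sampleHits`. -/
def sampleSize : WExpr := .mul (.mul (.lit 4) (rd vM)) (rd vG)

/-- Draw one point from the list `vUL` and count it if it is uncovered and gets covered by the edge
from `vI` to `vX`. -/
def sampleOne (cov : BExpr) : Prog :=
  .seq (.rand vV (.lit 0) (rd vU)) <|
  .seq (asg vJ (.read vUL (rd vV))) <|
  .ite (.conj (.weq (.read vCV (rd vJ)) (.lit 0)) cov) (asg vH (.add (rd vH) (.lit 1))) .skip

/-- Count the hits among a number of random samples. -/
def sampleHits (cov : BExpr) : Prog :=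
  .seq (asg vH (.lit 0)) (forLoop vT sampleSize (sampleOne cov))

@[simp] theorem mods_buildList : buildList.mods = [vU, vJ, vUL, vU, vJ] := rfl
@[simp] theorem keepsReals_buildList : buildList.keepsReals = true := rfl
@[simp] theorem silent_buildList : buildList.silent = true := rfl
@[simp] theorem silent_mark (cov : BExpr) : (mark cov).silent = true := rfl
@[simp] theorem mods_sampleOne (cov : BExpr) : (sampleOne cov).mods = [vV, vJ, vH] := rfl
@[simp] theorem keepsReals_sampleOne (cov : BExpr) : (sampleOne cov).keepsReals = true := rfl
@[simp] theorem mods_sampleHits (cov : BExpr) :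
    (sampleHits cov).mods = [vH, vT, vV, vJ, vH, vT] := rfl
@[simp] theorem keepsReals_sampleHits (cov : BExpr) : (sampleHits cov).keepsReals = true := rfl
@[simp] theorem silent_sampleHits (cov : BExpr) : (sampleHits cov).silent = true := rfl

section Sampling

variable {n W D : ℕ} {d : Fin n → Fin n → ℝ} {a : ℝ} {cov : BExpr} {Cv : ℕ → ℕ → ℕ → Prop}

/-- The set of uncovered points. -/
def uncovered (s : State n) : Finset ℕ := (Finset.range n).filter fun j => s.word vCV j = 0

theorem uncovered_congr {s s' : State n} (h : s'.word vCV = s.word vCV) :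
    uncovered s' = uncovered s := by
  unfold uncovered; rw [h]

theorem mem_uncovered {s : State n} {j : ℕ} : j ∈ uncovered s ↔ j < n ∧ s.word vCV j = 0 := by
  simp [uncovered]

theorem card_uncovered_le (s : State n) : (uncovered s).card ≤ n := by
  simpa [uncovered] using Finset.card_filter_le (Finset.range n) fun j => s.word vCV j = 0

/-- `vUL` lists the elements of `S`. -/
structure IsList (s : State n) (S : Finset ℕ) : Prop where
  card : s.word vU 0 = S.card
  image : (Finset.range S.card).image (s.word vUL) = S

theorem spec_buildList {s : State n} (hs : Params D s) (hnW : n + 1 < W) :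
    Spec W d buildList s (50 * n + 50) (fun s' => IsList s' (uncovered s)) 0 := by
  unfold buildList
  have e1 : 1 % W = 1 := Nat.mod_eq_of_lt (by omega)
  refine Spec.seq (ε1 := 0) (ε2 := 0) (c1 := 10) (c2 := 50 * n + 30)
    (P := fun s' => s'.word vU 0 = 0) (Spec.of_eff (by simp) (by simp) (by simp)) ?_
  intro s1 hs1 hF1
  refine (spec_forLoop (N := n) (C := 50 * n + 30) (δ := 0)
      (fun k s' => s'.word vU 0 = ((uncovered s).filter (· < k)).card ∧
        (Finset.range (s'.word vU 0)).image (s'.word vUL) = (uncovered s).filter (· < k)) 33 0 ?_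
        (by omega) (by simp) ?_ ?_ ?_ (by simp)).weaken le_rfl ?_ le_rfl
  · intro s' hF
    simp [hF.word _ (show vN ∉ _ by simp), hF1.word _ (show vN ∉ _ by simp), hs.n_eq]
  · simp [hs1]
  · rintro k s' hk hF hx ⟨h1, h2⟩
    have f1 : s'.word vCV = s.word vCV := by rw [hF.word _ (by simp), hF1.word _ (by simp)]
    refine Spec.of_eff (by simp) (by simp) ?_
    have hfil : (uncovered s).filter (· < k + 1) = if s.word vCV k = 0 then
        insert k ((uncovered s).filter (· < k)) else (uncovered s).filter (· < k) := by
      ext j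
      split_ifs with h0
      · simp only [Finset.mem_filter, mem_uncovered, Finset.mem_insert]
        constructor
        · rintro ⟨⟨h3, h4⟩, h5⟩
          rcases (show j < k ∨ j = k by omega) with h | h
          · exact Or.inr ⟨⟨h3, h4⟩, h⟩
          · exact Or.inl h
        · rintro (rfl | ⟨h3, h4⟩)
          · exact ⟨⟨hk, h0⟩, by omega⟩
          · exact ⟨h3, by omega⟩
      · simp only [Finset.mem_filter, mem_uncovered]
        refine and_congr_right fun h3 => ?_
        have : j ≠ k := by rintro rfl; exact h0 h3.2
        omega
    rw [hfil]
    have hcard : ((uncovered s).filter (· < k)).card ≤ n :=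
      (Finset.card_filter_le _ _).trans (card_uncovered_le s)
    by_cases h0 : s.word vCV k = 0
    · have e2 : (((uncovered s).filter (· < k)).card + 1) % W =
          ((uncovered s).filter (· < k)).card + 1 := Nat.mod_eq_of_lt (by omega)
      simp [f1, hx, h0, e1, h1, e2]
      rw [Finset.range_add_one, Finset.image_insert]
      simp only [word_setWord, Nat.reduceEqDiff, false_and, if_false, and_self, if_true]
      congr 1
      refine Eq.trans ?_ h2
      rw [h1]
      refine Finset.image_congr fun v hv => ?_
      rw [Finset.mem_coe, Finset.mem_range] at hv
      simp only [word_setWord, Nat.reduceEqDiff, false_and, if_false, true_and]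
      rw [if_neg (by omega)]
    · simp only [Prog.eff, BExpr.Holds, WExpr.eval, eval_rd, Nat.zero_mod, hx, f1, if_neg h0]
      refine ⟨by simpa using h1, Eq.trans ?_ h2⟩
      simp only [word_setWord, Nat.reduceEqDiff, false_and, if_false]
      rfl
  · simp only [cost_rd]; omega
  · rintro s' hF ⟨⟨h1, h2⟩, -⟩
    have : (uncovered s).filter (· < n) = uncovered s :=
      Finset.filter_true_of_mem fun j hj => (mem_uncovered.mp hj).1
    rw [this] at h1 h2
    exact ⟨h1, by rw [← h1]; exact h2⟩

open Classical in
theorem spec_mark {s : State n} {i x : ℕ} (hs : Params D s) (hnW : n + 1 < W)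
    (hcov : CoverTest W d a cov Cv) (ha : s.real 0 0 = a) (hi : s.word vI 0 = i)
    (hx : s.word vX 0 = x) :
    Spec W d (mark cov) s (100 * n + 50)
      (fun s' => uncovered s' = (uncovered s).filter fun j => ¬ Cv i x j) 0 := by
  have e1 : 1 % W = 1 := Nat.mod_eq_of_lt (by omega)
  have hc := hcov.cost
  unfold mark
  refine (spec_forLoop (N := n) (C := 100 * n + 50) (δ := 0)
      (fun k s' => ∀ j, s'.word vCV j = if j < k ∧ s.word vCV j = 0 ∧ Cv i x j then 1 else
        s.word vCV j) 60 0 ?_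
        (by omega) (by simp) ?_ ?_ ?_ (by simp)).weaken le_rfl ?_ le_rfl
  · intro s' hF
    simp [hF.word _ (show vN ∉ _ by simp), hs.n_eq]
  · simp
  · rintro k s' hk hF hJ hI
    refine Spec.of_eff (by simp) (by simp; omega) ?_
    have h0 : s'.word vCV k = s.word vCV k := by rw [hI, if_neg (by omega)]
    have hh := hcov.holds s' (by rw [hF.real (by simp), ha])
    rw [hJ, hF.word vX (by simp), hF.word vI (by simp), hi, hx] at hh
    intro j
    by_cases hC : s.word vCV k = 0 ∧ Cv i x k
    · simp [hJ, hh, h0, hC, e1, hI]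
      by_cases hj : j = k
      · subst hj; simp [hC]
      · have : j ≤ k ↔ j < k := by omega
        simp [hj, this]
    · have hC' : ¬ ((s.word vCV k = 0 % W) ∧ Cv i x k) := by simpa using hC
      simp only [Prog.eff, BExpr.Holds, WExpr.eval, eval_rd, hJ, hh, h0]
      rw [if_neg hC']
      simp only [word_setWord, Nat.reduceEqDiff, false_and, if_false, hI]
      congr 1
      by_cases hj : j = k
      · subst hj; simp [hC]
      · have : j < k + 1 ↔ j < k := by omega
        simp [this]
  · simp only [cost_rd]; omega
  · rintro s' - ⟨h, -⟩
    ext j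
    simp only [mem_uncovered, Finset.mem_filter, h]
    by_cases hj : j < n <;> by_cases h0 : s.word vCV j = 0 <;> by_cases hC : Cv i x j <;>
      simp [hj, h0, hC]

open Classical in
/-- The uncovered points that the edge from `i` to `x` takes care of. -/
noncomputable def gain (Cv : ℕ → ℕ → ℕ → Prop) (s : State n) (i x : ℕ) : Finset ℕ :=
  (uncovered s).filter fun j => Cv i x j

theorem gain_congr {s s' : State n} (h : s'.word vCV = s.word vCV) (i x : ℕ) :
    gain Cv s' i x = gain Cv s i x := by
  unfold gain; rw [uncovered_congr h]

open Classical in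
/-- The positions of a list of points where a sample counts. -/
theorem card_hits {s : State n} {S : Finset ℕ} {i x : ℕ} (hS : IsList s S)
    (hsub : uncovered s ⊆ S) (hSn : S ⊆ Finset.range n) :
    ((Finset.range S.card).filter fun v => s.word vCV (s.word vUL v) = 0 ∧
      Cv i x (s.word vUL v)).card = (gain Cv s i x).card := by
  have hinj : Set.InjOn (s.word vUL) (Finset.range S.card) := by
    rw [← Finset.card_image_iff, hS.image, Finset.card_range]
  rw [← Finset.card_image_of_injOn (f := s.word vUL) (hinj.mono (Finset.coe_subset.mpr (Finset.filter_subset _ _)))]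
  congr 1
  ext j
  simp only [Finset.mem_image, Finset.mem_filter, gain, mem_uncovered]
  constructor
  · rintro ⟨v, ⟨hv, h1, h2⟩, rfl⟩
    have : s.word vUL v ∈ S := by
      rw [← hS.image]; exact Finset.mem_image_of_mem _ hv
    exact ⟨⟨Finset.mem_range.mp (hSn this), h1⟩, h2⟩
  · rintro ⟨⟨h1, h2⟩, h3⟩
    have : j ∈ S := hsub (mem_uncovered.mpr ⟨h1, h2⟩)
    rw [← hS.image] at this
    obtain ⟨v, hv, rfl⟩ := Finset.mem_image.mp this
    exact ⟨v, ⟨hv, h2, h3⟩, rfl⟩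

open Classical in
-- One step of a supermartingale: `A` is the set of list positions that are hits, and `havg` says
-- that `ψ` after a uniform draw is at most `ε` on average.
theorem run_sampleOne {s : State n} {b u i x t : ℕ} {ψ : ℕ → ℝ} {Φ : ℕ → State n → ℝ≥0∞} {ε : ℝ}
    (hcov : CoverTest W d a cov Cv) (hW : 1 < W) (ha : s.real 0 0 = a) (hi : s.word vI 0 = i)
    (hx : s.word vX 0 = x) (hu : s.word vU 0 = u) (hu0 : 0 < u) (hHW : s.word vH 0 + 1 < W)
    (hψ : ∀ h, 0 ≤ ψ h) (A : Finset ℕ)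
    (hA : A = (Finset.range u).filter fun v => s.word vCV (s.word vUL v) = 0 ∧
      Cv i x (s.word vUL v))
    (havg : A.card * ψ (s.word vH 0 + 1) + (u - A.card) * ψ (s.word vH 0) ≤ u * ε)
    (hb : 70 ≤ b)
    (hΦ : ∀ (b' : ℕ) (s' : State n), b ≤ b' + 70 → (∃ v < u, s'.word vH 0 = s.word vH 0 + if v ∈ A then 1 else 0) →
      Φ b' (s'.setWord vT 0 (t + 1)) ≤ ENNReal.ofReal (ψ (s'.word vH 0))) :
    Run W d (sampleOne cov) s b (fun b' s' => Φ b' (s'.setWord vT 0 (t + 1)))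
      (ENNReal.ofReal ε) := by
  have hc := hcov.cost
  have e1 : 1 % W = 1 := Nat.mod_eq_of_lt hW
  unfold sampleOne
  refine run_seq (Ψ := fun b' s' => failure (b ≤ b' + 5 ∧ ∃ v < u, s' = s.setWord vV 0 v) +
    ENNReal.ofReal (ψ (s.word vH 0 + if s'.word vV 0 ∈ A then 1 else 0))) (by omega) ?_ ?_
  · refine (run_rand (by simp; omega)).mono (fun _ _ _ => min_le_right _ _) ?_
    simp only [eval_rd, hu, WExpr.cost, cost_rd, WExpr.eval, Nat.zero_mod, max_eq_right (Nat.one_le_iff_ne_zero.mpr hu0.ne')]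
    have : ∀ v ∈ Finset.range u, (failure (b ≤ b - 1 - (1 + 1 + 2) + 5 ∧
        ∃ v' < u, s.setWord vV 0 v = s.setWord vV 0 v') +
        ENNReal.ofReal (ψ (s.word vH 0 + if (s.setWord vV 0 v).word vV 0 ∈ A then 1 else 0))) =
        ENNReal.ofReal (if v ∈ A then ψ (s.word vH 0 + 1) else ψ (s.word vH 0)) := by
      intro v hv
      rw [failure_true ⟨by omega, v, Finset.mem_range.mp hv, rfl⟩, zero_add]
      congr 1
      simp only [word_setWord, and_self, if_true]
      split_ifs <;> rfl
    refine le_trans (ENNReal.div_le_div_right (Finset.sum_congr rfl this).le _) ?_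
    rw [← ENNReal.ofReal_sum_of_nonneg
      (fun v _ => by split_ifs <;> exact hψ _), ← ENNReal.ofReal_natCast u,
      ← ENNReal.ofReal_div_of_pos (by exact_mod_cast hu0)]
    refine ENNReal.ofReal_le_ofReal ?_
    have hAu : A ⊆ Finset.range u := by rw [hA]; exact Finset.filter_subset _ _
    have hsum : ∑ v ∈ Finset.range u, (if v ∈ A then ψ (s.word vH 0 + 1) else ψ (s.word vH 0)) =
        A.card * ψ (s.word vH 0 + 1) + (u - A.card) * ψ (s.word vH 0) := by
      rw [Finset.sum_ite, Finset.sum_const, Finset.sum_const, Finset.filter_mem_eq_inter,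
        Finset.inter_eq_right.mpr hAu, Finset.filter_notMem_eq_sdiff,
        Finset.card_sdiff_of_subset hAu, Finset.card_range, nsmul_eq_mul, nsmul_eq_mul,
        Nat.cast_sub (by simpa using Finset.card_le_card hAu)]
    rw [hsum, div_le_iff₀ (by exact_mod_cast hu0)]
    linarith
  · intro b' s1 _ hlt
    obtain ⟨h1, v, hv, rfl⟩ := of_failure_lt_one (lt_of_le_of_lt le_self_add hlt)
    rw [failure_true ⟨h1, v, hv, rfl⟩, zero_add]
    have hh := hcov.holds ((s.setWord vV 0 v).setWord vJ 0 (s.word vUL v)) (by simpa using ha)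
    simp only [word_setWord, Nat.reduceEqDiff, false_and, if_false, and_self, if_true, hi, hx] at hh
    have hmem : v ∈ A ↔ s.word vCV (s.word vUL v) = 0 ∧ Cv i x (s.word vUL v) := by
      rw [hA, Finset.mem_filter, Finset.mem_range]
      exact and_iff_right hv
    have hspec : Spec W d (.seq (asg vJ (.read vUL (rd vV))) <|
        .ite (.conj (.weq (.read vCV (rd vJ)) (.lit 0)) cov)
          (asg vH (.add (rd vH) (.lit 1))) .skip) (s.setWord vV 0 v) 60
        (fun s' => s'.word vH 0 = s.word vH 0 + if v ∈ A then 1 else 0) 0 := by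
      refine Spec.of_eff (by simp) (by simp; omega) ?_
      simp only [Prog.eff, eff_asg, WExpr.eval, BExpr.Holds, eval_rd, word_setWord]
      simp only [Nat.reduceEqDiff, false_and, if_false, and_self, if_true, hh, Nat.zero_mod, hmem,
        e1]
      by_cases hC : s.word vCV (s.word vUL v) = 0 ∧ Cv i x (s.word vUL v)
      · rw [if_pos hC, if_pos hC]
        simp [Nat.mod_eq_of_lt hHW]
      · rw [if_neg hC, if_neg hC]
        simp
    have := hspec.run (b := b') (Φ := fun b' s' => Φ b' (s'.setWord vT 0 (t + 1)))
      (ε := ENNReal.ofReal (ψ (s.word vH 0 + if v ∈ A then 1 else 0))) (by omega) ?_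
    · simpa using this
    · intro b'' s' h3 h4 _
      rw [← h4]
      exact hΦ b'' s' (by omega) ⟨v, hv, h4⟩

open Classical in
-- `ψ t h` is a potential after `t` samples with `h` hits. As it does not increase on average, its
-- expected final value is at most `ψ 0 0`; exponential choices of `ψ` yield Chernoff bounds.
theorem run_sampleHits {s : State n} {b u i x m g N : ℕ} {ψ : ℕ → ℕ → ℝ}
    (hcov : CoverTest W d a cov Cv) (ha : s.real 0 0 = a) (hi : s.word vI 0 = i)
    (hx : s.word vX 0 = x) (hu : s.word vU 0 = u) (hu0 : 0 < u) (hm : s.word vM 0 = m)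
    (hg : s.word vG 0 = g) (hN : N = 4 * m * g) (hg0 : 0 < g) (hNW : N + 4 < W)
    (hψ : ∀ t h, 0 ≤ ψ t h) (A : Finset ℕ)
    (hA : A = (Finset.range u).filter fun v => s.word vCV (s.word vUL v) = 0 ∧
      Cv i x (s.word vUL v))
    (havg : ∀ t < N, ∀ h, A.card * ψ (t + 1) (h + 1) + (u - A.card) * ψ (t + 1) h ≤ u * ψ t h)
    (hb : N * 100 + 50 ≤ b) :
    Run W d (sampleHits cov) s b (fun b' s' => failure (b ≤ b' + (N * 100 + 50)) +
      ENNReal.ofReal (ψ N (s'.word vH 0))) (ENNReal.ofReal (ψ 0 0)) := by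
  unfold sampleHits
  have hcost : sampleSize.cost = 7 := rfl
  have e4 : 4 % W = 4 := Nat.mod_eq_of_lt (by omega)
  have em : 4 * m % W = 4 * m := Nat.mod_eq_of_lt (by
    have : 4 * m ≤ N := by rw [hN]; exact Nat.le_mul_of_pos_right _ hg0
    omega)
  refine run_seq (Ψ := fun b' s' => failure (b ≤ b' + 5 ∧ s' = s.setWord vH 0 0) +
    ENNReal.ofReal (ψ 0 0)) (by omega) ?_ ?_
  · refine (run_wset (by simp; omega)).mono (fun _ _ _ => min_le_right _ _) ?_
    rw [failure_true ⟨by simp; omega, by simp⟩, zero_add]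
  · intro b1 s1 _ hlt
    obtain ⟨hb1, hs1⟩ := of_failure_lt_one (lt_of_le_of_lt le_self_add hlt)
    rw [failure_true ⟨hb1, hs1⟩, zero_add]
    have hs1' : ∀ c, c ≠ vH → s1.word c = s.word c := by
      intro c hc
      funext k
      simp [hs1, hc]
    refine (run_forLoop (x := vT) (e := sampleSize) (body := sampleOne cov) (s := s1) (B := b1)
      (N := N) (fun k b' s' => failure (b1 ≤ b' + 4 + k * 88 ∧ s'.word vH 0 ≤ k) +
        ENNReal.ofReal (ψ k (s'.word vH 0))) ?_ (by omega) (by simp) ?_ ?_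
        (by omega)).mono (fun _ _ _ => min_le_right _ _) ?_
    · intro s' hF
      have f1 : s'.word vM 0 = m := by rw [hF.word _ (by simp), hs1' _ (by decide), hm]
      have f2 : s'.word vG 0 = g := by rw [hF.word _ (by simp), hs1' _ (by decide), hg]
      simp only [sampleSize, WExpr.eval, eval_rd, f1, f2, e4, em, ← hN]
      exact Nat.mod_eq_of_lt (by omega)
    · intro k b' s' hk hF hT hlt
      obtain ⟨h1, h2⟩ := of_failure_lt_one (lt_of_le_of_lt le_self_add hlt)
      rw [hcost]
      refine ⟨by omega, ?_⟩
      rw [failure_true ⟨h1, h2⟩, zero_add]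
      have fw : ∀ c, c ≠ vH → c ≠ vT → c ≠ vV → c ≠ vJ → s'.word c = s.word c := by
        intro c h1 h2 h3 h4
        rw [hF.word _ (by simp [h1, h2, h3, h4]), hs1' _ h1]
      refine run_sampleOne (b := b' - (7 + 11)) (t := k) (ψ := ψ (k + 1)) (Φ := fun b'' s'' =>
        failure (b1 ≤ b'' + 4 + (k + 1) * 88 ∧ s''.word vH 0 ≤ k + 1) +
          ENNReal.ofReal (ψ (k + 1) (s''.word vH 0))) hcov (by omega) ?_ rfl rfl (by
        rw [fw vU (by decide) (by decide) (by decide) (by decide), hu]) hu0 (by omega) (hψ _) A ?_ ?_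
        (by omega) ?_
      · rw [hF.real (by simp), hs1, real_setWord, ha]
      · rw [hA, fw vCV (by decide) (by decide) (by decide) (by decide),
          fw vUL (by decide) (by decide) (by decide) (by decide),
          fw vI (by decide) (by decide) (by decide) (by decide),
          fw vX (by decide) (by decide) (by decide) (by decide), hi, hx]
      · exact havg k hk _
      · rintro b'' s'' h3 ⟨v, -, h4⟩
        rw [failure_true, zero_add]
        · simp
        · simp only [word_setWord, Nat.reduceEqDiff, false_and, if_false, h4]
          refine ⟨by omega, ?_⟩
          split_ifs <;> omega
    · intro b' s' hF hT hlt
      obtain ⟨h1, h2⟩ := of_failure_lt_one (lt_of_le_of_lt le_self_add hlt)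
      rw [hcost]
      refine ⟨by omega, ?_⟩
      rw [failure_true (And.intro h1 h2), zero_add, failure_true (by omega), zero_add]
    · rw [failure_true ⟨by omega, by simp [hs1]⟩, zero_add]
      simp [hs1]

end Sampling

/-! ## One pass of threshold greedy with sampling -/

/-- `(1 + q) ^ (4 g) ≤ exp (4 g q) ≤ exp (1/2) ≤ 2`; needed for the upper tail. -/
theorem pow_one_add_le_two_pow {q : ℝ} {g : ℕ} (m : ℕ) (hq0 : 0 ≤ q) (hq : 8 * q * g ≤ 1) :
    (1 + q) ^ (4 * m * g) ≤ 2 ^ m := by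
  have h1 : (1 + q) ^ (4 * g) ≤ 2 := by
    have h2 : 1 + q ≤ Real.exp q := by linarith [Real.add_one_le_exp q]
    calc (1 + q) ^ (4 * g) ≤ Real.exp q ^ (4 * g) := pow_le_pow_left₀ (by linarith) h2 _
      _ = Real.exp ((4 * g : ℕ) * q) := by rw [Real.exp_nat_mul]
      _ ≤ Real.exp (1 / 2) := by
          apply Real.exp_le_exp.mpr
          push_cast
          linarith
      _ ≤ 2 := by
          have h3 : Real.exp (1 / 2) * Real.exp (1 / 2) = Real.exp 1 := by
            rw [← Real.exp_add]; norm_num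
          have h4 := Real.exp_one_lt_d9
          by_contra h
          nlinarith
  calc (1 + q) ^ (4 * m * g) = ((1 + q) ^ (4 * g)) ^ m := by rw [← pow_mul]; congr 1; ring
    _ ≤ 2 ^ m := pow_le_pow_left₀ (by positivity) h1 _

/-- `(1 - p/2) ^ (4 g) ≤ exp (-2 p g) ≤ exp (-2) ≤ 1/4`; needed for the lower tail. -/
theorem pow_one_sub_le {p : ℝ} {g : ℕ} (m : ℕ) (hp1 : p ≤ 1) (hp : 1 ≤ p * g) :
    (1 - p / 2) ^ (4 * m * g) ≤ (1 / 4) ^ m := by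
  have h1 : (1 - p / 2) ^ (4 * g) ≤ 1 / 4 := by
    have h2 : 1 - p / 2 ≤ Real.exp (-(p / 2)) := by
      linarith [Real.add_one_le_exp (-(p / 2))]
    calc (1 - p / 2) ^ (4 * g) ≤ Real.exp (-(p / 2)) ^ (4 * g) :=
          pow_le_pow_left₀ (by linarith) h2 _
      _ = Real.exp ((4 * g : ℕ) * (-(p / 2))) := by rw [Real.exp_nat_mul]
      _ ≤ Real.exp (-1 + -1) := by
          apply Real.exp_le_exp.mpr
          push_cast
          linarith
      _ ≤ 1 / 4 := by
          rw [Real.exp_add, Real.exp_neg]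
          have h4 : (2 : ℝ) ≤ Real.exp 1 := by linarith [Real.add_one_le_exp (1 : ℝ)]
          have h5 : (Real.exp 1)⁻¹ ≤ 1 / 2 := by
            rw [inv_le_comm₀ (Real.exp_pos 1) (by norm_num)]; norm_num; exact h4
          have h6 : 0 < (Real.exp 1)⁻¹ := inv_pos.mpr (Real.exp_pos 1)
          nlinarith
  calc (1 - p / 2) ^ (4 * m * g) = ((1 - p / 2) ^ (4 * g)) ^ m := by
        rw [← pow_mul]; congr 1; ring
    _ ≤ (1 / 4) ^ m := pow_le_pow_left₀ (pow_nonneg (by linarith) _) h1 _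

section Pass

variable {n W D : ℕ} {d : Fin n → Fin n → ℝ} {a : ℝ} {cov : BExpr} {Cv : ℕ → ℕ → ℕ → Prop}

theorem ofReal_half_pow (m : ℕ) : ENNReal.ofReal ((1 / 2) ^ m) = (1 / 2) ^ m := by
  rw [ENNReal.ofReal_pow (by norm_num)]
  congr 1
  rw [ENNReal.ofReal_div_of_pos (by norm_num)]
  simp

/-- With `p = |gain| / |S|`, the expected number of hits is `4 m g p`: at least `4 m` if `p ≥ 1 /
g`, at most `m / 6` if `p ≤ 1 / (24 g)`. The cutoff `m` separates these cases except with
probability `2 ^ (-m)`. `S` may be larger than the set of uncovered points because the list is not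
rebuilt during a pass. -/
theorem spec_sampleHits {s : State n} {i x m g : ℕ} {S : Finset ℕ}
    (hcov : CoverTest W d a cov Cv) (ha : s.real 0 0 = a) (hi : s.word vI 0 = i)
    (hx : s.word vX 0 = x) (hm : s.word vM 0 = m) (hg : s.word vG 0 = g) (hg0 : 0 < g)
    (hNW : 4 * m * g + 4 < W) (hS : IsList s S) (hS0 : 0 < S.card)
    (hsub : uncovered s ⊆ S) (hSn : S ⊆ Finset.range n) :
    Spec W d (sampleHits cov) s (4 * m * g * 100 + 50) (fun s' =>
      (m ≤ s'.word vH 0 → S.card ≤ 24 * g * (gain Cv s i x).card) ∧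
      (s'.word vH 0 < m → g * (gain Cv s i x).card ≤ S.card)) ((1 / 2) ^ m) := by
  classical
  intro b hb
  set A := (Finset.range S.card).filter fun v => s.word vCV (s.word vUL v) = 0 ∧
      Cv i x (s.word vUL v) with hA
  have hAc : A.card = (gain Cv s i x).card := card_hits hS hsub hSn
  rw [← hAc]
  set u := S.card with hu
  have hu' : (0 : ℝ) < u := by exact_mod_cast hS0
  have hAu : A.card ≤ u := by simpa using Finset.card_filter_le (Finset.range u) _
  have hAu' : (A.card : ℝ) ≤ u := by exact_mod_cast hAu
  set p : ℝ := A.card / u with hp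
  have hp0 : 0 ≤ p := by positivity
  have hp1 : p ≤ 1 := by rw [hp, div_le_one hu']; exact hAu'
  have hpu : (A.card : ℝ) = p * u := by rw [hp]; field_simp
  set N := 4 * m * g with hN
  -- It suffices to find a potential that is initially at most `2 ^ (-m)` and at least `1` at every
  -- wrong final count.
  have key : ∀ ψ : ℕ → ℕ → ℝ, (∀ t h, 0 ≤ ψ t h) →
      (∀ t < N, ∀ h, A.card * ψ (t + 1) (h + 1) + (u - A.card) * ψ (t + 1) h ≤ u * ψ t h) →
      ψ 0 0 ≤ (1 / 2) ^ m →
      (∀ h, ¬ ((m ≤ h → u ≤ 24 * g * A.card) ∧ (h < m → g * A.card ≤ u)) → 1 ≤ ψ N h) →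
      Run W d (sampleHits cov) s b (fun b' s' => failure (b ≤ b' + (N * 100 + 50) ∧
        (m ≤ s'.word vH 0 → u ≤ 24 * g * A.card) ∧ (s'.word vH 0 < m → g * A.card ≤ u)))
        ((1 / 2) ^ m) := by
    intro ψ h1 h2 h3 h4
    refine (run_sampleHits (ψ := ψ) hcov ha hi hx hS.card hS0 hm hg hN hg0 hNW h1 A hA h2
      hb).mono (fun b' s' _ => (min_le_right _ _).trans ?_) ?_
    · by_cases hgood : (m ≤ s'.word vH 0 → u ≤ 24 * g * A.card) ∧
        (s'.word vH 0 < m → g * A.card ≤ u)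
      · exact (failure_mono fun h => ⟨h, hgood⟩).trans le_self_add
      · refine (failure_le_one _).trans (le_trans ?_ le_add_self)
        rw [ENNReal.one_le_ofReal]
        exact h4 _ hgood
    · rw [← ofReal_half_pow]; exact ENNReal.ofReal_le_ofReal h3
  by_cases hlow : u ≤ 24 * g * A.card
  · by_cases hhigh : g * A.card ≤ u
    · refine key (fun _ _ => 0) (fun _ _ => le_rfl)
        (fun _ _ _ => by simp only [mul_zero, add_zero, le_refl]) (by positivity) ?_
      intro h hbad
      exact absurd ⟨fun _ => hlow, fun _ => hhigh⟩ hbad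
    -- Only too few hits are wrong here. Each sample multiplies the mean of `2 ^ (-h)` by `1 - p /
    -- 2`.
    · refine key (fun t h => (1 - p / 2) ^ (N - t) * (2 ^ m * (1 / 2) ^ h)) ?_ ?_ ?_ ?_
      · intro t h
        have : 0 ≤ 1 - p / 2 := by linarith
        positivity
      · intro t ht h
        refine le_of_eq ?_
        rw [hpu, show N - t = (N - (t + 1)) + 1 by omega, pow_succ, pow_succ]
        ring
      · have hpg : 1 ≤ p * g := by
          have h1 : (u : ℝ) ≤ g * A.card := by exact_mod_cast (not_le.mp hhigh).le
          rw [hpu] at h1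
          by_contra h2
          have : p * g * u < 1 * u := mul_lt_mul_of_pos_right (not_le.mp h2) hu'
          linarith
        have h3 := pow_one_sub_le m hp1 hpg
        simp only [Nat.sub_zero, pow_zero, mul_one]
        calc (1 - p / 2) ^ N * 2 ^ m ≤ (1 / 4) ^ m * 2 ^ m := by gcongr
          _ = (1 / 2) ^ m := by rw [← mul_pow]; norm_num
      · intro h hbad
        have hlt : h < m := by
          by_contra hle
          exact hbad ⟨fun _ => hlow, fun h' => absurd h' hle⟩
        simp only [Nat.sub_self, pow_zero, one_mul]
        rw [show m = h + (m - h) by omega, pow_add, mul_right_comm, ← mul_pow]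
        norm_num
        exact one_le_pow₀ (by norm_num)
  -- Only too many hits are wrong here. Each sample multiplies the mean of `4 ^ h` by `1 + 3 p`.
  · refine key (fun t h => (1 + 3 * p) ^ (N - t) * (4 ^ h * (1 / 4) ^ m)) ?_ ?_ ?_ ?_
    · intro t h
      exact mul_nonneg (pow_nonneg (by linarith) _) (mul_nonneg (pow_nonneg (by norm_num) _)
        (pow_nonneg (by norm_num) _))
    · intro t ht h
      refine le_of_eq ?_
      rw [hpu, show N - t = (N - (t + 1)) + 1 by omega, pow_succ, pow_succ]
      ring
    · have hpg : 8 * (3 * p) * g ≤ 1 := by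
        have h1 : 24 * g * (A.card : ℝ) ≤ u := by exact_mod_cast (not_le.mp hlow).le
        rw [hpu] at h1
        by_contra h2
        have : 1 * (u : ℝ) < 8 * (3 * p) * g * u := mul_lt_mul_of_pos_right (not_le.mp h2) hu'
        linarith
      have h3 := pow_one_add_le_two_pow m (mul_nonneg (by norm_num) hp0) hpg
      simp only [Nat.sub_zero, pow_zero, one_mul]
      calc (1 + 3 * p) ^ N * (1 / 4) ^ m ≤ 2 ^ m * (1 / 4) ^ m := by gcongr
        _ = (1 / 2) ^ m := by rw [← mul_pow]; norm_num
    · intro h hbad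
      have hle : m ≤ h := by
        by_contra hlt
        refine hbad ⟨fun h' => absurd h' hlt, fun _ => ?_⟩
        have h1 : 24 * g * A.card < u := not_le.mp hlow
        have h2 : 24 * g * A.card = 24 * (g * A.card) := by ring
        omega
      simp only [Nat.sub_self, pow_zero, one_mul]
      rw [show h = m + (h - m) by omega, pow_add, mul_right_comm, ← mul_pow]
      norm_num
      exact one_le_pow₀ (by norm_num)

/-- The edge from `i` to `x` has been output. -/
def HasEdge (s : State n) (i x : ℕ) : Prop :=
  ∃ (hi : i < n) (hx : x < n), ((⟨i, hi⟩, ⟨x, hx⟩) : Fin n × Fin n) ∈ s.out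

theorem HasEdge.mono {s s' : State n} {i x : ℕ} (h : HasEdge s i x) (hs : s.out ⊆ s'.out) :
    HasEdge s' i x := by
  obtain ⟨hi, hx, h⟩ := h
  exact ⟨hi, hx, hs h⟩

theorem hasEdge_addEdge {s : State n} {i x : ℕ} (hi : i < n) (hx : x < n) :
    HasEdge (s.addEdge i x) i x := by
  refine ⟨hi, hx, ?_⟩
  simp [State.addEdge, hi, hx]

theorem card_out_addEdge (s : State n) (i x : ℕ) :
    (s.addEdge i x).out.card ≤ s.out.card + 1 := by
  unfold State.addEdge
  split_ifs
  · exact Finset.card_insert_le _ _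
  · omega

/-- An edge taking care of `j` has been output. -/
def Handled (Cv : ℕ → ℕ → ℕ → Prop) (s : State n) (i j : ℕ) : Prop :=
  ∃ x < n, HasEdge s i x ∧ Cv i x j

theorem Handled.mono {s s' : State n} {i j : ℕ} (h : Handled Cv s i j) (hs : s.out ⊆ s'.out) :
    Handled Cv s' i j := by
  obtain ⟨x, hx, h, hC⟩ := h
  exact ⟨x, hx, h.mono hs, hC⟩

/-- Progress made between two states: the set of uncovered points has shrunk, and the points that
are no longer uncovered have been taken care of. -/
structure Progress (Cv : ℕ → ℕ → ℕ → Prop) (s s' : State n) (i : ℕ) : Prop where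
  subset : uncovered s' ⊆ uncovered s
  handled : ∀ j ∈ uncovered s, j ∈ uncovered s' ∨ Handled Cv s' i j

theorem Progress.of_word_eq {s s' : State n} {i : ℕ} (h : s'.word vCV = s.word vCV) :
    Progress Cv s s' i := by
  have := uncovered_congr h
  exact ⟨this.le, fun j hj => Or.inl (this ▸ hj)⟩

theorem Progress.trans {s s' s'' : State n} {i : ℕ} (h : Progress Cv s s' i)
    (h' : Progress Cv s' s'' i) (hs : s'.out ⊆ s''.out) : Progress Cv s s'' i := by
  refine ⟨h'.subset.trans h.subset, fun j hj => ?_⟩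
  rcases h.handled j hj with h1 | h1
  · exact h'.handled j h1
  · exact Or.inr (h1.mono hs)

theorem gain_subset {s s' : State n} (h : uncovered s' ⊆ uncovered s) (i x : ℕ) :
    gain Cv s' i x ⊆ gain Cv s i x := by
  classical
  exact Finset.filter_subset_filter _ h

/-- Output the edge from `vI` to `vX` and mark the points it takes care of. -/
def takeEdge (cov : BExpr) : Prog := .seq (.emit (rd vI) (rd vX)) (mark cov)

theorem spec_takeEdge {s : State n} {i x : ℕ} (hs : Params D s) (hnW : n + 1 < W)
    (hcov : CoverTest W d a cov Cv) (ha : s.real 0 0 = a) (hi : s.word vI 0 = i) (hin : i < n)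
    (hx : s.word vX 0 = x) (hxn : x < n) :
    Spec W d (takeEdge cov) s (100 * n + 80) (fun s' => Progress Cv s s' i ∧
      s'.out.card ≤ s.out.card + 1 ∧ gain Cv s' i x = ∅ ∧
      (uncovered s).card = (uncovered s').card + (gain Cv s i x).card) 0 := by
  classical
  unfold takeEdge
  refine Spec.seq (ε1 := 0) (ε2 := 0) (c1 := 10) (c2 := 100 * n + 50)
    (P := fun s' => s' = s.addEdge i x) (Spec.of_eff (by simp) (by simp) (by simp [hi, hx])) ?_
  rintro s1 rfl hF1
  refine (spec_mark (hs.frame hF1 (by simp)) hnW hcov (by rw [real_addEdge, ha])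
    (by rw [word_addEdge, hi]) (by rw [word_addEdge, hx])).weaken le_rfl ?_ le_rfl
  intro s' hF' h
  have hu : uncovered (s.addEdge i x) = uncovered s := uncovered_congr (by rw [word_addEdge])
  rw [hu] at h
  have hout : s'.out = (s.addEdge i x).out := hF'.out (by simp)
  refine ⟨⟨by rw [h]; exact Finset.filter_subset _ _, fun j hj => ?_⟩, ?_, ?_, ?_⟩
  · by_cases hC : Cv i x j
    · exact Or.inr ⟨x, hxn, (hasEdge_addEdge hin hxn).mono hout.ge, hC⟩
    · left; rw [h, Finset.mem_filter]; exact ⟨hj, hC⟩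
  · rw [hout]; exact card_out_addEdge _ _ _
  · unfold gain
    rw [h, Finset.filter_filter]
    refine Finset.filter_false_of_mem fun j _ => ?_
    tauto
  · rw [h]
    unfold gain
    rw [add_comm]
    exact (Finset.card_filter_add_card_filter_not _).symm

/-- Decide by sampling whether to output the edge from `vI` to `vX`. -/
def sampleStep (cov : BExpr) : Prog :=
  .seq (sampleHits cov) (.ite (.neg (.wlt (rd vH) (rd vM))) (takeEdge cov) .skip)

/-- Try all edges from `vI` once. -/
def onePass (cov : BExpr) : Prog :=
  .seq buildList (.ite (.wlt (.lit 0) (rd vU)) (forLoop vX (rd vN) (sampleStep cov)) .skip)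

@[simp] theorem mods_sampleStep (cov : BExpr) :
    (sampleStep cov).mods = [vH, vT, vV, vJ, vH, vT, vJ, vCV, vJ] := rfl
@[simp] theorem keepsReals_sampleStep (cov : BExpr) : (sampleStep cov).keepsReals = true := rfl
@[simp] theorem mods_onePass (cov : BExpr) : (onePass cov).mods =
    [vU, vJ, vUL, vU, vJ, vX, vH, vT, vV, vJ, vH, vT, vJ, vCV, vJ, vX] := rfl
@[simp] theorem keepsReals_onePass (cov : BExpr) : (onePass cov).keepsReals = true := rfl

/-- An edge that is taken gains at least `u / (24 g)` points, so it lowers `⌊24 g |U| / u⌋` by at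
least one. This number starts at `24 g`; it bounds both the edges output and the time for marking. A
candidate rejected early stays within the bound `u / g`, since gains only shrink. -/
theorem spec_onePass {s : State n} {i m g : ℕ} (hs : Params D s) (hnW : n + 1 < W)
    (hcov : CoverTest W d a cov Cv) (ha : s.real 0 0 = a) (hi : s.word vI 0 = i) (hin : i < n)
    (hm : s.word vM 0 = m) (hm0 : 0 < m) (hg : s.word vG 0 = g) (hg0 : 0 < g)
    (hNW : 4 * m * g + 4 < W) :
    Spec W d (onePass cov) s (6000 * (n * (m * g)) + 1000) (fun s' => Progress Cv s s' i ∧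
      s'.out.card ≤ s.out.card + 24 * g ∧
      ∀ x < n, g * (gain Cv s' i x).card ≤ (uncovered s).card) (n * (1 / 2) ^ m) := by
  have hmg : 1 ≤ m * g := Nat.mul_pos hm0 hg0
  have hnmg : n ≤ n * (m * g) := Nat.le_mul_of_pos_right n hmg
  have hngm : n * g ≤ n * (m * g) := Nat.mul_le_mul_left n (Nat.le_mul_of_pos_left g hm0)
  have hggm : g ≤ n * g := Nat.le_mul_of_pos_left g (by omega)
  unfold onePass
  refine Spec.seq (ε1 := 0) (ε2 := n * (1 / 2) ^ m) (c1 := 50 * n + 50)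
    (c2 := 5900 * (n * (m * g)) + 900) (spec_buildList hs hnW) ?_
  intro s1 hS hF1
  have hu1 : uncovered s1 = uncovered s := uncovered_congr (hF1.word _ (by simp))
  have hout1 : s1.out = s.out := hF1.out (by simp)
  have hP1 : Progress Cv s s1 i := Progress.of_word_eq (hF1.word _ (by simp))
  have hs1 : Params D s1 := hs.frame hF1 (by simp)
  have ha1 : s1.real 0 0 = a := by rw [hF1.real (by simp), ha]
  have hi1 : s1.word vI 0 = i := by rw [hF1.word _ (by simp), hi]
  have hm1 : s1.word vM 0 = m := by rw [hF1.word _ (by simp), hm]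
  have hg1 : s1.word vG 0 = g := by rw [hF1.word _ (by simp), hg]
  set u := (uncovered s).card with hu
  refine Spec.ite (c1 := 5800 * (n * (m * g)) + 850) (fun h => ?_) (fun h => ?_)
    (by simp; omega)
  swap
  · simp only [BExpr.Holds, WExpr.eval, Nat.zero_mod, eval_rd, hS.card] at h
    have h0 : uncovered s = ∅ := Finset.card_eq_zero.mp (by omega)
    refine Spec.of_eff (by simp) (by simp) ?_
    refine ⟨hP1, by simp [hout1], fun x _ => ?_⟩
    have : gain Cv s1 i x = ∅ := by
      unfold gain; rw [hu1, h0]; simp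
    simp [this]
  simp only [BExpr.Holds, WExpr.eval, Nat.zero_mod, eval_rd, hS.card] at h
  -- Each unit of the quotient pays for marking after one edge.
  set pot : State n → ℕ := fun s' => (100 * n + 100) * (24 * g * (uncovered s').card / u) with hpot
  have hpot1 : ∀ (s' : State n) v, pot (s'.setWord vX 0 v) = pot s' := by
    intro s' v
    simp only [hpot]
    rw [uncovered_congr (s := s') (by funext k; simp)]
  refine (spec_forLoop_amortized (N := n)
    (fun k s' => Progress Cv s s' i ∧
      s'.out.card + 24 * g * (uncovered s').card / u ≤ s.out.card + 24 * g ∧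
      ∀ x < k, g * (gain Cv s' i x).card ≤ u) (fun _ => 4 * m * g * 100 + 100) pot
    ((1 / 2) ^ m) ?_ (by omega) (by simp) ?_ ?_).weaken ?_ ?_ le_rfl
  · intro s' hF
    simp [hF.word _ (show vN ∉ _ by simp), hs1.n_eq]
  · have hu2 : uncovered (s1.setWord vX 0 0) = uncovered s := by
      rw [← hu1]; exact uncovered_congr (by funext k; simp)
    refine ⟨hP1.trans (Progress.of_word_eq (by funext k; simp)) (by simp), ?_, by simp⟩
    rw [hu2, ← hu, Nat.mul_div_cancel _ h]
    simp [hout1]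
  · rintro k s' b hk hF hx ⟨hI1, hI2, hI3⟩ hb
    have hs' : Params D s' := hs1.frame hF (by simp)
    have ha' : s'.real 0 0 = a := by rw [hF.real (by simp), ha1]
    have hi' : s'.word vI 0 = i := by rw [hF.word _ (by simp), hi1]
    have hm' : s'.word vM 0 = m := by rw [hF.word _ (by simp), hm1]
    have hg' : s'.word vG 0 = g := by rw [hF.word _ (by simp), hg1]
    have hS' : IsList s' (uncovered s) := by
      refine ⟨?_, ?_⟩
      · rw [hF.word _ (by simp), hS.card]
      · rw [hF.word _ (by simp), hS.image]
    have hSn : uncovered s ⊆ Finset.range n := Finset.filter_subset _ _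
    unfold sampleStep
    refine run_seq (Ψ := fun b' s'' => failure (b - 1 ≤ b' + (4 * m * g * 100 + 50) ∧
      Frame (sampleHits cov) s' s'' ∧
      (m ≤ s''.word vH 0 → u ≤ 24 * g * (gain Cv s' i k).card) ∧
      (s''.word vH 0 < m → g * (gain Cv s' i k).card ≤ u))) (by omega) ?_ ?_
    · have := (spec_sampleHits hcov ha' hi' hx hm' hg' hg0 hNW hS' h hI1.subset hSn).run
        (b := b - 1) (ε := 0) (Φ := fun b' s'' => failure (b - 1 ≤ b' + (4 * m * g * 100 + 50) ∧
          Frame (sampleHits cov) s' s'' ∧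
          (m ≤ s''.word vH 0 → u ≤ 24 * g * (gain Cv s' i k).card) ∧
          (s''.word vH 0 < m → g * (gain Cv s' i k).card ≤ u))) (by omega)
          (fun b' s'' h1 h2 h3 => by rw [failure_true ⟨h1, h3, h2⟩])
      rwa [add_zero] at this
    · intro b' s'' _ hlt
      obtain ⟨hb', hF'', h1, h2⟩ := of_failure_lt_one hlt
      rw [failure_true ⟨hb', hF'', h1, h2⟩]
      have hw'' : s''.word vCV = s'.word vCV := hF''.word _ (by simp)
      have hu'' : uncovered s'' = uncovered s' := uncovered_congr hw''
      have hout'' : s''.out = s'.out := hF''.out (by simp)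
      have hP'' : Progress Cv s s'' i := hI1.trans (Progress.of_word_eq hw'') hout''.ge
      refine run_ite (by simp; omega) (fun hH => ?_) (fun hH => ?_)
      · simp only [BExpr.Holds, eval_rd, hF''.word vM (by simp), hm', not_lt] at hH
        have hgk := h1 hH
        -- The candidate's gain shows that `24 g |U| ≥ u`, so the potential still contains the price
        -- of one marking and the budget cannot be too small.
        by_cases hbig : 100 * n + 80 ≤ b' - (1 + (BExpr.neg (.wlt (rd vH) (rd vM))).cost)
        swap
        · exfalso
          have hge : 1 ≤ 24 * g * (uncovered s').card / u := by
            rw [Nat.one_le_div_iff h]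
            refine hgk.trans (Nat.mul_le_mul_left _ (Finset.card_le_card ?_))
            classical exact Finset.filter_subset _ _
          have : (100 * n + 100) * 1 ≤ pot s' := Nat.mul_le_mul_left _ hge
          simp at hbig
          omega
        have := (spec_takeEdge (hs'.frame hF'' (by simp)) hnW hcov
          (by rw [hF''.real (by simp), ha']) (by rw [hF''.word _ (by simp), hi']) hin
          (by rw [hF''.word _ (by simp), hx]) hk).run
          (Φ := fun b' s'' => failure (b + pot (s''.setWord vX 0 (k + 1)) ≤
            b' + (4 * m * g * 100 + 100) + pot s' ∧
            Progress Cv s (s''.setWord vX 0 (k + 1)) i ∧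
            (s''.setWord vX 0 (k + 1)).out.card +
              24 * g * (uncovered (s''.setWord vX 0 (k + 1))).card / u ≤ s.out.card + 24 * g ∧
            ∀ x < k + 1, g * (gain Cv (s''.setWord vX 0 (k + 1)) i x).card ≤ u))
          (ε := 0) hbig ?_
        · rwa [add_zero] at this
        · rintro b3 s3 hb3 ⟨hP3, hout3, hgain3, hcard3⟩ hF3
          have hu4 : uncovered (s3.setWord vX 0 (k + 1)) = uncovered s3 :=
            uncovered_congr (by funext c; simp)
          have hg4 : ∀ x, gain Cv (s3.setWord vX 0 (k + 1)) i x = gain Cv s3 i x :=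
            fun x => gain_congr (by funext c; simp) i x
          rw [hu'', gain_congr hw''] at hcard3
          have hdiv : 24 * g * (uncovered s3).card / u + 1 ≤ 24 * g * (uncovered s').card / u := by
            rw [← Nat.add_div_right _ h]
            refine Nat.div_le_div_right ?_
            rw [hcard3, mul_add]
            omega
          rw [failure_true]
          refine ⟨?_, ?_, ?_, ?_⟩
          · rw [hpot1]
            have : pot s3 + (100 * n + 100) ≤ pot s' := by
              simp only [hpot]
              calc _ = (100 * n + 100) * (24 * g * (uncovered s3).card / u + 1) := by ring
                _ ≤ _ := Nat.mul_le_mul_left _ hdiv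
            simp at hb3
            omega
          · exact (hP''.trans hP3 hF3.out_subset).trans
              (Progress.of_word_eq (by funext c; simp)) (by simp)
          · rw [hu4, out_setWord]
            rw [hout''] at hout3
            omega
          · intro x hx
            rw [hg4]
            rcases (show x < k ∨ x = k by omega) with h' | rfl
            · refine le_trans (Nat.mul_le_mul_left _ (Finset.card_le_card ?_)) (hI3 x h')
              exact gain_subset (by rw [← hu'']; exact hP3.subset) _ _
            · simp [hgain3]
      · simp only [BExpr.Holds, eval_rd, hF''.word vM (by simp), hm', not_lt, not_le] at hH
        refine (run_skip (by simp; omega)).mono (fun _ _ _ => min_le_right _ _) ?_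
        have hu4 : uncovered (s''.setWord vX 0 (k + 1)) = uncovered s' := by
          rw [← hu'']; exact uncovered_congr (by funext c; simp)
        have hg4 : ∀ x, gain Cv (s''.setWord vX 0 (k + 1)) i x = gain Cv s' i x := fun x => by
          rw [← gain_congr hw'']
          exact gain_congr (by funext c; simp) i x
        rw [failure_true]
        refine ⟨?_, ?_, ?_, ?_⟩
        · have : pot (s''.setWord vX 0 (k + 1)) = pot s' := by simp only [hpot, hu4]
          rw [this]
          simp
          omega
        · exact hP''.trans (Progress.of_word_eq (by funext c; simp)) (by simp)
        · rw [hu4, out_setWord, hout'']; exact hI2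
        · intro x hx
          rw [hg4]
          rcases (show x < k ∨ x = k by omega) with h' | rfl
          · exact hI3 x h'
          · exact h2 (by omega)
  · have hp0 : pot (s1.setWord vX 0 0) = (100 * n + 100) * (24 * g) := by
      rw [hpot1]
      simp only [hpot]
      rw [hu1, ← hu, Nat.mul_div_cancel _ h]
    rw [hp0]
    simp only [Finset.sum_const, Finset.card_range, smul_eq_mul, cost_rd]
    have e1 : (100 * n + 100) * (24 * g) = 2400 * (n * g) + 2400 * g := by ring
    have e2 : n * (4 * m * g * 100 + 100 + 2 + 11) = 400 * (n * (m * g)) + 113 * n := by ring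
    rw [e1, e2]
    omega
  · rintro s' - ⟨⟨h1, h2, h3⟩, -⟩
    exact ⟨h1, (Nat.le_add_right _ _).trans h2, h3⟩

end Pass

/-! ## Guessing the optimum -/

/-- Repeated passes with the same guess. -/
def passes (cov : BExpr) : Prog := forLoop vR (rd vL) (onePass cov)

/-- If there are uncovered points and the guess is not too large, make passes and double the
guess. -/
def guessStep (cov : BExpr) : Prog :=
  .seq buildList (.ite (.conj (.wlt (.lit 0) (rd vU)) (.neg (.wlt (rd vW) (rd vG))))
    (.seq (passes cov) (asg vG (.mul (rd vG) (.lit 2)))) .skip)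

/-- Passes with the guesses `1, 2, 4, …`. -/
def guesses (cov : BExpr) : Prog :=
  .seq (asg vG (.lit 1)) (forLoop vA (rd vL) (guessStep cov))

@[simp] theorem mods_passes (cov : BExpr) :
    (passes cov).mods = vR :: ((onePass cov).mods ++ [vR]) := rfl
@[simp] theorem mods_guessStep (cov : BExpr) : (guessStep cov).mods =
    [vU, vJ, vUL, vU, vJ] ++ (((passes cov).mods ++ [vG]) ++ []) := rfl
@[simp] theorem keepsReals_guessStep (cov : BExpr) : (guessStep cov).keepsReals = true := rfl
@[simp] theorem mods_guesses (cov : BExpr) : (guesses cov).mods =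
    vG :: (vA :: ((guessStep cov).mods ++ [vA])) := rfl
@[simp] theorem keepsReals_guesses (cov : BExpr) : (guesses cov).keepsReals = true := rfl

section Guesses

variable {n W D : ℕ} {d : Fin n → Fin n → ℝ} {a : ℝ} {cov : BExpr} {Cv : ℕ → ℕ → ℕ → Prop}

/-- Edges from `i` to the points of `F` take care of all points. -/
structure IsCover (n : ℕ) (Cv : ℕ → ℕ → ℕ → Prop) (i : ℕ) (F : Finset ℕ) : Prop where
  lt : ∀ x ∈ F, x < n
  exists_mem : ∀ j < n, j ≠ i → ∃ x ∈ F, Cv i x j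

theorem card_uncovered_le_sum_gain {s : State n} {i : ℕ} {F : Finset ℕ} (hF : IsCover n Cv i F)
    (hi : i ∉ uncovered s) : (uncovered s).card ≤ ∑ x ∈ F, (gain Cv s i x).card := by
  classical
  refine le_trans (Finset.card_le_card ?_) Finset.card_biUnion_le
  intro j hj
  obtain ⟨x, hx, hC⟩ := hF.exists_mem j (mem_uncovered.mp hj).1 (fun h => hi (h ▸ hj))
  exact Finset.mem_biUnion.mpr ⟨x, hx, Finset.mem_filter.mpr ⟨hj, hC⟩⟩

/-- Sum the gains over the cover: `g |U| ≤ ∑ g * gain ≤ |F| u`, and `2 |F| ≤ g`. -/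
theorem two_mul_card_uncovered_le {s : State n} {i g u : ℕ} {F : Finset ℕ}
    (hF : IsCover n Cv i F) (hi : i ∉ uncovered s) (hg0 : 0 < g) (hg : 2 * F.card ≤ g)
    (h : ∀ x < n, g * (gain Cv s i x).card ≤ u) : 2 * (uncovered s).card ≤ u := by
  have h1 : g * (uncovered s).card ≤ F.card * u := by
    calc g * (uncovered s).card ≤ g * ∑ x ∈ F, (gain Cv s i x).card :=
          Nat.mul_le_mul_left _ (card_uncovered_le_sum_gain hF hi)
      _ = ∑ x ∈ F, g * (gain Cv s i x).card := Finset.mul_sum _ _ _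
      _ ≤ ∑ _x ∈ F, u := Finset.sum_le_sum fun x hx => h x (hF.lt x hx)
      _ = F.card * u := by simp
  have h2 : 2 * F.card * u ≤ g * u := Nat.mul_le_mul_right u hg
  refine le_of_mul_le_mul_left (a := g) ?_ hg0
  calc g * (2 * (uncovered s).card) = 2 * (g * (uncovered s).card) := by ring
    _ ≤ 2 * (F.card * u) := Nat.mul_le_mul_left _ h1
    _ = 2 * F.card * u := by ring
    _ ≤ g * u := h2

theorem one_le_size (hn : 2 ≤ n) : 1 ≤ Nat.size n := Nat.size_pos.mpr (by omega)

/-- Time and output are bounded for every guess; only the halving of the uncovered set needs `2 |F|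
≤ g`. After `Nat.size n` halvings of at most `n < 2 ^ Nat.size n` points nothing is left. -/
theorem spec_passes {s : State n} {i m g : ℕ} {F : Finset ℕ} (hn : 2 ≤ n) (hs : Params D s)
    (hnW : n + 1 < W) (hcov : CoverTest W d a cov Cv) (ha : s.real 0 0 = a)
    (hi : s.word vI 0 = i) (hin : i < n) (hm : m = D * Nat.size n) (hm0 : 0 < m)
    (hg : s.word vG 0 = g) (hg0 : 0 < g) (hNW : 4 * m * g + 4 < W)
    (hF : IsCover n Cv i F) (hiu : i ∉ uncovered s) :
    Spec W d (passes cov) s (8000 * (Nat.size n * (n * m)) * g) (fun s' => Progress Cv s s' i ∧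
      s'.out.card ≤ s.out.card + 24 * Nat.size n * g ∧
      (2 * F.card ≤ g → uncovered s' = ∅)) (Nat.size n * (n * (1 / 2) ^ m)) := by
  have hL := one_le_size hn
  have hLn := size_le_self n
  have hmg : 1 ≤ m * g := Nat.mul_pos hm0 hg0
  have hX : n ≤ n * (m * g) := Nat.le_mul_of_pos_right n hmg
  unfold passes
  refine (spec_forLoop (N := Nat.size n) (C := 8000 * (Nat.size n * (n * m)) * g)
    (fun k s' => Progress Cv s s' i ∧ s'.out.card ≤ s.out.card + 24 * g * k ∧
      (2 * F.card ≤ g → 2 ^ k * (uncovered s').card ≤ n)) (6000 * (n * (m * g)) + 1000)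
    (n * (1 / 2) ^ m) ?_ (by omega) (by simp) ?_ ?_ ?_ le_rfl).weaken le_rfl ?_ le_rfl
  · intro s' hF'
    simp [hF'.word _ (show vL ∉ _ by simp), hs.L_eq]
  · have hu : uncovered (s.setWord vR 0 0) = uncovered s := uncovered_congr (by funext c; simp)
    refine ⟨Progress.of_word_eq (by funext c; simp), by simp, fun _ => ?_⟩
    rw [hu, pow_zero, one_mul]
    exact card_uncovered_le s
  · rintro k s' hk hF' - ⟨h1, h2, h3⟩
    refine (spec_onePass (m := m) (g := g) (hs.frame hF' (by simp)) hnW hcov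
      (by rw [hF'.real (by simp), ha]) (by rw [hF'.word _ (by simp), hi]) hin
      (by rw [hF'.word _ (by simp), hs.M_eq, hm]) hm0 (by rw [hF'.word _ (by simp), hg]) hg0
      hNW).weaken le_rfl ?_ le_rfl
    rintro s'' hF'' ⟨h4, h5, h6⟩
    have hu : uncovered (s''.setWord vR 0 (k + 1)) = uncovered s'' :=
      uncovered_congr (by funext c; simp)
    refine ⟨(h1.trans h4 hF''.out_subset).trans (Progress.of_word_eq (by funext c; simp)) (by simp),
      ?_, fun hle => ?_⟩
    · rw [out_setWord, mul_add]; omega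
    · rw [hu]
      have h7 := two_mul_card_uncovered_le hF (fun h => hiu (h1.subset (h4.subset h))) hg0 hle h6
      calc 2 ^ (k + 1) * (uncovered s'').card = 2 ^ k * (2 * (uncovered s'').card) := by ring
        _ ≤ 2 ^ k * (uncovered s').card := Nat.mul_le_mul_left _ h7
        _ ≤ n := h3 hle
  · simp only [cost_rd]
    have e1 : 8000 * (Nat.size n * (n * m)) * g = Nat.size n * (8000 * (n * (m * g))) := by ring
    rw [e1]
    calc Nat.size n * (6000 * (n * (m * g)) + 1000 + 2 + 11) + 2 + 8
        ≤ Nat.size n * (6000 * (n * (m * g)) + 1000 + 2 + 11) + Nat.size n * 10 := by omega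
      _ = Nat.size n * (6000 * (n * (m * g)) + 1023) := by ring
      _ ≤ _ := Nat.mul_le_mul_left _ (by omega)
  · rintro s' - ⟨⟨h1, h2, h3⟩, -⟩
    refine ⟨h1, by rw [mul_right_comm]; exact h2, fun hle => ?_⟩
    have h4 := h3 hle
    rw [← Finset.card_eq_zero]
    by_contra h0
    have h5 : 2 ^ Nat.size n * 1 ≤ 2 ^ Nat.size n * (uncovered s').card :=
      Nat.mul_le_mul_left _ (Nat.one_le_iff_ne_zero.mpr h0)
    have := Nat.lt_size_self n
    omega

/-- A guess is used only while points are uncovered and it is at most `w`. A guess of at least `2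
|F|` leaves no point uncovered, so every guess used is below `4 |F|` and the final value is at most
`8 |F|` and at most `2 w`. The guesses used sum up to the final value minus one. -/
theorem spec_guesses {s : State n} {i m : ℕ} {F : Finset ℕ} (hn : 2 ≤ n) (hs : Params D s)
    (hW : (n + 1) * (n + 1) ≤ W) (hcov : CoverTest W d a cov Cv) (ha : s.real 0 0 = a)
    (hi : s.word vI 0 = i) (hin : i < n) (hm : m = D * Nat.size n) (hm0 : 0 < m)
    (hNW : 4 * m * n + 4 < W) (hF : IsCover n Cv i F) (hF0 : 0 < F.card)
    (hiu : i ∉ uncovered s) :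
    Spec W d (guesses cov) s (70000 * (Nat.size n * (n * m)) * min F.card (sqrtCeil n))
      (fun s' => Progress Cv s s' i ∧ s'.out.card ≤ s.out.card + 192 * Nat.size n * F.card ∧
        (uncovered s' ≠ ∅ → sqrtCeil n < 4 * F.card))
      (Nat.size n * (Nat.size n * (n * (1 / 2) ^ m))) := by
  have hL := one_le_size hn
  have hLn := size_le_self n
  have hwn := sqrtCeil_le n
  have hw0 := sqrtCeil_pos (n := n) (by omega)
  have hnn : 2 * n ≤ n * n := Nat.mul_le_mul_right n hn
  have hnW : n * n + 2 * n + 1 ≤ W := by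
    have : (n + 1) * (n + 1) = n * n + 2 * n + 1 := by ring
    omega
  have e1 : 1 % W = 1 := Nat.mod_eq_of_lt (by omega)
  have e2 : 2 % W = 2 := Nat.mod_eq_of_lt (by omega)
  set L := Nat.size n with hLdef
  set w := sqrtCeil n with hwdef
  set M := min F.card w with hM
  have hM0 : 1 ≤ M := le_min hF0 hw0
  set A := 8000 * (L * (n * m)) with hA
  have hLn1 : 1 ≤ L * (n * m) := Nat.mul_pos hL (Nat.mul_pos (by omega) hm0)
  have hLnm : L * n ≤ L * (n * m) := Nat.mul_le_mul_left L (Nat.le_mul_of_pos_right n hm0)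
  have hLnm' : L ≤ L * n := Nat.le_mul_of_pos_right L (by omega)
  have hAM : L * (n * m) ≤ L * (n * m) * M := Nat.le_mul_of_pos_right _ hM0
  unfold guesses
  refine Spec.seq (ε1 := 0) (ε2 := L * (L * (n * (1 / 2) ^ m))) (c1 := 10)
    (c2 := 64000 * (L * (n * m) * M) + 500 * (L * n) + 500 * L + 40)
    (P := fun s' => s' = s.setWord vG 0 1)
    (Spec.of_eff (by simp) (by simp) (by simp [e1])) ?_ (by
      have : 70000 * (L * (n * m)) * M = 70000 * (L * (n * m) * M) := by ring
      omega)
  rintro s1 rfl hF1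
  set s1 := s.setWord vG 0 1 with hs1def
  have hs1 : Params D s1 := hs.frame hF1 (by simp)
  have hu1 : uncovered s1 = uncovered s := uncovered_congr (hF1.word _ (by simp))
  -- Passes with guess `g` cost `A * g` and `g` becomes `2 g`: exactly the drop of this potential,
  -- since `2 g ≤ 8 M` keeps the truncated subtraction exact.
  set pot : State n → ℕ := fun s' => A * (8 * M - s'.word vG 0) with hpot
  have hpot1 : ∀ (s' : State n) v, pot (s'.setWord vA 0 v) = pot s' := by
    intro s' v; simp [hpot]
  -- The clause on the output says that at most `24 L (g - 1)` edges were added, with the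
  -- subtraction moved to the other side. The last clause: the work is done, or the guesses are
  -- exhausted, or none was skipped.
  refine (spec_forLoop_amortized (N := L)
    (fun k s' => Progress Cv s s' i ∧ 1 ≤ s'.word vG 0 ∧ s'.word vG 0 ≤ 2 * w ∧
      s'.word vG 0 ≤ 8 * F.card ∧ (uncovered s' ≠ ∅ → s'.word vG 0 < 4 * F.card) ∧
      s'.out.card + 24 * L ≤ s.out.card + 24 * L * s'.word vG 0 ∧
      (uncovered s' = ∅ ∨ w < s'.word vG 0 ∨ s'.word vG 0 = 2 ^ k)) (fun _ => 50 * n + 200) pot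
    (L * (n * (1 / 2) ^ m)) ?_ (by omega) (by simp) ?_ ?_).weaken ?_ ?_ le_rfl
  · intro s' hF'
    simp [hF'.word _ (show vL ∉ _ by simp), hs1.L_eq, hLdef]
  · refine ⟨Progress.of_word_eq (by funext c; simp [hs1def]), ?_⟩
    simp only [hs1def, word_setWord, out_setWord]
    simp
    omega
  · rintro k s' b hk hF' - ⟨h1, h2, h3, h4, h5, h6, h7⟩ hb
    set g := s'.word vG 0 with hg
    have hs' : Params D s' := hs1.frame hF' (by simp)
    have ha' : s'.real 0 0 = a := by rw [hF'.real (by simp), hF1.real (by simp), ha]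
    have hi' : s'.word vI 0 = i := by rw [hF'.word _ (by simp), hF1.word _ (by simp), hi]
    by_cases hguard : uncovered s' ≠ ∅ ∧ g ≤ w
    · have hg4 := h5 hguard.1
      have hspec : Spec W d (guessStep cov) s' (50 * n + 200 + A * g) (fun s'' =>
          Progress Cv s' s'' i ∧ s''.out.card ≤ s'.out.card + 24 * L * g ∧
          (2 * F.card ≤ g → uncovered s'' = ∅) ∧ s''.word vG 0 = 2 * g)
          (L * (n * (1 / 2) ^ m)) := by
        unfold guessStep
        refine Spec.seq (ε1 := 0) (ε2 := L * (n * (1 / 2) ^ m)) (c2 := A * g + 100)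
          (spec_buildList hs' (by omega)) ?_
        intro s2 hS2 hF2
        have hs2 : Params D s2 := hs'.frame hF2 (by simp)
        have hg2 : s2.word vG 0 = g := by rw [hF2.word _ (by simp)]
        have hu2 : uncovered s2 = uncovered s' := uncovered_congr (hF2.word _ (by simp))
        have hout2 : s2.out = s'.out := hF2.out (by simp)
        refine Spec.ite (c1 := A * g + 50) (fun _ => ?_) (fun h => ?_) (by simp; omega)
        swap
        · exfalso
          apply h
          simp only [BExpr.Holds, WExpr.eval, Nat.zero_mod, eval_rd, hS2.card, hg2, hs2.W_eq]
          exact ⟨Finset.card_pos.mpr (Finset.nonempty_iff_ne_empty.mpr hguard.1), by omega⟩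
        · refine Spec.seq (ε1 := L * (n * (1 / 2) ^ m)) (ε2 := 0) (c1 := A * g) (c2 := 20)
            (spec_passes (F := F) hn hs2 (by omega) hcov (by rw [hF2.real (by simp), ha'])
              (by rw [hF2.word _ (by simp), hi']) hin hm hm0 hg2 h2 ?_ hF ?_) ?_
          · exact lt_of_le_of_lt (Nat.add_le_add_right
              (Nat.mul_le_mul_left _ (hguard.2.trans hwn)) 4) hNW
          · rw [hu2]; exact fun h => hiu (h1.subset h)
          · rintro s3 ⟨h8, h9, h10⟩ hF3
            have hg3 : s3.word vG 0 = g := by rw [hF3.word _ (by simp), hg2]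
            refine Spec.of_eff (by simp) (by simp) ?_
            have e3 : g * 2 % W = 2 * g := by
              rw [mul_comm]; exact Nat.mod_eq_of_lt (by omega)
            have hP4 : Progress Cv s' s3 i := (Progress.of_word_eq
              (hF2.word _ (by simp))).trans h8 hF3.out_subset
            have hu4 : ∀ v, uncovered (s3.setWord vG 0 v) = uncovered s3 := fun v =>
              uncovered_congr (by funext c; simp)
            simp only [eff_asg, WExpr.eval, eval_rd, hg3, e2, e3]
            refine ⟨hP4.trans (Progress.of_word_eq (by funext c; simp)) (by simp), ?_, ?_, by simp⟩
            · rw [out_setWord, ← hout2]; exact h9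
            · rw [hu4]; exact h10
      have hg2w : 2 * g ≤ 8 * M := by
        rw [hM]
        have : 2 * g ≤ 8 * F.card := by omega
        have : 2 * g ≤ 8 * w := by omega
        omega
      have hpay : ∀ s'' : State n, s''.word vG 0 = 2 * g → pot s'' + A * g = pot s' := by
        intro s'' h
        simp only [hpot, h, ← hg]
        rw [← mul_add]
        congr 1
        omega
      have hpg : A * g ≤ pot s' := by
        have := hpay (s'.setWord vG 0 (2 * g)) (by simp)
        omega
      have := hspec.run (b := b) (ε := 0) (Φ := fun b' s'' => failure
        (b + pot (s''.setWord vA 0 (k + 1)) ≤ b' + (50 * n + 200) + pot s' ∧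
          Progress Cv s (s''.setWord vA 0 (k + 1)) i ∧
          1 ≤ (s''.setWord vA 0 (k + 1)).word vG 0 ∧ (s''.setWord vA 0 (k + 1)).word vG 0 ≤ 2 * w ∧
          (s''.setWord vA 0 (k + 1)).word vG 0 ≤ 8 * F.card ∧
          (uncovered (s''.setWord vA 0 (k + 1)) ≠ ∅ →
            (s''.setWord vA 0 (k + 1)).word vG 0 < 4 * F.card) ∧
          (s''.setWord vA 0 (k + 1)).out.card + 24 * L ≤
            s.out.card + 24 * L * (s''.setWord vA 0 (k + 1)).word vG 0 ∧
          (uncovered (s''.setWord vA 0 (k + 1)) = ∅ ∨ w < (s''.setWord vA 0 (k + 1)).word vG 0 ∨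
            (s''.setWord vA 0 (k + 1)).word vG 0 = 2 ^ (k + 1)))) (by omega) ?_
      · rwa [add_zero] at this
      · rintro b' s'' h8 ⟨h9, h10, h11, h12⟩ hF''
        have hu4 : uncovered (s''.setWord vA 0 (k + 1)) = uncovered s'' :=
          uncovered_congr (by funext c; simp)
        have hg5 : (s''.setWord vA 0 (k + 1)).word vG 0 = 2 * g := by simp [h12]
        rw [failure_true]
        rw [hpot1, hu4, hg5, out_setWord]
        refine ⟨?_, ?_, by omega, by omega, by omega, ?_, ?_, ?_⟩
        · have := hpay s'' h12
          omega
        · exact (h1.trans h9 hF''.out_subset).trans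
            (Progress.of_word_eq (by funext c; simp)) (by simp)
        · intro hne
          by_contra hcon
          exact hne (h11 (by omega))
        · have : 24 * L * (2 * g) = 24 * L * g + 24 * L * g := by ring
          omega
        · rcases h7 with h7 | h7 | h7
          · exact absurd h7 hguard.1
          · omega
          · right; right; rw [h7, pow_succ, mul_comm]
    · have hspec : Spec W d (guessStep cov) s' (50 * n + 200) (fun s'' =>
          s''.word vCV = s'.word vCV ∧ s''.out = s'.out ∧ s''.word vG 0 = g)
          (L * (n * (1 / 2) ^ m)) := by
        unfold guessStep
        refine Spec.seq (ε1 := 0) (ε2 := L * (n * (1 / 2) ^ m)) (c2 := 100)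
          (spec_buildList hs' (by omega)) ?_
        intro s2 hS2 hF2
        have hs2 : Params D s2 := hs'.frame hF2 (by simp)
        have hg2 : s2.word vG 0 = g := by rw [hF2.word _ (by simp)]
        refine Spec.ite (c1 := 50) (fun h => ?_) (fun h => ?_) (by simp)
        · exfalso
          apply hguard
          simp only [BExpr.Holds, WExpr.eval, Nat.zero_mod, eval_rd, hS2.card, hg2, hs2.W_eq] at h
          exact ⟨Finset.nonempty_iff_ne_empty.mp (Finset.card_pos.mp h.1), by omega⟩
        · refine Spec.of_eff (by simp) (by simp) ?_
          exact ⟨hF2.word _ (by simp), hF2.out (by simp), hg2⟩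
      have := hspec.run (b := b) (ε := 0) (Φ := fun b' s'' => failure
        (b + pot (s''.setWord vA 0 (k + 1)) ≤ b' + (50 * n + 200) + pot s' ∧
          Progress Cv s (s''.setWord vA 0 (k + 1)) i ∧
          1 ≤ (s''.setWord vA 0 (k + 1)).word vG 0 ∧ (s''.setWord vA 0 (k + 1)).word vG 0 ≤ 2 * w ∧
          (s''.setWord vA 0 (k + 1)).word vG 0 ≤ 8 * F.card ∧
          (uncovered (s''.setWord vA 0 (k + 1)) ≠ ∅ →
            (s''.setWord vA 0 (k + 1)).word vG 0 < 4 * F.card) ∧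
          (s''.setWord vA 0 (k + 1)).out.card + 24 * L ≤
            s.out.card + 24 * L * (s''.setWord vA 0 (k + 1)).word vG 0 ∧
          (uncovered (s''.setWord vA 0 (k + 1)) = ∅ ∨ w < (s''.setWord vA 0 (k + 1)).word vG 0 ∨
            (s''.setWord vA 0 (k + 1)).word vG 0 = 2 ^ (k + 1)))) (by omega) ?_
      · rwa [add_zero] at this
      · rintro b' s'' h8 ⟨h9, h10, h11⟩ hF''
        have hu4 : uncovered (s''.setWord vA 0 (k + 1)) = uncovered s' := by
          rw [← uncovered_congr h9]
          exact uncovered_congr (by funext c; simp)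
        have hg5 : (s''.setWord vA 0 (k + 1)).word vG 0 = g := by simp [h11]
        rw [failure_true]
        rw [hpot1, hu4, hg5, out_setWord, h10]
        refine ⟨?_, ?_, h2, h3, h4, h5, h6, ?_⟩
        · have : pot s'' = pot s' := by simp only [hpot, h11, ← hg]
          omega
        · exact h1.trans (Progress.of_word_eq (by funext c; simp [h9])) (by simp [h10])
        · by_cases h0 : uncovered s' = ∅
          · exact Or.inl h0
          · right; left
            by_contra hle
            exact hguard ⟨h0, by omega⟩
  · have hp0 : pot (s1.setWord vA 0 0) ≤ A * (8 * M) := by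
      rw [hpot1]
      exact Nat.mul_le_mul_left _ (Nat.sub_le _ _)
    have e3 : A * (8 * M) = 64000 * (L * (n * m) * M) := by rw [hA]; ring
    rw [e3] at hp0
    simp only [Finset.sum_const, Finset.card_range, smul_eq_mul, cost_rd]
    have e4 : L * (50 * n + 200 + 2 + 11) = 50 * (L * n) + 213 * L := by ring
    rw [e4]
    omega
  · rintro s' - ⟨⟨h1, h2, h3, h4, h5, h6, h7⟩, -⟩
    refine ⟨h1, ?_, fun hne => ?_⟩
    · have : 24 * L * s'.word vG 0 ≤ 24 * L * (8 * F.card) := Nat.mul_le_mul_left _ h4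
      have : 24 * L * (8 * F.card) = 192 * L * F.card := by ring
      omega
    · have h8 := h5 hne
      rcases h7 with h7 | h7 | h7
      · exact absurd h7 hne
      · omega
      -- After `Nat.size n` doublings the guess exceeds `n`, and hence `w`.
      · have : n < 2 ^ L := Nat.lt_size_self n
        omega

end Guesses

/-! ## Threshold greedy on truncated incidence lists -/

/-- The cell of the array `vINV` with entry `vR` of the list of `vX`. -/
def invCell : WExpr := .add (.mul (rd vX) (rd vN)) (rd vR)

/-- If entry `vR` of the list of nearest points of `vJ` takes care of `vJ`, append `vJ` to the
incidence list of that entry. -/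
def fillOne (cov : BExpr) : Prog :=
  .seq (asg vX (.read vNB (.add (.mul (rd vJ) (rd vW)) (rd vR))))
    (.ite cov
      (.seq (.wset vINV (.add (.mul (rd vX) (rd vN)) (.read vDEG (rd vX))) (rd vJ))
        (.wset vDEG (rd vX) (.add (.read vDEG (rd vX)) (.lit 1)))) .skip)

/-- Compute the incidence lists. -/
def fill (cov : BExpr) : Prog :=
  .seq (forLoop vX (rd vN) (.wset vDEG (rd vX) (.lit 0))) <|
  forLoop vJ (rd vN) (.ite (.weq (.read vCV (rd vJ)) (.lit 0))
    (forLoop vR (rd vW) (fillOne cov)) .skip)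

/-- Count the uncovered points in the incidence list of `vX`. -/
def countList : Prog :=
  .seq (asg vC (.lit 0)) <|
  forLoop vR (.read vDEG (rd vX))
    (.ite (.weq (.read vCV (.read vINV invCell)) (.lit 0)) (asg vC (.add (rd vC) (.lit 1))) .skip)

/-- Mark the points in the incidence list of `vX`. -/
def markList : Prog :=
  forLoop vR (.read vDEG (rd vX)) (.wset vCV (.read vINV invCell) (.lit 1))

/-- Output the edge to `vX` if the incidence list has enough uncovered points. -/
def levelStep : Prog :=
  .seq countList (.ite (.neg (.wlt (rd vC) (rd vTH)))
    (.seq (.emit (rd vI) (rd vX)) markList) .skip)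

/-- One level of the threshold greedy algorithm. -/
def level : Prog := .seq (asg vTH (.div (rd vTH) (.lit 2))) (forLoop vX (rd vN) levelStep)

/-- The threshold greedy algorithm. -/
def greedy (cov : BExpr) : Prog :=
  .seq (fill cov) <| .seq (asg vTH (rd vP)) (forLoop vA (rd vL) level)

@[simp] theorem mods_fillOne (cov : BExpr) : (fillOne cov).mods = [vX, vINV, vDEG] := rfl
@[simp] theorem keepsReals_fillOne (cov : BExpr) : (fillOne cov).keepsReals = true := rfl
@[simp] theorem mods_fill (cov : BExpr) : (fill cov).mods =
    [vX, vDEG, vX, vJ, vR, vX, vINV, vDEG, vR, vJ] := rfl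
@[simp] theorem silent_fill (cov : BExpr) : (fill cov).silent = true := rfl
@[simp] theorem mods_countList : countList.mods = [vC, vR, vC, vR] := rfl
@[simp] theorem silent_countList : countList.silent = true := rfl
@[simp] theorem mods_levelStep : levelStep.mods = [vC, vR, vC, vR, vR, vCV, vR] := rfl
@[simp] theorem mods_level : level.mods = vTH :: vX :: (levelStep.mods ++ [vX]) := rfl
@[simp] theorem mods_greedy (cov : BExpr) : (greedy cov).mods =
    (fill cov).mods ++ (vTH :: vA :: (level.mods ++ [vA])) := rfl

section Greedy

variable {n W D : ℕ} {d : Fin n → Fin n → ℝ} {a : ℝ} {cov : BExpr} {Cv : ℕ → ℕ → ℕ → Prop}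

/-- The incidence list of `x` consists of the elements of `S`. -/
structure IsIncidenceList (s : State n) (x : ℕ) (S : Finset ℕ) : Prop where
  card : s.word vDEG x = S.card
  image : (Finset.range S.card).image (fun c => s.word vINV (x * n + c)) = S

theorem IsIncidenceList.congr {s s' : State n} {x : ℕ} {S : Finset ℕ} (h : IsIncidenceList s x S)
    (h1 : s'.word vDEG = s.word vDEG) (h2 : s'.word vINV = s.word vINV) :
    IsIncidenceList s' x S := by
  constructor
  · rw [h1, h.card]
  · rw [h2, h.image]

open Classical in
/-- The points in the incidence list of `x` after treating the points below `k` completely, and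
the point `k` up to entry `r`. -/
noncomputable def partialIncidence (Cv : ℕ → ℕ → ℕ → Prop) (s : State n) (i k r x : ℕ) :
    Finset ℕ :=
  (uncovered s).filter fun j => Cv i x j ∧
    ((j < k ∧ ∃ r' < sqrtCeil n, nb s j r' = x) ∨ (j = k ∧ ∃ r' < r, nb s j r' = x))

open Classical in
/-- The uncovered points `j` that have `x` as a near neighbor taking care of `j`. -/
noncomputable def incidence (Cv : ℕ → ℕ → ℕ → Prop) (s : State n) (i x : ℕ) : Finset ℕ :=
  (uncovered s).filter fun j => Cv i x j ∧ ∃ r < sqrtCeil n, nb s j r = x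

theorem partialIncidence_zero (s : State n) (i x : ℕ) : partialIncidence Cv s i 0 0 x = ∅ := by
  classical
  unfold partialIncidence
  refine Finset.filter_false_of_mem fun j _ => ?_
  rintro ⟨-, ⟨h, -⟩ | ⟨-, r, h, -⟩⟩ <;> omega

theorem partialIncidence_self (s : State n) (i x : ℕ) :
    partialIncidence Cv s i n 0 x = incidence Cv s i x := by
  classical
  unfold partialIncidence incidence
  refine Finset.filter_congr fun j hj => ?_
  have := (mem_uncovered.mp hj).1
  refine and_congr_right fun _ => ⟨?_, fun h => Or.inl ⟨this, h⟩⟩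
  rintro (⟨-, h⟩ | ⟨h, -⟩)
  · exact h
  · omega

theorem partialIncidence_succ (s : State n) (i k x : ℕ) :
    partialIncidence Cv s i (k + 1) 0 x = partialIncidence Cv s i k (sqrtCeil n) x := by
  classical
  unfold partialIncidence
  refine Finset.filter_congr fun j _ => and_congr_right fun _ => ?_
  constructor
  · rintro (⟨h1, h2⟩ | ⟨-, r, hr, -⟩)
    · rcases (show j < k ∨ j = k by omega) with h | h
      · exact Or.inl ⟨h, h2⟩
      · exact Or.inr ⟨h, h2⟩
    · omega
  · rintro (⟨h1, h2⟩ | ⟨h1, h2⟩)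
    · exact Or.inl ⟨by omega, h2⟩
    · exact Or.inl ⟨by omega, h2⟩

theorem partialIncidence_succ_of_covered {s : State n} {i k : ℕ} (hk : k ∉ uncovered s) (x : ℕ) :
    partialIncidence Cv s i (k + 1) 0 x = partialIncidence Cv s i k 0 x := by
  classical
  rw [partialIncidence_succ]
  unfold partialIncidence
  refine Finset.filter_congr fun j hj => and_congr_right fun _ => ?_
  have : j ≠ k := fun h => hk (h ▸ hj)
  simp [this]

open Classical in
theorem partialIncidence_step {s : State n} {i k r : ℕ} (hk : k ∈ uncovered s) (x : ℕ) :
    partialIncidence Cv s i k (r + 1) x = if x = nb s k r ∧ Cv i x k then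
      insert k (partialIncidence Cv s i k r x) else partialIncidence Cv s i k r x := by
  ext j
  have hiff : (∃ r' < r + 1, nb s j r' = x) ↔ (∃ r' < r, nb s j r' = x) ∨ x = nb s j r := by
    constructor
    · rintro ⟨r', h, h'⟩
      rcases (show r' < r ∨ r' = r by omega) with h1 | rfl
      · exact Or.inl ⟨r', h1, h'⟩
      · exact Or.inr h'.symm
    · rintro (⟨r', h, h'⟩ | h)
      · exact ⟨r', by omega, h'⟩
      · exact ⟨r, by omega, h.symm⟩
  by_cases hjk : j = k
  · subst hjk
    split_ifs with h
    · exact ⟨fun _ => Finset.mem_insert_self _ _, fun _ => Finset.mem_filter.mpr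
        ⟨hk, h.2, Or.inr ⟨rfl, r, by omega, h.1.symm⟩⟩⟩
    · simp only [partialIncidence, Finset.mem_filter, hk, hiff, lt_irrefl, false_and, true_and,
        false_or]
      refine and_congr_right fun hC => or_iff_left fun hx => h ⟨hx, hC⟩
  · split_ifs <;> simp [partialIncidence, hjk]

theorem not_mem_partialIncidence {s : State n} {i k r : ℕ} (hr : r < sqrtCeil n)
    (hinj : ∀ r₁ < sqrtCeil n, ∀ r₂ < sqrtCeil n, nb s k r₁ = nb s k r₂ → r₁ = r₂) :
    k ∉ partialIncidence Cv s i k r (nb s k r) := by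
  classical
  unfold partialIncidence
  simp only [Finset.mem_filter, not_and, lt_irrefl, false_and, false_or, true_and]
  rintro - - ⟨r', hr', h⟩
  have := hinj r' (by omega) r hr h
  omega

theorem spec_fillOne {s s₀ : State n} {i k r : ℕ} (hs : Params D s)
    (hW : (n + 1) * (n + 1) ≤ W) (hn : 2 ≤ n)
    (hcov : CoverTest W d a cov Cv) (ha : s.real 0 0 = a) (hi : s.word vI 0 = i)
    (hk : s.word vJ 0 = k) (hr : s.word vR 0 = r) (hrw : r < sqrtCeil n)
    (hNB : s.word vNB = s₀.word vNB) (hku : k ∈ uncovered s₀) (hlist : IsNearestList d s₀ k)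
    (hI : ∀ x < n, IsIncidenceList s x (partialIncidence Cv s₀ i k r x)) :
    Spec W d (fillOne cov) s 100 (fun s' => ∀ x < n,
      IsIncidenceList s' x (partialIncidence Cv s₀ i k (r + 1) x)) 0 := by
  classical
  have hc := hcov.cost
  have hkn := (mem_uncovered.mp hku).1
  have hwn := sqrtCeil_le n
  have hnn : n * sqrtCeil n ≤ n * n := Nat.mul_le_mul_left n hwn
  have hnW : n * n + 2 * n + 1 ≤ W := by
    have : (n + 1) * (n + 1) = n * n + 2 * n + 1 := by ring
    omega
  have hkr := mul_add_lt hkn hrw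
  have e1 : 1 % W = 1 := Nat.mod_eq_of_lt (by omega)
  have e2 : k * sqrtCeil n % W = k * sqrtCeil n := Nat.mod_eq_of_lt (by omega)
  have e3 : (k * sqrtCeil n + r) % W = k * sqrtCeil n + r := Nat.mod_eq_of_lt (by omega)
  set x₀ := nb s₀ k r with hx₀
  have hx₀n : x₀ < n := hlist.lt r hrw
  set E := partialIncidence Cv s₀ i k r x₀ with hE
  have hkE : k ∉ E := not_mem_partialIncidence hrw hlist.inj
  -- The new entry `k` is not yet in the list, because entries of a list of nearest points are
  -- distinct. So the list has room for `k` in its row of `n` cells and cannot run into the next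
  -- row.
  have hEn : E.card < n := by
    have h1 : insert k E ⊆ Finset.range n := by
      intro j hj
      rcases Finset.mem_insert.mp hj with rfl | hj
      · exact Finset.mem_range.mpr hkn
      · exact (Finset.filter_subset _ _) (Finset.filter_subset _ _ hj)
    have h2 := Finset.card_le_card h1
    rw [Finset.card_insert_of_notMem hkE, Finset.card_range] at h2
    omega
  have hcell := mul_add_lt hx₀n hEn
  have e4 : x₀ * n % W = x₀ * n := Nat.mod_eq_of_lt (by omega)
  have e5 : (x₀ * n + E.card) % W = x₀ * n + E.card := Nat.mod_eq_of_lt (by omega)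
  have e6 : (E.card + 1) % W = E.card + 1 := Nat.mod_eq_of_lt (by omega)
  have hx : s.word vNB (k * sqrtCeil n + r) = x₀ := by rw [hNB]; rfl
  have hdeg : s.word vDEG x₀ = E.card := (hI x₀ hx₀n).card
  unfold fillOne
  refine Spec.seq (ε1 := 0) (ε2 := 0) (c1 := 20) (c2 := 75)
    (P := fun s' => s' = s.setWord vX 0 x₀) (Spec.of_eff (by simp) (by simp) ?_) ?_
  · simp only [eff_asg, WExpr.eval, eval_rd, hk, hs.W_eq, hr, e2, e3, hx]
  rintro s1 rfl -
  have hh := hcov.holds (s.setWord vX 0 x₀) (by simpa using ha)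
  simp only [word_setWord, Nat.reduceEqDiff, false_and, if_false, and_self, if_true, hi, hk] at hh
  refine Spec.ite (c1 := 40) (fun h => ?_) (fun h => ?_)
  · have hC := hh.mp h
    refine Spec.of_eff (by simp) (by simp) ?_
    simp only [Prog.eff, WExpr.eval, eval_rd, word_setWord]
    simp only [Nat.reduceEqDiff, false_and, if_false, and_self, if_true, hs.n_eq, hdeg, hk, e1,
      e4, e5, e6]
    intro x hxn
    rw [partialIncidence_step hku]
    by_cases hxx : x = x₀
    · subst hxx
      rw [if_pos ⟨rfl, hC⟩]
      constructor
      · simp only [word_setWord, and_self, if_true]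
        rw [Finset.card_insert_of_notMem hkE]
      · rw [Finset.card_insert_of_notMem hkE, Finset.range_add_one, Finset.image_insert]
        simp only [word_setWord, Nat.reduceEqDiff, false_and, if_false, true_and, if_true]
        congr 1
        refine Eq.trans ?_ (hI _ hx₀n).image
        refine Finset.image_congr fun c hc => ?_
        have hc' : c < E.card := Finset.mem_range.mp (Finset.mem_coe.mp hc)
        rw [if_neg (by omega)]
    · rw [if_neg (fun h => hxx h.1)]
      have hle : (partialIncidence Cv s₀ i k r x).card ≤ n :=
        (Finset.card_filter_le _ _).trans (card_uncovered_le s₀)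
      constructor
      · simp only [word_setWord, Nat.reduceEqDiff, false_and, if_false, true_and, hxx]
        exact (hI x hxn).card
      · refine Eq.trans ?_ (hI x hxn).image
        refine Finset.image_congr fun c hc => ?_
        have hc' : c < (partialIncidence Cv s₀ i k r x).card :=
          Finset.mem_range.mp (Finset.mem_coe.mp hc)
        simp only [word_setWord, Nat.reduceEqDiff, false_and, if_false, true_and]
        rw [if_neg]
        intro h
        exact hxx (mul_add_inj (by omega) hEn h).1
  · have hC : ¬ Cv i x₀ k := fun hC => h (hh.mpr hC)
    refine Spec.of_eff (by simp) (by simp) ?_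
    intro x hxn
    rw [partialIncidence_step hku, if_neg (by rintro ⟨rfl, h⟩; exact hC h)]
    exact (hI x hxn).congr (by funext c; simp) (by funext c; simp)

theorem spec_fill {s : State n} {i : ℕ} (hs : Params D s)
    (hW : (n + 1) * (n + 1) ≤ W) (hn : 2 ≤ n)
    (hcov : CoverTest W d a cov Cv) (ha : s.real 0 0 = a) (hi : s.word vI 0 = i)
    (hlist : ∀ j < n, IsNearestList d s j) :
    Spec W d (fill cov) s (250 * (n * sqrtCeil n)) (fun s' => ∀ x < n,
      IsIncidenceList s' x (incidence Cv s i x)) 0 := by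
  have hw0 := sqrtCeil_pos (n := n) (by omega)
  have hwn := sqrtCeil_le n
  have hnw : n ≤ n * sqrtCeil n := Nat.le_mul_of_pos_right n hw0
  have hnn : 2 * n ≤ n * n := Nat.mul_le_mul_right n hn
  have hnW : n * n + 2 * n + 1 ≤ W := by
    have : (n + 1) * (n + 1) = n * n + 2 * n + 1 := by ring
    omega
  have e0 : 0 % W = 0 := Nat.zero_mod W
  unfold fill
  refine Spec.seq (ε1 := 0) (ε2 := 0) (c1 := 20 * n + 10) (c2 := 120 * (n * sqrtCeil n) + 70 * n)
    (P := fun s' => ∀ x < n, s'.word vDEG x = 0) ?_ ?_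
  · refine (spec_forLoop (N := n) (C := 20 * n + 10) (δ := 0)
      (fun k s' => ∀ x < k, s'.word vDEG x = 0) 4 0 ?_ (by omega) (by simp) (by simp) ?_
      ?_ (by simp)).weaken le_rfl (fun s' _ h => h.1) le_rfl
    · intro s' hF
      simp [hF.word _ (show vN ∉ _ by simp), hs.n_eq]
    · intro k s' hk hF hx hI
      refine Spec.of_eff (by simp) (by simp) ?_
      simp [hx]
      intro x hxk
      exact fun h => hI x (by omega)
    · simp only [cost_rd]; omega
  intro s1 hD1 hF1
  have hs1 : Params D s1 := hs.frame hF1 (by simp)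
  refine (spec_forLoop (N := n) (C := 120 * (n * sqrtCeil n) + 70 * n) (δ := 0)
      (fun k s' => ∀ x < n, IsIncidenceList s' x (partialIncidence Cv s i k 0 x))
      (113 * sqrtCeil n + 30) 0 ?_ (by omega) (by simp) ?_ ?_
      ?_ (by simp)).weaken le_rfl ?_ le_rfl
  · intro s' hF
    simp [hF.word _ (show vN ∉ _ by simp), hs1.n_eq]
  · intro x hx
    rw [partialIncidence_zero]
    exact ⟨by simp [hD1 x hx], by simp⟩
  · intro k s' hk hF hJ hI
    have hs' : Params D s' := hs1.frame hF (by simp)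
    have hCV : s'.word vCV = s.word vCV := by rw [hF.word _ (by simp), hF1.word _ (by simp)]
    refine Spec.ite (c1 := 113 * sqrtCeil n + 15) (fun h => ?_) (fun h => ?_) (by simp; omega)
    · simp only [BExpr.Holds, WExpr.eval, eval_rd, hJ, hCV, e0] at h
      have hku : k ∈ uncovered s := mem_uncovered.mpr ⟨hk, h⟩
      refine (spec_forLoop (N := sqrtCeil n) (C := 113 * sqrtCeil n + 15) (δ := 0)
        (fun r s' => ∀ x < n, IsIncidenceList s' x (partialIncidence Cv s i k r x))
        100 0 ?_ (by omega) (by simp) ?_ ?_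
        ?_ (by simp)).weaken le_rfl ?_ le_rfl
      · intro s'' hF'
        simp [hF'.word _ (show vW ∉ _ by simp), hs'.W_eq]
      · exact fun x hx => (hI x hx).congr (by funext c; simp) (by funext c; simp)
      · intro r s'' hr hF' hR hI'
        refine (spec_fillOne (s₀ := s) (i := i) (k := k) (r := r) (hs'.frame hF' (by simp)) hW hn
          hcov ?_ ?_ ?_ hR hr ?_ hku
          (hlist k hk) hI').weaken le_rfl ?_ le_rfl
        · rw [hF'.real (by simp), hF.real (by simp), hF1.real (by simp), ha]
        · rw [hF'.word _ (by simp), hF.word _ (by simp), hF1.word _ (by simp), hi]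
        · rw [hF'.word _ (by simp), hJ]
        · rw [hF'.word _ (by simp), hF.word _ (by simp), hF1.word _ (by simp)]
        · exact fun s3 _ h3 x hx => (h3 x hx).congr (by funext c; simp) (by funext c; simp)
      · simp only [cost_rd]; omega
      · rintro s'' - ⟨h3, -⟩ x hx
        rw [partialIncidence_succ]
        exact (h3 x hx).congr (by funext c; simp) (by funext c; simp)
    · simp only [BExpr.Holds, WExpr.eval, eval_rd, hJ, hCV, e0] at h
      have hku : k ∉ uncovered s := fun h' => h (mem_uncovered.mp h').2
      refine Spec.of_eff (by simp) (by simp) ?_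
      intro x hx
      rw [partialIncidence_succ_of_covered hku]
      exact (hI x hx).congr (by funext c; simp) (by funext c; simp)
  · simp only [cost_rd]
    have : n * (113 * sqrtCeil n + 30 + 2 + 11) = 113 * (n * sqrtCeil n) + 43 * n := by ring
    omega
  · rintro s' - ⟨h, -⟩ x hx
    rw [← partialIncidence_self]
    exact h x hx

theorem IsIncidenceList.injOn {s : State n} {x : ℕ} {S : Finset ℕ} (h : IsIncidenceList s x S) :
    Set.InjOn (fun c => s.word vINV (x * n + c)) (Finset.range S.card) := by
  rw [← Finset.card_image_iff, h.image, Finset.card_range]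

/-- An edge is output only when it covers at least `θ` new points, so `out.card * θ +
(uncovered).card` never increases. If it is output, no point of `S` stays uncovered, which is why `θ
≠ 0` is needed for the strict bound. -/
theorem spec_levelStep {s : State n} {i x θ : ℕ} {S : Finset ℕ} (hs : Params D s)
    (hW : (n + 1) * (n + 1) ≤ W) (hn : 2 ≤ n) (hi : s.word vI 0 = i) (hin : i < n)
    (hx : s.word vX 0 = x) (hxn : x < n) (hθ : s.word vTH 0 = θ)
    (hS : IsIncidenceList s x S) (hSn : S ⊆ Finset.range n) (hSC : ∀ j ∈ S, Cv i x j) :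
    Spec W d levelStep s (100 * S.card + 100) (fun s' => Progress Cv s s' i ∧
      s'.out.card * θ + (uncovered s').card ≤ s.out.card * θ + (uncovered s).card ∧
      (θ ≠ 0 → (uncovered s' ∩ S).card < θ)) 0 := by
  have hnn : 2 * n ≤ n * n := Nat.mul_le_mul_right n hn
  have hnW : n * n + 2 * n + 1 ≤ W := by
    have : (n + 1) * (n + 1) = n * n + 2 * n + 1 := by ring
    omega
  have e0 : 0 % W = 0 := Nat.zero_mod W
  have e1 : 1 % W = 1 := Nat.mod_eq_of_lt (by omega)
  have hSn' : S.card ≤ n := by simpa using Finset.card_le_card hSn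
  have hcell : ∀ c < S.card, (x * n % W + c) % W = x * n + c := by
    intro c hc
    have := mul_add_lt hxn (lt_of_lt_of_le hc hSn')
    rw [Nat.mod_eq_of_lt (show x * n < W by omega), Nat.mod_eq_of_lt (by omega)]
  set f : ℕ → ℕ := fun c => s.word vINV (x * n + c) with hf
  have hinj : Set.InjOn f (Finset.range S.card) := hS.injOn
  have himg : (Finset.range S.card).image f = S := hS.image
  have hcount : ((Finset.range S.card).filter fun c => s.word vCV (f c) = 0).card =
      (uncovered s ∩ S).card := by
    rw [← Finset.card_image_of_injOn (f := f)
      (hinj.mono (Finset.coe_subset.mpr (Finset.filter_subset _ _)))]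
    congr 1
    ext j
    simp only [Finset.mem_image, Finset.mem_filter, Finset.mem_inter, mem_uncovered]
    constructor
    · rintro ⟨c, ⟨hc, h0⟩, rfl⟩
      have hfS : f c ∈ S := by rw [← himg]; exact Finset.mem_image_of_mem f hc
      exact ⟨⟨Finset.mem_range.mp (hSn hfS), h0⟩, hfS⟩
    · rintro ⟨⟨-, h0⟩, hj⟩
      rw [← himg] at hj
      obtain ⟨c, hc, rfl⟩ := Finset.mem_image.mp hj
      exact ⟨c, ⟨hc, h0⟩, rfl⟩
  unfold levelStep
  refine Spec.seq (ε1 := 0) (ε2 := 0) (c1 := 50 * S.card + 30) (c2 := 40 * S.card + 60)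
    (P := fun s' => s'.word vC 0 = (uncovered s ∩ S).card) ?_ ?_
  · unfold countList
    refine Spec.seq (ε1 := 0) (ε2 := 0) (c1 := 10) (c2 := 50 * S.card + 15)
      (P := fun s' => s'.word vC 0 = 0) (Spec.of_eff (by simp) (by simp) (by simp)) ?_
    intro s1 hC1 hF1
    refine (spec_forLoop (N := S.card) (C := 50 * S.card + 15) (δ := 0)
      (fun k s' => s'.word vC 0 = ((Finset.range k).filter fun c => s.word vCV (f c) = 0).card)
      34 0 ?_ (by omega) (by simp) ?_ ?_ ?_ (by simp)).weaken le_rfl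
      (fun s' _ h => h.1.trans hcount) le_rfl
    · intro s' hF
      simp only [WExpr.eval, eval_rd, hF.word vX (by simp), hF.word vDEG (by simp),
        hF1.word vX (by simp), hF1.word vDEG (by simp), hx, hS.card]
    · simp [hC1]
    · intro k s' hk hF hR hI
      refine Spec.of_eff (by simp) (by simp [invCell]) ?_
      have f1 : s'.word vX 0 = x := by rw [hF.word _ (by simp), hF1.word _ (by simp), hx]
      have f2 : s'.word vN 0 = n := by rw [hF.word _ (by simp), hF1.word _ (by simp), hs.n_eq]
      have f3 : s'.word vINV = s.word vINV := by rw [hF.word _ (by simp), hF1.word _ (by simp)]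
      have f4 : s'.word vCV = s.word vCV := by rw [hF.word _ (by simp), hF1.word _ (by simp)]
      have hfk : s.word vINV (x * n + k) = f k := rfl
      simp only [Prog.eff, eff_asg, BExpr.Holds, WExpr.eval, eval_rd, invCell, f1, f2, f3, f4, hR,
        hcell k hk, hfk, e0, e1]
      rw [Finset.range_add_one, Finset.filter_insert]
      have hcard : ((Finset.range k).filter fun c => s.word vCV (f c) = 0).card ≤ k := by
        simpa using Finset.card_filter_le (Finset.range k) fun c => s.word vCV (f c) = 0
      by_cases h0 : s.word vCV (f k) = 0
      · rw [if_pos h0, if_pos h0, Finset.card_insert_of_notMem (by simp)]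
        simp only [word_setWord, Nat.reduceEqDiff, false_and, if_false, and_self, if_true, hI]
        exact Nat.mod_eq_of_lt (by omega)
      · rw [if_neg h0, if_neg h0]
        simpa using hI
    · simp [WExpr.cost]; omega
  intro s1 hC1 hF1
  have hCV1 : s1.word vCV = s.word vCV := hF1.word _ (by simp)
  have hu1 : uncovered s1 = uncovered s := uncovered_congr hCV1
  have hout1 : s1.out = s.out := hF1.out (by simp)
  have hP1 : Progress Cv s s1 i := Progress.of_word_eq hCV1
  refine Spec.ite (c1 := 40 * S.card + 40) (fun h => ?_) (fun h => ?_) (by simp; omega)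
  swap
  · simp only [BExpr.Holds, eval_rd, hC1, hF1.word vTH (by simp), hθ, not_not] at h
    refine Spec.of_eff (by simp) (by simp) ?_
    refine ⟨hP1, ?_, fun _ => ?_⟩
    · simp only [Prog.eff, hu1, hout1]; exact le_rfl
    · simp only [Prog.eff, hu1]; exact h
  simp only [BExpr.Holds, eval_rd, hC1, hF1.word vTH (by simp), hθ, not_lt] at h
  have f1 : s1.word vX 0 = x := by rw [hF1.word _ (by simp), hx]
  have f2 : s1.word vN 0 = n := by rw [hF1.word _ (by simp), hs.n_eq]
  have f3 : s1.word vINV = s.word vINV := hF1.word _ (by simp)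
  have f5 : s1.word vDEG = s.word vDEG := hF1.word _ (by simp)
  have f6 : s1.word vI 0 = i := by rw [hF1.word _ (by simp), hi]
  refine Spec.seq (ε1 := 0) (ε2 := 0) (c1 := 10) (c2 := 40 * S.card + 20)
    (P := fun s' => s' = s1.addEdge i x) (Spec.of_eff (by simp) (by simp) (by simp [f6, f1])) ?_
  rintro s2 rfl -
  unfold markList
  refine (spec_forLoop (N := S.card) (C := 40 * S.card + 20) (δ := 0)
    (fun k s' => ∀ j, s'.word vCV j = if j ∈ (Finset.range k).image f then 1 else s.word vCV j)
    24 0 ?_ (by omega) (by simp) ?_ ?_ ?_ (by simp)).weaken le_rfl ?_ le_rfl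
  · intro s' hF
    simp only [WExpr.eval, eval_rd, hF.word vX (by simp), hF.word vDEG (by simp), word_addEdge,
      f1, f5, hS.card]
  · intro j; simp [hCV1]
  · intro k s' hk hF hR hI
    refine Spec.of_eff (by simp) (by simp [invCell]) ?_
    have g1 : s'.word vX 0 = x := by rw [hF.word _ (by simp), word_addEdge, f1]
    have g2 : s'.word vN 0 = n := by rw [hF.word _ (by simp), word_addEdge, f2]
    have g3 : s'.word vINV = s.word vINV := by rw [hF.word _ (by simp), word_addEdge, f3]
    have hfk : s.word vINV (x * n + k) = f k := rfl
    simp only [Prog.eff, WExpr.eval, eval_rd, invCell, g1, g2, g3, hR, hcell k hk, hfk, e1]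
    intro j
    simp only [word_setWord, Nat.reduceEqDiff, false_and, if_false, true_and]
    rw [Finset.range_add_one, Finset.image_insert, hI j]
    by_cases hj : j = f k
    · rw [if_pos hj, if_pos (by rw [hj]; exact Finset.mem_insert_self _ _)]
    · rw [if_neg hj]
      simp only [Finset.mem_insert, hj, false_or]
  · simp [WExpr.cost]; omega
  · rintro s' hF ⟨hI, -⟩
    have hout : s'.out = (s1.addEdge i x).out := hF.out (by simp)
    have hu : uncovered s' = uncovered s \ S := by
      ext j
      simp only [Finset.mem_sdiff, mem_uncovered, hI j, himg]
      by_cases hj : j ∈ S <;> simp [hj]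
    have hcard : (uncovered s').card + (uncovered s ∩ S).card = (uncovered s).card := by
      rw [hu, add_comm]; exact Finset.card_inter_add_card_sdiff _ _
    refine ⟨⟨by rw [hu]; exact Finset.sdiff_subset, fun j hj => ?_⟩, ?_, fun h0 => ?_⟩
    · by_cases hjS : j ∈ S
      · exact Or.inr ⟨x, hxn, (hasEdge_addEdge hin hxn).mono hout.ge, hSC j hjS⟩
      · left; rw [hu]; exact Finset.mem_sdiff.mpr ⟨hj, hjS⟩
    · have h1 : s'.out.card ≤ s.out.card + 1 := by
        rw [hout, ← hout1]; exact card_out_addEdge _ _ _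
      have h2 : s'.out.card * θ ≤ (s.out.card + 1) * θ := Nat.mul_le_mul_right _ h1
      rw [add_mul, one_mul] at h2
      omega
    · rw [hu, Finset.sdiff_inter_self]
      simp only [Finset.card_empty]
      omega

end Greedy

/-! ### Truncated lists suffice for the threshold greedy algorithm -/

section GreedySpec

variable {n W D : ℕ} {d : Fin n → Fin n → ℝ} {a : ℝ} {cov : BExpr} {Cv : ℕ → ℕ → ℕ → Prop}

theorem mem_incidence {s : State n} {i x j : ℕ} : j ∈ incidence Cv s i x ↔
    j ∈ uncovered s ∧ Cv i x j ∧ ∃ r < sqrtCeil n, nb s j r = x := by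
  classical
  exact Finset.mem_filter

theorem incidence_subset (s : State n) (i x : ℕ) : incidence Cv s i x ⊆ Finset.range n := by
  intro j hj
  exact Finset.mem_range.mpr (mem_uncovered.mp (mem_incidence.mp hj).1).1

/-- Double counting: a point lies only in the incidence lists of its `sqrtCeil n` near points. This
bounds the time of a level. -/
theorem sum_card_incidence_le (s : State n) (i : ℕ) :
    ∑ x ∈ Finset.range n, (incidence Cv s i x).card ≤ n * sqrtCeil n := by
  classical
  have h1 : ∀ x, (incidence Cv s i x).card =
      ((uncovered s).bipartiteAbove (fun x j => j ∈ incidence Cv s i x) x).card := by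
    intro x
    congr 1
    ext j
    simp only [Finset.mem_bipartiteAbove]
    exact ⟨fun h => ⟨(mem_incidence.mp h).1, h⟩, fun h => h.2⟩
  simp only [h1]
  rw [Finset.sum_card_bipartiteAbove_eq_sum_card_bipartiteBelow]
  calc _ ≤ ∑ _j ∈ uncovered s, sqrtCeil n := by
        refine Finset.sum_le_sum fun j _ => ?_
        refine le_trans (Finset.card_le_card (t := (Finset.range (sqrtCeil n)).image (nb s j)) ?_)
          (Finset.card_image_le.trans (by simp))
        intro x hx
        obtain ⟨r, hr, h⟩ := (mem_incidence.mp ((Finset.mem_bipartiteBelow _).mp hx).2).2.2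
        exact Finset.mem_image.mpr ⟨r, Finset.mem_range.mpr hr, h⟩
    _ = (uncovered s).card * sqrtCeil n := by simp
    _ ≤ _ := Nat.mul_le_mul_right _ (card_uncovered_le s)

/-- Whether a point is taken care of depends monotonically on the distance from it. -/
def IsClosedTowards (d : Fin n → Fin n → ℝ) (Cv : ℕ → ℕ → ℕ → Prop) (i : ℕ) : Prop :=
  ∀ x < n, ∀ y < n, ∀ j < n, Cv i x j → natDist d y j ≤ natDist d x j → Cv i y j

/-- A point of `U` either is in the incidence list of a member of `F` (`U₁`), or is taken care of by
all of its `sqrtCeil n` near points (`U₂`) and then occurs in that many lists. The first sum counts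
the former, the second the latter. -/
theorem card_uncovered_mul_le {s : State n} {i : ℕ} {F U : Finset ℕ} (hF : IsCover n Cv i F)
    (hcl : IsClosedTowards d Cv i) (hlist : ∀ j < n, IsNearestList d s j)
    (hU : U ⊆ uncovered s) (hi : i ∉ U) :
    sqrtCeil n * U.card ≤ sqrtCeil n * ∑ x ∈ F, (U ∩ incidence Cv s i x).card +
      ∑ x ∈ Finset.range n, (U ∩ incidence Cv s i x).card := by
  classical
  set U₁ := F.biUnion fun x => U ∩ incidence Cv s i x with hU₁
  set U₂ := U.filter fun j => ∀ r < sqrtCeil n, Cv i (nb s j r) j with hU₂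
  have hsub : U ⊆ U₁ ∪ U₂ := by
    intro j hj
    have hjn := (mem_uncovered.mp (hU hj)).1
    obtain ⟨x, hx, hC⟩ := hF.exists_mem j hjn (fun h => hi (h ▸ hj))
    by_cases hr : ∃ r < sqrtCeil n, nb s j r = x
    · exact Finset.mem_union_left _ (Finset.mem_biUnion.mpr ⟨x, hx,
        Finset.mem_inter.mpr ⟨hj, mem_incidence.mpr ⟨hU hj, hC, hr⟩⟩⟩)
    · refine Finset.mem_union_right _ (Finset.mem_filter.mpr ⟨hj, fun r hrw => ?_⟩)
      -- The cover uses an `x` that is not near `j`, so every near point is at least as close to `j`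
      -- as `x`.
      refine hcl x (hF.lt x hx) _ ((hlist j hjn).lt r hrw) j hjn hC ?_
      exact (hlist j hjn).le r hrw x (hF.lt x hx) fun r' h h' => hr ⟨r', h, h'⟩
  have h1 : U₁.card ≤ ∑ x ∈ F, (U ∩ incidence Cv s i x).card := Finset.card_biUnion_le
  have h2 : sqrtCeil n * U₂.card ≤ ∑ x ∈ Finset.range n, (U ∩ incidence Cv s i x).card := by
    calc sqrtCeil n * U₂.card = ∑ _j ∈ U₂, sqrtCeil n := by simp [mul_comm]
      _ ≤ ∑ j ∈ U₂, ((Finset.range n).bipartiteBelow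
            (fun x j => j ∈ incidence Cv s i x) j).card := by
          refine Finset.sum_le_sum fun j hj => ?_
          obtain ⟨hjU, hjC⟩ := Finset.mem_filter.mp hj
          have hjn := (mem_uncovered.mp (hU hjU)).1
          have hcard : ((Finset.range (sqrtCeil n)).image (nb s j)).card = sqrtCeil n := by
            rw [Finset.card_image_of_injOn, Finset.card_range]
            intro r₁ h₁ r₂ h₂ h
            exact (hlist j hjn).inj r₁ (by simpa using h₁) r₂ (by simpa using h₂) h
          refine hcard.ge.trans (Finset.card_le_card fun x hx => ?_)
          obtain ⟨r, hr, rfl⟩ := Finset.mem_image.mp hx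
          have hr' := Finset.mem_range.mp hr
          exact (Finset.mem_bipartiteBelow _).mpr ⟨Finset.mem_range.mpr ((hlist j hjn).lt r hr'),
            mem_incidence.mpr ⟨hU hjU, hjC r hr', r, hr', rfl⟩⟩
      _ = ∑ x ∈ Finset.range n, (U₂.bipartiteAbove
            (fun x j => j ∈ incidence Cv s i x) x).card :=
          (Finset.sum_card_bipartiteAbove_eq_sum_card_bipartiteBelow _).symm
      _ ≤ _ := by
          refine Finset.sum_le_sum fun x _ => Finset.card_le_card fun j hj => ?_
          obtain ⟨hj1, hj2⟩ := (Finset.mem_bipartiteAbove _).mp hj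
          exact Finset.mem_inter.mpr ⟨(Finset.mem_filter.mp hj1).1, hj2⟩
  calc sqrtCeil n * U.card ≤ sqrtCeil n * (U₁.card + U₂.card) :=
        Nat.mul_le_mul_left _ ((Finset.card_le_card hsub).trans (Finset.card_union_le _ _))
    _ = sqrtCeil n * U₁.card + sqrtCeil n * U₂.card := mul_add _ _ _
    _ ≤ _ := Nat.add_le_add (Nat.mul_le_mul_left _ h1) h2

/-- Bound every summand of `card_uncovered_mul_le` by `θ`, use `n ≤ sqrtCeil n * sqrtCeil n`, and
cancel `sqrtCeil n`. -/
theorem card_uncovered_le_of_forall {s : State n} {i θ : ℕ} {F U : Finset ℕ} (hn : 2 ≤ n)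
    (hF : IsCover n Cv i F) (hcl : IsClosedTowards d Cv i)
    (hlist : ∀ j < n, IsNearestList d s j) (hU : U ⊆ uncovered s) (hi : i ∉ U)
    (h : ∀ x < n, (U ∩ incidence Cv s i x).card ≤ θ) :
    U.card ≤ θ * (F.card + sqrtCeil n) := by
  have hw := sqrtCeil_pos (n := n) (by omega)
  refine le_of_mul_le_mul_left ((card_uncovered_mul_le hF hcl hlist hU hi).trans ?_) hw
  have h1 : ∑ x ∈ F, (U ∩ incidence Cv s i x).card ≤ F.card * θ := by
    simpa using Finset.sum_le_sum fun x hx => h x (hF.lt x hx)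
  have h2 : ∑ x ∈ Finset.range n, (U ∩ incidence Cv s i x).card ≤ n * θ := by
    simpa using Finset.sum_le_sum fun x hx => h x (Finset.mem_range.mp hx)
  calc _ ≤ sqrtCeil n * (F.card * θ) + sqrtCeil n * sqrtCeil n * θ :=
        Nat.add_le_add (Nat.mul_le_mul_left _ h1)
          (h2.trans (Nat.mul_le_mul_right _ (le_sqrtCeil_mul n)))
    _ = _ := by ring

theorem spec_level {s : State n} {i θ : ℕ} {S : ℕ → Finset ℕ} (hs : Params D s)
    (hW : (n + 1) * (n + 1) ≤ W) (hn : 2 ≤ n) (hi : s.word vI 0 = i) (hin : i < n)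
    (hθ : s.word vTH 0 = 2 * θ) (hθ0 : θ ≠ 0)
    (hS : ∀ x < n, IsIncidenceList s x (S x)) (hSn : ∀ x < n, S x ⊆ Finset.range n)
    (hSC : ∀ x < n, ∀ j ∈ S x, Cv i x j)
    (hsum : ∑ x ∈ Finset.range n, (S x).card ≤ n * sqrtCeil n) :
    Spec W d level s (300 * (n * sqrtCeil n)) (fun s' => Progress Cv s s' i ∧
      s'.word vTH 0 = θ ∧
      s'.out.card * θ + (uncovered s').card ≤ s.out.card * θ + (uncovered s).card ∧
      ∀ x < n, (uncovered s' ∩ S x).card < θ) 0 := by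
  have hw0 := sqrtCeil_pos (n := n) (by omega)
  have hnw : n ≤ n * sqrtCeil n := Nat.le_mul_of_pos_right n hw0
  have hnn : 2 * n ≤ n * n := Nat.mul_le_mul_right n hn
  have hnW : n * n + 2 * n + 1 ≤ W := by
    have : (n + 1) * (n + 1) = n * n + 2 * n + 1 := by ring
    omega
  have e2 : 2 % W = 2 := Nat.mod_eq_of_lt (by omega)
  unfold level
  refine Spec.seq (ε1 := 0) (ε2 := 0) (c1 := 10) (c2 := 100 * (n * sqrtCeil n) + 113 * n + 20)
    (P := fun s' => s' = s.setWord vTH 0 θ) (Spec.of_eff (by simp) (by simp) ?_) ?_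
  · simp [hθ, e2, WExpr.eval]
  rintro s1 rfl hF1
  have hs1 : Params D (s.setWord vTH 0 θ) := hs.frame hF1 (by simp)
  have hCV : ∀ (s' : State n) a v, a ≠ vCV → uncovered (s'.setWord a 0 v) = uncovered s' :=
    fun s' a v ha => uncovered_congr (by funext c; simp [Ne.symm ha])
  refine (spec_forLoop_sum (N := n) (δ := 0)
    (fun k s' => Progress Cv s s' i ∧
      s'.out.card * θ + (uncovered s').card ≤ s.out.card * θ + (uncovered s).card ∧
      ∀ x < k, (uncovered s' ∩ S x).card < θ) (fun k => 100 * (S k).card + 100) 0 ?_ (by omega)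
    (by simp) ?_ ?_ ?_ (by simp)).weaken le_rfl ?_ le_rfl
  · intro s' hF
    simpa [hF.word _ (show vN ∉ _ by simp)] using hs.n_eq
  · rw [hCV _ _ _ (by simp), hCV _ _ _ (by simp)]
    exact ⟨Progress.of_word_eq (by funext c; simp), by simp, fun x hx => by omega⟩
  · rintro k s' hk hF hx ⟨h1, h2, h3⟩
    have f1 : s'.word vI 0 = i := by rw [hF.word _ (by simp), word_setWord]; simpa using hi
    have f2 : s'.word vTH 0 = θ := by rw [hF.word _ (by simp), word_setWord]; simp
    have f3 : s'.word vDEG = s.word vDEG := by rw [hF.word _ (by simp)]; funext c; simp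
    have f4 : s'.word vINV = s.word vINV := by rw [hF.word _ (by simp)]; funext c; simp
    refine (spec_levelStep (Cv := Cv) (hs1.frame hF (by simp)) hW hn f1 hin hx hk f2
      ((hS k hk).congr f3 f4) (hSn k hk) (hSC k hk)).weaken le_rfl ?_ le_rfl
    rintro s'' hF'' ⟨h4, h5, h6⟩
    rw [hCV _ _ _ (by simp)]
    refine ⟨(h1.trans h4 hF''.out_subset).trans (Progress.of_word_eq (by funext c; simp)) (by simp),
      by simpa using h5.trans h2, fun x hx => ?_⟩
    rcases (show x < k ∨ x = k by omega) with hxk | rfl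
    · exact lt_of_le_of_lt (Finset.card_le_card
        (Finset.inter_subset_inter_right h4.subset)) (h3 x hxk)
    · exact h6 hθ0
  · simp only [cost_rd, Finset.sum_add_distrib, ← Finset.mul_sum, Finset.sum_const,
      Finset.card_range, smul_eq_mul]
    omega
  · rintro s' hF ⟨⟨h1, h2, h3⟩, -⟩
    refine ⟨h1, ?_, h2, h3⟩
    rw [hF.word _ (by simp), word_setWord]; simp

/-- The threshold is halved before its first use, so it runs through `2 ^ (Nat.size n - 1), …, 2,
1`. Before the level with threshold `θ` every list has fewer than `2 θ` uncovered points, hence at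
most `2 θ (|F| + w)` points are uncovered; each edge uses up `θ` of them, so the level outputs at
most `2 (|F| + w)` edges. After threshold `1` all lists are exhausted, and the same bound with `θ =
0` leaves no uncovered point. -/
theorem spec_greedy {s : State n} {i : ℕ} {F : Finset ℕ} (hs : Params D s)
    (hW : (n + 1) * (n + 1) ≤ W) (hn : 2 ≤ n) (hcov : CoverTest W d a cov Cv)
    (ha : s.real 0 0 = a) (hi : s.word vI 0 = i) (hin : i < n)
    (hlist : ∀ j < n, IsNearestList d s j) (hF : IsCover n Cv i F)
    (hcl : IsClosedTowards d Cv i) (hiu : i ∉ uncovered s) :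
    Spec W d (greedy cov) s (700 * (Nat.size n * (n * sqrtCeil n))) (fun s' =>
      Progress Cv s s' i ∧ uncovered s' = ∅ ∧
      s'.out.card ≤ s.out.card + 2 * (F.card + sqrtCeil n) * Nat.size n) 0 := by
  have hw0 := sqrtCeil_pos (n := n) (by omega)
  have hL := one_le_size hn
  have hLn := size_le_self n
  have hnw : n ≤ n * sqrtCeil n := Nat.le_mul_of_pos_right n hw0
  have hLnw : n * sqrtCeil n ≤ Nat.size n * (n * sqrtCeil n) := Nat.le_mul_of_pos_left _ hL
  have hLn' : Nat.size n * 2 ≤ Nat.size n * (n * sqrtCeil n) :=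
    Nat.mul_le_mul_left _ (hn.trans hnw)
  have hnn : 2 * n ≤ n * n := Nat.mul_le_mul_right n hn
  have hnW : n * n + 2 * n + 1 ≤ W := by
    have : (n + 1) * (n + 1) = n * n + 2 * n + 1 := by ring
    omega
  have hcl' : ∀ (s' : State n) a v, a ≠ vCV → uncovered (s'.setWord a 0 v) = uncovered s' :=
    fun s' a v ha => uncovered_congr (by funext c; simp [Ne.symm ha])
  unfold greedy
  refine Spec.seq (ε1 := 0) (ε2 := 0) (c2 := 350 * (Nat.size n * (n * sqrtCeil n)) + 20)
    (spec_fill hs hW hn hcov ha hi hlist) ?_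
  intro s1 hS1 hF1
  have hs1 : Params D s1 := hs.frame hF1 (by simp)
  refine Spec.seq (ε1 := 0) (ε2 := 0) (c1 := 5) (c2 := 350 * (Nat.size n * (n * sqrtCeil n)) + 12)
    (P := fun s' => s' = s1.setWord vTH 0 (2 ^ Nat.size n)) (Spec.of_eff (by simp) (by simp) ?_) ?_
  · simp [hs1.P_eq]
  rintro s2 rfl hF2
  have hs2 : Params D (s1.setWord vTH 0 (2 ^ Nat.size n)) := hs1.frame hF2 (by simp)
  have hu1 : uncovered s1 = uncovered s := uncovered_congr (hF1.word _ (by simp))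
  refine (spec_forLoop (N := Nat.size n) (δ := 0)
    (fun k s' => Progress Cv s s' i ∧ s'.word vTH 0 = 2 ^ (Nat.size n - k) ∧
      s'.out.card ≤ s.out.card + 2 * (F.card + sqrtCeil n) * k ∧
      ∀ x < n, (uncovered s' ∩ incidence Cv s i x).card < 2 ^ (Nat.size n - k))
    (300 * (n * sqrtCeil n)) 0 ?_ (by omega)
    (by simp) ?_ ?_ ?_ (by simp)).weaken le_rfl ?_ le_rfl
  · intro s' hF'
    simpa [hF'.word _ (show vL ∉ _ by simp)] using hs1.L_eq
  · rw [hcl' _ _ _ (by simp), hcl' _ _ _ (by simp), hu1]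
    refine ⟨Progress.of_word_eq ?_, by simp, ?_, fun x hx => ?_⟩
    · rw [← hF1.word vCV (by simp)]; funext c; simp
    · simp [hF1.out (by simp)]
    · refine lt_of_le_of_lt ((Finset.card_le_card Finset.inter_subset_left).trans
        (card_uncovered_le s)) ?_
      simpa using Nat.lt_size_self n
  · rintro k s' hk hF' - ⟨h1, h2, h3, h4⟩
    have hsz : Nat.size n - k = (Nat.size n - (k + 1)) + 1 := by omega
    set e := Nat.size n - (k + 1) with he
    rw [hsz, pow_succ, mul_comm] at h2 h4
    have f1 : s'.word vI 0 = i := by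
      rw [hF'.word _ (by simp), word_setWord]; simpa [hF1.word vI (by simp)] using hi
    have f3 : s'.word vDEG = s1.word vDEG := by rw [hF'.word _ (by simp)]; funext c; simp
    have f4 : s'.word vINV = s1.word vINV := by rw [hF'.word _ (by simp)]; funext c; simp
    refine (spec_level (Cv := Cv) (S := incidence Cv s i) (hs2.frame hF' (by simp)) hW hn f1 hin h2
      (by positivity) (fun x hx => (hS1 x hx).congr f3 f4) (fun x _ => incidence_subset s i x)
      (fun x _ j hj => (mem_incidence.mp hj).2.1) (sum_card_incidence_le s i)).weaken le_rfl ?_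
      le_rfl
    rintro s'' hF'' ⟨h5, h6, h7, h8⟩
    rw [hcl' _ _ _ (by simp)]
    refine ⟨(h1.trans h5 hF''.out_subset).trans (Progress.of_word_eq (by funext c; simp)) (by simp),
      by simpa using h6, ?_, h8⟩
    have h9 := card_uncovered_le_of_forall hn hF hcl hlist h1.subset (fun h => hiu (h1.subset h))
      (θ := 2 * 2 ^ e) (fun x hx => (h4 x hx).le)
    have h10 : s''.out.card ≤ s'.out.card + 2 * (F.card + sqrtCeil n) := by
      have hp : 0 < 2 ^ e := by positivity
      refine le_of_mul_le_mul_right (a := 2 ^ e) ?_ hp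
      calc s''.out.card * 2 ^ e ≤ s'.out.card * 2 ^ e + (uncovered s').card := by omega
        _ ≤ s'.out.card * 2 ^ e + 2 * 2 ^ e * (F.card + sqrtCeil n) := by omega
        _ = _ := by ring
    rw [out_setWord, mul_add, mul_one]
    omega
  · simp only [cost_rd]
    have : Nat.size n * (300 * (n * sqrtCeil n) + 2 + 11) =
      300 * (Nat.size n * (n * sqrtCeil n)) + 13 * Nat.size n := by ring
    omega
  · rintro s' - ⟨⟨h1, -, h3, h4⟩, -⟩
    refine ⟨h1, ?_, h3⟩
    rw [← Finset.card_eq_zero, ← Nat.le_zero]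
    have := card_uncovered_le_of_forall hn hF hcl hlist h1.subset (fun h => hiu (h1.subset h))
      (θ := 0) (fun x hx => by have := h4 x hx; simp at this; simp [this])
    simpa using this

end GreedySpec

/-! ## The out-neighbors of one point -/

/-- Declare all points other than `vI` uncovered. -/
def clear : Prog :=
  .seq (forLoop vJ (rd vN) (.wset vCV (rd vJ) (.lit 0))) (.wset vCV (rd vI) (.lit 1))

/-- Choose the out-neighbors of the point `vI`. -/
def coverPoint (cov : BExpr) : Prog :=
  .seq clear <| .seq (guesses cov) <| .seq buildList <|
    .ite (.wlt (.lit 0) (rd vU)) (greedy cov) .skip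

@[simp] theorem mods_clear : clear.mods = [vJ, vCV, vJ, vCV] := rfl
@[simp] theorem keepsReals_clear : clear.keepsReals = true := rfl
@[simp] theorem silent_clear : clear.silent = true := rfl
@[simp] theorem mods_coverPoint (cov : BExpr) : (coverPoint cov).mods =
    [vJ, vCV, vJ, vCV] ++ ((guesses cov).mods ++ ([vU, vJ, vUL, vU, vJ] ++
      ((greedy cov).mods ++ []))) := rfl
@[simp] theorem keepsReals_coverPoint (cov : BExpr) : (coverPoint cov).keepsReals = true := rfl

section CoverPoint

variable {n W D : ℕ} {d : Fin n → Fin n → ℝ} {a : ℝ} {cov : BExpr} {Cv : ℕ → ℕ → ℕ → Prop}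

theorem spec_clear {s : State n} {i : ℕ} (hs : Params D s) (hnW : n + 1 < W)
    (hi : s.word vI 0 = i) :
    Spec W d clear s (20 * n + 20) (fun s' => ∀ j, j ∈ uncovered s' ↔ j < n ∧ j ≠ i) 0 := by
  have e1 : 1 % W = 1 := Nat.mod_eq_of_lt (by omega)
  unfold clear
  refine Spec.seq (ε1 := 0) (ε2 := 0) (c1 := 20 * n + 10) (c2 := 5)
    (P := fun s' => ∀ j < n, s'.word vCV j = 0) ?_ ?_
  · refine (spec_forLoop (N := n) (C := 20 * n + 10) (δ := 0)
      (fun k s' => ∀ j < k, s'.word vCV j = 0) 4 0 ?_ (by omega) (by simp) (by simp) ?_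
      ?_ (by simp)).weaken le_rfl (fun s' _ h => h.1) le_rfl
    · intro s' hF
      simp [hF.word _ (show vN ∉ _ by simp), hs.n_eq]
    · intro k s' hk hF hx hI
      refine Spec.of_eff (by simp) (by simp) ?_
      simp [hx]
      intro x hxk
      exact fun h => hI x (by omega)
    · simp only [cost_rd]; omega
  intro s1 h1 hF1
  have hi1 : s1.word vI 0 = i := by rw [hF1.word _ (by simp), hi]
  refine Spec.of_eff (by simp) (by simp) fun j => ?_
  simp only [mem_uncovered, Prog.eff, WExpr.eval, eval_rd, hi1, e1, word_setWord, true_and]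
  refine and_congr_right fun hj => ?_
  by_cases hji : j = i
  · simp [hji]
  · simp [hji, h1 j hj]

/-- The greedy algorithm runs only if `w < 4 |F|`. Then `w ≤ 4 min(|F|, w)` pays for its time, and
its output `2 (|F| + w) L ≤ 10 L |F|` raises the constant from `192` to `202`. -/
theorem spec_coverPoint {s : State n} {i m : ℕ} {F : Finset ℕ} (hn : 2 ≤ n) (hs : Params D s)
    (hW : (n + 1) * (n + 1) ≤ W) (hcov : CoverTest W d a cov Cv) (ha : s.real 0 0 = a)
    (hi : s.word vI 0 = i) (hin : i < n) (hm : m = D * Nat.size n) (hm0 : 0 < m)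
    (hNW : 4 * m * n + 4 < W) (hlist : ∀ j < n, IsNearestList d s j)
    (hF : IsCover n Cv i F) (hF0 : 0 < F.card) (hcl : IsClosedTowards d Cv i) :
    Spec W d (coverPoint cov) s (80000 * (Nat.size n * (n * m)) * min F.card (sqrtCeil n))
      (fun s' => (∀ j < n, j ≠ i → Handled Cv s' i j) ∧
        s'.out.card ≤ s.out.card + 202 * Nat.size n * F.card)
      (Nat.size n * (Nat.size n * (n * (1 / 2) ^ m))) := by
  have hL := one_le_size hn
  have hw0 := sqrtCeil_pos (n := n) (by omega)
  have hnn : 2 * n ≤ n * n := Nat.mul_le_mul_right n hn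
  have hnW : n * n + 2 * n + 1 ≤ W := by
    have : (n + 1) * (n + 1) = n * n + 2 * n + 1 := by ring
    omega
  set L := Nat.size n with hLdef
  set w := sqrtCeil n with hwdef
  set M := min F.card w with hM
  have hM0 : 1 ≤ M := le_min hF0 hw0
  have hX : n ≤ L * (n * m) * M := by
    calc n ≤ n * m := Nat.le_mul_of_pos_right _ hm0
      _ ≤ L * (n * m) := Nat.le_mul_of_pos_left _ hL
      _ ≤ _ := Nat.le_mul_of_pos_right _ hM0
  have e70 : 70000 * (L * (n * m)) * M = 70000 * (L * (n * m) * M) := by ring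
  have e80 : 80000 * (L * (n * m)) * M = 80000 * (L * (n * m) * M) := by ring
  set ε := (L : ℝ≥0∞) * (L * (n * (1 / 2) ^ m)) with hε
  unfold coverPoint
  refine Spec.seq (ε1 := 0) (ε2 := ε) (c2 := 75000 * (L * (n * m) * M))
    (spec_clear hs (by omega) hi) ?_
  intro s1 hu1 hF1
  have hs1 : Params D s1 := hs.frame hF1 (by simp)
  have hi1 : s1.word vI 0 = i := by rw [hF1.word _ (by simp), hi]
  have ha1 : s1.real 0 0 = a := by rw [hF1.real (by simp), ha]
  have hout1 : s1.out = s.out := hF1.out (by simp)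
  have hiu1 : i ∉ uncovered s1 := fun h => ((hu1 i).mp h).2 rfl
  have hguess := spec_guesses hn hs1 hW hcov ha1 hi1 hin hm hm0 hNW hF hF0 hiu1
  simp only [← hLdef, ← hwdef, ← hM] at hguess
  refine Spec.seq (ε1 := ε) (ε2 := 0) (c2 := 4000 * (L * (n * m) * M)) hguess ?_
  rintro s2 ⟨hP2, hout2, hw2⟩ hF2
  have hs2 : Params D s2 := hs1.frame hF2 (by simp)
  refine Spec.seq (ε1 := 0) (ε2 := 0) (c2 := 3000 * (L * (n * m) * M))
    (spec_buildList hs2 (by omega)) ?_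
  intro s3 hU3 hF3
  have hs3 : Params D s3 := hs2.frame hF3 (by simp)
  have hu3 : uncovered s3 = uncovered s2 := uncovered_congr (hF3.word _ (by simp))
  have hout3 : s3.out = s2.out := hF3.out (by simp)
  have hP3 : Progress Cv s1 s3 i :=
    hP2.trans (Progress.of_word_eq (hF3.word _ (by simp))) hF3.out_subset
  have hfin : ∀ s' : State n, Progress Cv s1 s' i → uncovered s' = ∅ →
      ∀ j < n, j ≠ i → Handled Cv s' i j := by
    intro s' hP hu j hj hji
    rcases hP.handled j ((hu1 j).mpr ⟨hj, hji⟩) with h | h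
    · simp [hu] at h
    · exact h
  refine Spec.ite (c1 := 2900 * (L * (n * m) * M)) (fun h => ?_) (fun h => ?_) (by simp; omega)
  · simp only [BExpr.Holds, WExpr.eval, Nat.zero_mod, eval_rd, hU3.card] at h
    have hne := Finset.nonempty_iff_ne_empty.mp (Finset.card_pos.mp h)
    have hw4 := hw2 hne
    have hwM : w ≤ 4 * M := by omega
    have hlist3 : ∀ j < n, IsNearestList d s3 j := fun j hj => (hlist j hj).congr
      fun r _ => by
        unfold nb
        rw [hF3.word _ (by simp), hF2.word _ (by simp), hF1.word _ (by simp)]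
    have hgreedy := spec_greedy hs3 hW hn hcov
      (by rw [hF3.real (by simp), hF2.real (by simp), ha1])
      (by rw [hF3.word _ (by simp), hF2.word _ (by simp), hi1]) hin hlist3 hF hcl
      (fun h => hiu1 (hP3.subset h))
    simp only [← hLdef, ← hwdef] at hgreedy
    refine hgreedy.weaken ?_ ?_ le_rfl
    · have h1 : L * (n * w) ≤ L * (n * (4 * M)) :=
        Nat.mul_le_mul_left _ (Nat.mul_le_mul_left _ hwM)
      have h2 : L * (n * (4 * M)) = 4 * (L * (n * 1) * M) := by ring
      have h3 : L * (n * 1) * M ≤ L * (n * m) * M :=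
        Nat.mul_le_mul_right _ (Nat.mul_le_mul_left _ (Nat.mul_le_mul_left _ hm0))
      omega
    · rintro s4 hF4 ⟨h1, h2, h3⟩
      refine ⟨hfin s4 (hP3.trans h1 hF4.out_subset) h2, ?_⟩
      have h4 : 2 * (F.card + w) * L ≤ 2 * (F.card + 4 * F.card) * L :=
        Nat.mul_le_mul_right _ (by omega)
      have h5 : 2 * (F.card + 4 * F.card) * L = 10 * (L * F.card) := by ring
      have h6 : 192 * L * F.card = 192 * (L * F.card) := by ring
      have h7 : 202 * L * F.card = 202 * (L * F.card) := by ring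
      rw [hout3] at h3
      rw [hout1] at hout2
      omega
  · simp only [BExpr.Holds, WExpr.eval, Nat.zero_mod, eval_rd, hU3.card, not_lt, Nat.le_zero,
      Finset.card_eq_zero] at h
    refine Spec.of_eff (by simp) (by simp; omega) ?_
    refine ⟨hfin s3 hP3 (by rw [hu3, h]), ?_⟩
    have h6 : 192 * L * F.card ≤ 202 * L * F.card :=
      Nat.mul_le_mul_right _ (Nat.mul_le_mul_right _ (by norm_num))
    simp only [Prog.eff]
    rw [hout3]
    rw [hout1] at hout2
    omega

end CoverPoint

/-! ## The algorithm -/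

/-- Choose the out-neighbors of all points. -/
def buildGraph (D : ℕ) (cov : BExpr) : Prog :=
  .seq (parameters D) <| .seq nearestLists (forLoop vI (rd vN) (coverPoint cov))

@[simp] theorem mods_parameters (D : ℕ) : (parameters D).mods =
    [vL, vP, vT, vP, vL, vT, vW, vT, vW, vT, vM] := rfl

section BuildGraph

variable {n W D : ℕ} {d : Fin n → Fin n → ℝ} {a : ℝ} {cov : BExpr} {Cv : ℕ → ℕ → ℕ → Prop}

theorem spec_buildGraph {s : State n} {F : ℕ → Finset ℕ} (hn : 2 ≤ n) (hs : s.word vN 0 = n)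
    (hW : (n + 1) * (n + 1) ≤ W) (hD0 : 0 < D) (hNW : 4 * (D * Nat.size n) * n + 4 < W)
    (hcov : CoverTest W d a cov Cv) (ha : s.real 0 0 = a)
    (hF : ∀ i < n, IsCover n Cv i (F i)) (hF0 : ∀ i < n, 0 < (F i).card)
    (hcl : ∀ i < n, IsClosedTowards d Cv i) :
    Spec W d (buildGraph D cov) s
      (90000 * (Nat.size n * (n * (D * Nat.size n))) *
        ∑ i ∈ Finset.range n, min (F i).card (sqrtCeil n))
      (fun s' => (∀ i < n, ∀ j < n, j ≠ i → Handled Cv s' i j) ∧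
        s'.out.card ≤ s.out.card + 202 * Nat.size n * ∑ i ∈ Finset.range n, (F i).card)
      (n * (Nat.size n * (Nat.size n * (n * (1 / 2) ^ (D * Nat.size n))))) := by
  have hL := one_le_size hn
  have hw0 := sqrtCeil_pos (n := n) (by omega)
  have hnn : 2 * n ≤ n * n := Nat.mul_le_mul_right n hn
  have hnW : n * n + 2 * n + 1 ≤ W := by
    have : (n + 1) * (n + 1) = n * n + 2 * n + 1 := by ring
    omega
  have hm0 : 0 < D * Nat.size n := Nat.mul_pos hD0 hL
  have hDn : D * n ≤ 4 * (D * Nat.size n) * n :=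
    Nat.mul_le_mul_right _ ((Nat.le_mul_of_pos_right D hL).trans (by omega))
  have hDn' : D ≤ D * n := Nat.le_mul_of_pos_right D (by omega)
  set T := ∑ i ∈ Finset.range n, min (F i).card (sqrtCeil n) with hT₀
  -- Every source needs an edge; therefore the preprocessing time `O(n²)` is absorbed by the main
  -- term.
  have hnT : n ≤ T := by
    calc n = ∑ _i ∈ Finset.range n, 1 := by simp
      _ ≤ T := Finset.sum_le_sum fun i hi => le_min (hF0 i (Finset.mem_range.mp hi)) hw0
  set Y := Nat.size n * (n * (D * Nat.size n)) with hY
  have hnY : n ≤ Y :=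
    (Nat.le_mul_of_pos_right n hm0).trans (Nat.le_mul_of_pos_left _ hL)
  have hnnY : n * n ≤ Y * T := Nat.mul_le_mul hnY hnT
  have e90 : 90000 * Y * T = 90000 * (Y * T) := by ring
  set ε := (n : ℝ≥0∞) * (Nat.size n * (Nat.size n * (n * (1 / 2) ^ (D * Nat.size n)))) with hε
  rw [e90]
  unfold buildGraph
  refine Spec.seq (ε1 := 0) (ε2 := ε) (c2 := 89000 * (Y * T))
    (spec_parameters hn hs hW (by omega) (by omega)) ?_
  rintro s1 ⟨h1, h2, h3, h4⟩ hF1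
  have hs1 : Params D s1 := ⟨by rw [hF1.word _ (by simp), hs], h1, h2, h3, h4⟩
  refine Spec.seq (ε1 := 0) (ε2 := ε) (c2 := 84000 * (Y * T))
    (spec_nearestLists hn hs1 hW) ?_
  intro s2 hlist hF2
  have hs2 : Params D s2 := hs1.frame hF2 (by decide)
  have hout : s2.out = s.out := by rw [hF2.out rfl, hF1.out rfl]
  refine (spec_forLoop_sum (N := n) (δ := ε)
    (fun k s' => (∀ i < k, ∀ j < n, j ≠ i → Handled Cv s' i j) ∧
      s'.out.card ≤ s.out.card + 202 * Nat.size n * ∑ i ∈ Finset.range k, (F i).card)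
    (fun k => 80000 * Y * min (F k).card (sqrtCeil n)) _ ?_ (by omega) (by simp) ?_ ?_ ?_
    le_rfl).weaken le_rfl (fun s' _ h => h.1) le_rfl
  · intro s' hF'
    simp [hF'.word _ (show vN ∉ _ by simp), hs2.n_eq]
  · exact ⟨fun i hi => by omega, by simp [hout]⟩
  · rintro k s' hk hF' hI ⟨h5, h6⟩
    refine (spec_coverPoint (m := D * Nat.size n) hn (hs2.frame hF' (by simp)) hW hcov ?_ hI hk rfl
      hm0 hNW (fun j hj => (hlist j hj).congr fun r _ => ?_) (hF k hk) (hF0 k hk)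
      (hcl k hk)).weaken le_rfl ?_ le_rfl
    · rw [hF'.real (by simp), hF2.real rfl, hF1.real rfl, ha]
    · unfold nb
      rw [hF'.word _ (by simp)]
    · rintro s'' hF'' ⟨h7, h8⟩
      refine ⟨fun i hi j hj hji => ?_, ?_⟩
      · rcases (show i < k ∨ i = k by omega) with hik | rfl
        · exact (h5 i hik j hj hji).mono (by simpa using hF''.out_subset)
        · exact (h7 j hj hji).mono (by simp)
      · rw [out_setWord, Finset.sum_range_succ, mul_add]
        omega
  · simp only [cost_rd, Finset.sum_add_distrib, ← Finset.mul_sum, ← hT₀, Finset.sum_const,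
      Finset.card_range, smul_eq_mul]
    have : 80000 * Y * T = 80000 * (Y * T) := by ring
    omega

/-- Every outcome is a success or has error `1`, so the success probability and the expected error
add up to at least `1`. Recursion depth `c` is enough to witness the supremum. -/
theorem one_sub_le_successProb {A : Algorithm} {c : ℕ} {Q : State n → Prop} {ε : ℝ≥0∞} {T : ℝ}
    {good : Finset (Fin n × Fin n) → Prop}
    (h : Spec (2 ^ (A.wordFactor * Nat.size n)) d A.code
      (State.init n (2 ^ (A.wordFactor * Nat.size n)) a) c Q ε)
    (hT : (c : ℝ) ≤ T) (hQ : ∀ s, Q s → good s.out) : 1 - ε ≤ A.successProb d a T good := by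
  set W := 2 ^ (A.wordFactor * Nat.size n) with hW
  unfold Algorithm.successProb
  refine le_iSup_of_le c ?_
  rw [← hW]
  set μ := exec W d c A.code (State.init n W a) with hμ
  set G : Set (Outcome n) := {o | ∃ (t : ℕ) (s : State n), o = some (t, s) ∧ (t : ℝ) ≤ T ∧
    good s.out} with hG
  have h1 := h c le_rfl c le_rfl
  rw [tsub_le_iff_right, PMF.toOuterMeasure_apply]
  calc (1 : ℝ≥0∞) = ∑' o, μ o := μ.tsum_coe.symm
    _ ≤ ∑' o, (G.indicator μ o + μ o * outcomeError c
          (fun b' s' => failure (c ≤ b' + c ∧ Q s')) o) := by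
        refine ENNReal.tsum_le_tsum fun o => ?_
        by_cases ho : o ∈ G
        · rw [Set.indicator_of_mem ho]; exact le_self_add
        · rw [Set.indicator_of_notMem ho, zero_add]
          have : outcomeError c (fun b' s' => failure (c ≤ b' + c ∧ Q s')) o = 1 := by
            rcases o with _ | ⟨t, s'⟩
            · rfl
            · simp only [outcomeError]
              split_ifs with ht
              · rw [failure, if_neg, min_self]
                rintro ⟨-, hq⟩
                exact ho ⟨t, s', rfl, le_trans (by exact_mod_cast ht) hT, hQ s' hq⟩
              · rfl
          rw [this, mul_one]
    _ = ∑' o, G.indicator μ o + expect μ (outcomeError c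
          (fun b' s' => failure (c ≤ b' + c ∧ Q s'))) := ENNReal.tsum_add
    _ ≤ _ := by gcongr

end BuildGraph

/-! ## Numerical estimates -/

/-- From `2 ^ (Nat.size n - 1) ≤ n` follows `Nat.size n * log 2 ≤ 2 log n`, and `2 / log 2 < 3`. -/
theorem size_le_log {n : ℕ} (hn : 2 ≤ n) : (Nat.size n : ℝ) ≤ 3 * Real.log n := by
  have hn' : (0 : ℝ) < n := by positivity
  have h2 : Real.log 2 ≤ Real.log n := Real.log_le_log (by norm_num) (by exact_mod_cast hn)
  have h3 := Real.log_two_gt_d9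
  have h1 : 2 ^ (Nat.size n - 1) ≤ n :=
    Nat.lt_size.mp (Nat.sub_lt (Nat.size_pos.mpr (by omega)) one_pos)
  have h4 : ((Nat.size n - 1 : ℕ) : ℝ) * Real.log 2 ≤ Real.log n := by
    rw [← Real.log_pow]
    exact Real.log_le_log (by positivity) (by exact_mod_cast h1)
  rw [Nat.cast_sub (Nat.size_pos.mpr (by omega)), Nat.cast_one] at h4
  have h5 : (Nat.size n : ℝ) * Real.log 2 ≤ 2 * Real.log n := by linarith
  have h6 : (0 : ℝ) ≤ Nat.size n := Nat.cast_nonneg _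
  nlinarith

theorem sq_le_rpow {n : ℕ} (hn : 2 ≤ n) : (n : ℝ) ^ 2 ≤ (n : ℝ) ^ (5 / 2 : ℝ) := by
  rw [← Real.rpow_natCast]
  exact Real.rpow_le_rpow_of_exponent_le (by exact_mod_cast (by omega : 1 ≤ n)) (by norm_num)

theorem sq_mul_sqrtCeil_le {n : ℕ} (hn : 2 ≤ n) :
    (n : ℝ) ^ 2 * sqrtCeil n ≤ 2 * (n : ℝ) ^ (5 / 2 : ℝ) := by
  have hn' : (0 : ℝ) ≤ n := Nat.cast_nonneg n
  have h1 : (n : ℝ) ^ (5 / 2 : ℝ) = (n : ℝ) ^ 2 * Real.sqrt n := by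
    rw [Real.sqrt_eq_rpow, ← Real.rpow_natCast, ← Real.rpow_add (by positivity)]
    norm_num
  have h2 : (sqrtCeil n : ℝ) ≤ 2 * Real.sqrt n := by
    refine abs_le_of_sq_le_sq' ?_ (by positivity) |>.2
    rw [mul_pow, Real.sq_sqrt hn']
    have : ((sqrtCeil n * sqrtCeil n : ℕ) : ℝ) ≤ ((4 * n : ℕ) : ℝ) := by
      exact_mod_cast sqrtCeil_mul_le hn
    push_cast at this
    nlinarith
  rw [h1]
  nlinarith [sq_nonneg (n : ℝ)]

/-- `S` stands for `∑ min(k_i, w)`. Being at most `opt` and at most `n w`, it satisfies `n S ≤ 2 m`.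
The two factors `Nat.size n`, one from the passes and one from the sample size combined with the
number of hits, become `(log m)²`; hence `κ = 2`. -/
theorem cost_le_timeBound {n D opt S : ℕ} (hn : 2 ≤ n) (hopt : n ≤ opt) (hS : S ≤ opt)
    (hS' : S ≤ n * sqrtCeil n) :
    ((90000 * (Nat.size n * (n * (D * Nat.size n))) * S : ℕ) : ℝ) ≤
      500000 * D * timeBound 2 n opt := by
  have hn1 : (1 : ℝ) ≤ n := by exact_mod_cast (by omega : 1 ≤ n)
  unfold timeBound
  set m := min ((n : ℝ) ^ (5 / 2 : ℝ)) ((n : ℝ) * (opt : ℝ)) with hm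
  -- Since `n ≤ opt`, both terms of the minimum are at least `n²`, so `log n ≤ log m / 2`.
  have hmn : (n : ℝ) ^ 2 ≤ m := by
    refine le_min (sq_le_rpow hn) ?_
    rw [pow_two]
    gcongr
  have h1 : (n : ℝ) * S ≤ 2 * m := by
    have h6 : (n : ℝ) * S ≤ n * opt := by gcongr
    have h7 : (S : ℝ) ≤ n * sqrtCeil n := by exact_mod_cast hS'
    have h8 : (n : ℝ) * S ≤ n * (n * sqrtCeil n) := by gcongr
    have h9 := sq_mul_sqrtCeil_le hn
    have h10 : (0 : ℝ) ≤ n * S := by positivity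
    have h11 : (n : ℝ) * S / 2 ≤ m := le_min (by nlinarith) (by linarith)
    linarith
  have h2 : 2 * Real.log n ≤ Real.log m := by
    have := Real.log_le_log (by positivity) hmn
    rwa [Real.log_pow, Nat.cast_ofNat] at this
  have h3 := size_le_log hn
  have hlog : 0 ≤ Real.log n := Real.log_nonneg hn1
  have h4 : (Nat.size n : ℝ) ≤ 3 / 2 * Real.log m := by linarith
  have h5 : (Nat.size n : ℝ) ^ 2 ≤ 9 / 4 * Real.log m ^ 2 := by
    calc (Nat.size n : ℝ) ^ 2 ≤ (3 / 2 * Real.log m) ^ 2 := by gcongr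
      _ = _ := by ring
  have hm0 : 0 ≤ m := le_trans (by positivity) hmn
  push_cast
  calc 90000 * ((Nat.size n : ℝ) * (n * (D * Nat.size n))) * S
      = 90000 * D * (n * S) * (Nat.size n : ℝ) ^ 2 := by ring
    _ ≤ 90000 * D * (2 * m) * (9 / 4 * Real.log m ^ 2) := by gcongr
    _ = 405000 * (D * (m * Real.log m ^ 2)) := by ring
    _ ≤ 500000 * (D * (m * Real.log m ^ 2)) := by gcongr; norm_num
    _ = _ := by ring

/-- A union bound over `n` sources, `Nat.size n` guesses, `Nat.size n` passes and `n` candidates.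
These four factors are at most `n` each, and the exponent `C + 4` compensates for them because `2 ^
(-Nat.size n) ≤ 1 / n`. -/
theorem error_le {n C : ℕ} (hn : 2 ≤ n) :
    (n : ℝ≥0∞) * (Nat.size n * (Nat.size n * (n * (1 / 2) ^ ((C + 4) * Nat.size n)))) ≤
      1 / (n : ℝ≥0∞) ^ C := by
  have hn0 : (n : ℝ≥0∞) ≠ 0 := by exact_mod_cast (by omega : n ≠ 0)
  have hnt : (n : ℝ≥0∞) ≠ ⊤ := ENNReal.natCast_ne_top n
  have h1 : (1 / 2 : ℝ≥0∞) ^ ((C + 4) * Nat.size n) ≤ ((n : ℝ≥0∞)⁻¹) ^ (C + 4) := by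
    rw [mul_comm, pow_mul]
    gcongr
    rw [one_div, ← ENNReal.inv_pow, ENNReal.inv_le_inv]
    exact_mod_cast (Nat.lt_size_self n).le
  have h2 : (Nat.size n : ℝ≥0∞) ≤ n := by exact_mod_cast size_le_self n
  calc _ ≤ (n : ℝ≥0∞) * (n * (n * (n * ((n : ℝ≥0∞)⁻¹) ^ (C + 4)))) := by gcongr
    _ = ((n : ℝ≥0∞) * (n : ℝ≥0∞)⁻¹) ^ 4 * ((n : ℝ≥0∞)⁻¹) ^ C := by ring
    _ = 1 / (n : ℝ≥0∞) ^ C := by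
        rw [ENNReal.mul_inv_cancel hn0 hnt, one_pow, one_mul, one_div, ENNReal.inv_pow]

/-- Words must hold table addresses and the number of samples `4 m g` for `g ≤ n`. A factor `2 ^ D`
of `W` takes care of `D`, and four factors `2 ^ Nat.size n > n` of the powers of `n`. -/
theorem word_bounds {n D W : ℕ} (hn : 2 ≤ n) (hW : W = 2 ^ ((D + 4) * Nat.size n)) :
    (n + 1) * (n + 1) ≤ W ∧ 4 * (D * Nat.size n) * n + 4 < W := by
  have h1 : n + 1 ≤ 2 ^ Nat.size n := Nat.lt_size_self n
  have h2 : (D + 1) * ((n + 1) * (n + 1) * ((n + 1) * (n + 1))) ≤ W := by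
    rw [hW, mul_comm (D + 4), pow_mul, pow_add]
    refine Nat.mul_le_mul ?_ ?_
    · calc D + 1 ≤ 2 ^ D := Nat.lt_two_pow_self
        _ ≤ _ := Nat.pow_le_pow_left (by omega) D
    · calc (n + 1) * (n + 1) * ((n + 1) * (n + 1)) = (n + 1) ^ 4 := by ring
        _ ≤ _ := Nat.pow_le_pow_left h1 4
  have h3 : 9 ≤ (n + 1) * (n + 1) := Nat.mul_le_mul (by omega : 3 ≤ n + 1) (by omega : 3 ≤ n + 1)
  have h4 : (D + 1) * ((n + 1) * (n + 1) * 9) ≤ W :=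
    (Nat.mul_le_mul_left _ (Nat.mul_le_mul_left _ h3)).trans h2
  have h5 : (D + 1) * ((n + 1) * (n + 1) * 9) =
      9 * (D * ((n + 1) * (n + 1))) + 9 * ((n + 1) * (n + 1)) := by ring
  have h6 : D * (Nat.size n * n) ≤ D * ((n + 1) * (n + 1)) :=
    Nat.mul_le_mul_left _ (Nat.mul_le_mul ((size_le_self n).trans (by omega)) (by omega))
  have h7 : 4 * (D * Nat.size n) * n = 4 * (D * (Nat.size n * n)) := by ring
  exact ⟨by omega, by omega⟩

/-! ### From covers of the points to approximately optimal graphs -/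

section Approximation

variable {n : ℕ}

/-- The out-neighbors of `i` in the graph with edge set `E`. -/
def outNeighbors (E : Finset (Fin n × Fin n)) (i : ℕ) : Finset ℕ :=
  (E.filter fun e => (e.1 : ℕ) = i).image fun e => (e.2 : ℕ)

theorem sum_card_outNeighbors_le (E : Finset (Fin n × Fin n)) :
    ∑ i ∈ Finset.range n, (outNeighbors E i).card ≤ E.card := by
  rw [Finset.card_eq_sum_card_fiberwise (f := fun e : Fin n × Fin n => (e.1 : ℕ))
    (t := Finset.range n) (fun e _ => by simp)]
  exact Finset.sum_le_sum fun i _ => Finset.card_image_le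

theorem isCover_outNeighbors {Cv : ℕ → ℕ → ℕ → Prop} {E : Finset (Fin n × Fin n)}
    (h : ∀ i j : Fin n, i ≠ j → ∃ k : Fin n, (i, k) ∈ E ∧ Cv i k j) {i : ℕ} (hi : i < n) :
    IsCover n Cv i (outNeighbors E i) := by
  constructor
  · intro x hx
    obtain ⟨e, -, rfl⟩ := Finset.mem_image.mp hx
    exact e.2.isLt
  · intro j hj hji
    obtain ⟨k, hk, hC⟩ := h ⟨i, hi⟩ ⟨j, hj⟩ (fun h => hji (congrArg Fin.val h).symm)
    exact ⟨k, Finset.mem_image.mpr ⟨_, Finset.mem_filter.mpr ⟨hk, rfl⟩, rfl⟩, hC⟩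

theorem exists_card_eq_minEdges {good : Finset (Fin n × Fin n) → Prop}
    (h : good Finset.univ) : ∃ E, good E ∧ E.card = minEdges good :=
  Nat.sInf_mem (s := {m | ∃ E, good E ∧ E.card = m}) ⟨_, _, h, rfl⟩

/-- The algorithm for the test `cov`, with failure probability at most `1 / n ^ C`. -/
def approximation (cov : BExpr) (C : ℕ) : Algorithm where
  code := buildGraph (C + 4) cov
  wordFactor := C + 4 + 4

/-- The covers `F i` in the analysis are the out-neighborhoods of an optimal graph; the algorithm
does not know them. The constant `606 = 3 * 202` comes from `size_le_log`. -/
theorem successProb_approximation {d : Fin n → Fin n → ℝ} {a : ℝ} {cov : BExpr}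
    {Cv : ℕ → ℕ → ℕ → Prop} {good : Finset (Fin n × Fin n) → Prop} (C : ℕ) (hn : 2 ≤ n)
    (hcov : ∀ W, CoverTest W d a cov Cv) (hcl : ∀ i < n, IsClosedTowards d Cv i)
    (hself : ∀ i j : Fin n, i ≠ j → Cv i j j)
    (hgood : ∀ E, good E ↔ ∀ i j : Fin n, i ≠ j → ∃ k : Fin n, (i, k) ∈ E ∧ Cv i k j) :
    1 - 1 / (n : ℝ≥0∞) ^ C ≤ (approximation cov C).successProb d a
      (500000 * (C + 4 : ℕ) * timeBound 2 n (minEdges good))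
      (fun E => good E ∧ (E.card : ℝ) ≤ 606 * Real.log n * (minEdges good : ℝ)) := by
  -- By `hself` the complete graph is good, so the minimum is attained and is not the default value
  -- of an infimum over the empty set.
  obtain ⟨E, hE, hEc⟩ := exists_card_eq_minEdges (good := good)
    ((hgood _).mpr fun i j hij => ⟨j, Finset.mem_univ _, hself i j hij⟩)
  have hF : ∀ i < n, IsCover n Cv i (outNeighbors E i) := fun i hi =>
    isCover_outNeighbors ((hgood E).mp hE) hi
  have hF0 : ∀ i < n, 0 < (outNeighbors E i).card := by
    intro i hi
    obtain ⟨j, hj, hji⟩ : ∃ j < n, j ≠ i := by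
      rcases Nat.eq_zero_or_pos i with rfl | h
      · exact ⟨1, by omega, by omega⟩
      · exact ⟨0, by omega, by omega⟩
    obtain ⟨x, hx, -⟩ := (hF i hi).exists_mem j hj hji
    exact Finset.card_pos.mpr ⟨x, hx⟩
  have hsum : ∑ i ∈ Finset.range n, (outNeighbors E i).card ≤ minEdges good :=
    hEc ▸ sum_card_outNeighbors_le E
  have hopt : n ≤ minEdges good := by
    calc n = ∑ _i ∈ Finset.range n, 1 := by simp
      _ ≤ ∑ i ∈ Finset.range n, (outNeighbors E i).card :=
        Finset.sum_le_sum fun i hi => hF0 i (Finset.mem_range.mp hi)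
      _ ≤ _ := hsum
  obtain ⟨hW, hNW⟩ := word_bounds (D := C + 4) hn rfl
  have hinit : (State.init n (2 ^ ((approximation cov C).wordFactor * Nat.size n)) a).word vN 0 =
      n := by
    have hn' : n ≤ (n + 1) * (n + 1) := by nlinarith
    have : n < 2 ^ ((C + 4 + 4) * Nat.size n) := by
      have : (n + 1) * (n + 1) = n * n + 2 * n + 1 := by ring
      omega
    simp [State.init, approximation, Nat.mod_eq_of_lt this]
  refine le_trans (tsub_le_tsub_left (error_le hn) 1) (one_sub_le_successProb
    (spec_buildGraph hn hinit hW (by omega) hNW (hcov _) (by simp [State.init]) hF hF0 hcl) ?_ ?_)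
  · refine cost_le_timeBound hn hopt (le_trans ?_ hsum) ?_
    · exact Finset.sum_le_sum fun i _ => min_le_left _ _
    · simpa using Finset.sum_le_sum fun i (_ : i ∈ Finset.range n) =>
        min_le_right (outNeighbors E i).card (sqrtCeil n)
  · rintro s ⟨h1, h2⟩
    constructor
    · refine (hgood _).mpr fun i j hij => ?_
      obtain ⟨x, hx, ⟨_, _, hm⟩, hC⟩ := h1 i i.isLt j j.isLt (fun h => hij (Fin.ext h.symm))
      exact ⟨⟨x, hx⟩, hm, hC⟩
    · have h3 : s.out.card ≤ 202 * Nat.size n * minEdges good :=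
        h2.trans (by simpa [State.init] using Nat.mul_le_mul_left _ hsum)
      have h4 : (s.out.card : ℝ) ≤ 202 * Nat.size n * minEdges good := by exact_mod_cast h3
      refine h4.trans ?_
      have h5 : 202 * (Nat.size n : ℝ) ≤ 606 * Real.log n := by linarith [size_le_log hn]
      gcongr

theorem natDist_coe (d : Fin n → Fin n → ℝ) (i j : Fin n) : natDist d i j = d i j := by
  simp [natDist]

/-- The test for shortcut reachability; the parameter is in cell `0` of real array `0`. -/
def shortcutTest : BExpr :=
  .rlt (.dist (rd vX) (rd vJ))
    (.mul (.div (.lit 1) (.read 0 (.lit 0))) (.dist (rd vI) (rd vJ)))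

/-- The test for monotonicity; the parameter is in cell `0` of real array `0`. -/
def monotonicTest : BExpr :=
  -- A disjunction, expressed by `neg` and `conj`.
  .neg (.conj (.neg (.weq (rd vX) (rd vJ)))
    (.neg (.rlt (.dist (rd vX) (rd vJ)) (.sub (.dist (rd vI) (rd vJ)) (.read 0 (.lit 0))))))

theorem coverTest_shortcutTest (W : ℕ) (d : Fin n → Fin n → ℝ) (α : ℝ) :
    CoverTest W d α shortcutTest
      (fun i x j => natDist d x j < (1 / α) * natDist d i j) := by
  refine ⟨by simp [shortcutTest, BExpr.cost, RExpr.cost, WExpr.cost], fun s hs => ?_⟩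
  simp only [shortcutTest, BExpr.Holds, RExpr.eval, WExpr.eval, eval_rd, hs, Nat.zero_mod,
    Nat.cast_one]
  rfl

theorem coverTest_monotonicTest (W : ℕ) (d : Fin n → Fin n → ℝ) (τ : ℝ) :
    CoverTest W d τ monotonicTest
      (fun i x j => x = j ∨ natDist d x j < natDist d i j - τ) := by
  refine ⟨by simp [monotonicTest, BExpr.cost, RExpr.cost, WExpr.cost], fun s hs => ?_⟩
  simp only [monotonicTest, BExpr.Holds, RExpr.eval, WExpr.eval, eval_rd, hs, Nat.zero_mod]
  unfold natDist
  tauto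

end Approximation

end SearchGraph

theorem corollary4 :
    ∃ (c : ℝ) (κ : ℕ),
      (∀ C : ℕ, ∃ (A : Algorithm) (K : ℝ),
        ∀ (n : ℕ) (_ : 2 ≤ n) (d : Fin n → Fin n → ℝ) (_ : IsDistance d) (α : ℝ) (_ : 1 ≤ α),
          1 - 1 / (n : ENNReal) ^ C ≤
            A.successProb d α (K * timeBound κ n (minEdges (IsShortcutReachable α d)))
              (fun E => IsShortcutReachable α d E ∧
                (E.card : ℝ) ≤ c * Real.log n * (minEdges (IsShortcutReachable α d) : ℝ))) ∧
      (∀ C : ℕ, ∃ (A : Algorithm) (K : ℝ),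
        ∀ (n : ℕ) (_ : 2 ≤ n) (d : Fin n → Fin n → ℝ) (_ : IsDistance d) (τ : ℝ) (_ : 0 ≤ τ),
          1 - 1 / (n : ENNReal) ^ C ≤
            A.successProb d τ (K * timeBound κ n (minEdges (IsMonotonic τ d)))
              (fun E => IsMonotonic τ d E ∧
                (E.card : ℝ) ≤ c * Real.log n * (minEdges (IsMonotonic τ d) : ℝ))) := by
  refine ⟨606, 2, fun C => ⟨approximation shortcutTest C, 500000 * (C + 4 : ℕ),
    fun n hn d hd α hα => ?_⟩, fun C => ⟨approximation monotonicTest C, 500000 * (C + 4 : ℕ),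
    fun n hn d hd τ hτ => ?_⟩⟩
  · refine successProb_approximation C hn (fun W => coverTest_shortcutTest W d α) ?_ ?_ ?_
    · exact fun i _ x _ y _ j _ h hyx => lt_of_le_of_lt hyx h
    · intro i j hij
      rw [natDist_coe, natDist_coe, hd.self]
      exact mul_pos (by positivity) (hd.pos i j hij)
    · exact fun E => by simp only [IsShortcutReachable, natDist_coe]
  · refine successProb_approximation C hn (fun W => coverTest_monotonicTest W d τ) ?_ ?_ ?_
    · rintro i - x hx y hy j hj h hyx
      -- If `x = j`, then `y` has distance at most `0` from `j`, and positivity off the diagonal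
      -- forces `y = j`.
      rcases h with rfl | h
      · left
        by_contra hne
        have h1 := hd.pos ⟨y, hy⟩ ⟨x, hx⟩ (fun h => hne (congrArg Fin.val h))
        rw [natDist_coe d ⟨y, hy⟩ ⟨x, hx⟩, natDist_coe d ⟨x, hx⟩ ⟨x, hx⟩, hd.self] at hyx
        linarith
      · exact Or.inr (lt_of_le_of_lt hyx h)
    · exact fun i j _ => Or.inl rfl
    · intro E
      simp only [IsMonotonic, natDist_coe, Fin.val_inj]
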